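/- **Setting.** Momenta are $k\in\mathbb R^4$. The legs of a vertex function carry a field with its $O(4)$ indices: a graviton $h_{\mu\nu}$ (symmetric in $\mu,\nu$; bosonic), a ghost $C_\mu$ or an antighost $\overline C_\mu$ (both Grassmann odd). Let $K:\mathbb R\to\mathbb R$ be a smooth cutoff function with $K(z)=1$ for $0\le z\le 1$ and $K(z)=0$ for $z\ge 4$. For real constants $A,B_1,B_2$ and a scale $\Lambda$ the regularized propagators are $$\Delta^\Lambda_{\mu\nu\rho\sigma}(k)=\tfrac12\,\frac{K(k^2/\Lambda^2)}{k^2+B_1}\big(\delta_{\mu\rho}\delta_{\nu\sigma}+\delta_{\mu\sigma}\delta_{\nu\rho}-\delta_{\mu\nu}\delta_{\rho\sigma}\big),\qquad \Delta^\Lambda_{GH\,\mu\nu}(k)=-\frac{K(k^2/\Lambda^2)}{k^2+B_2}\,\delta_{\mu\nu}.$$ *Flow.* The effective potential $L(h,C,\overline C;\Lambda)$ satisfies $$-\partial_\Lambda L=\int d^4k\,\tfrac{(2\pi)^4}{2}\,\partial_\Lambda\Delta^\Lambda_{\mu\nu\rho\sigma}\Big(\tfrac{\delta L}{\delta h_{\mu\nu}}\tfrac{\delta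 L}{\delta h_{\rho\sigma}}+\tfrac{\delta^2L}{\delta h_{\mu\nu}\delta h_{\rho\sigma}}+A\,\delta(k)\,\delta^{\mu\nu}\tfrac{\delta L}{\delta h_{\rho\sigma}}\Big)+\int d^4k\,(2\pi)^4\,\partial_\Lambda\Delta^\Lambda_{GH\,\mu\nu}\Big(\tfrac{\delta L}{\delta\overline C_\mu}\tfrac{\delta L}{\delta C_\nu}+\tfrac{\delta^2L}{\delta\overline C_\mu\delta C_\nu}\Big)$$ for $\Lambda_R\le\Lambda\le M_P$, where $0<\Lambda_R<M_P$ and $M_P$ (the Planck mass) is the UV cutoff. This is understood as the hierarchy of equations for its $n$-point vertex functions, $n\ge1$, defined by $\delta^4(k_1+\dots+k_n)\,L_n(k_1,\dots,k_n,\Lambda)=(2\pi)^{4n}\,\delta^nL/\delta\phi(k_1)\cdots\delta\phi(k_n)|_{\phi=0}$ on $k_1+\dots+k_n=0$, order by order in perturbation theory (below). The vertex functions are smooth in the momenta, graded symmetric under permutations of the legs, symmetric in the two indices of each graviton, $O(4)$-covariant, and of ghost number $0$. The constants satisfy $|A|\le\Lambda_R^3$, $|B_1|,|B_2|\le\Lambda_R^2$.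 *Couplings.* With $\partial^\mu_{i,j}=\partial/\partial k_i^\mu-\partial/\partial k_j^\mu$, the running couplings are the Taylor coefficients at zero momentum $$\rho_1=L_1(0),\ \ \rho_2=L_2(0),\ \ \rho_3=\partial_{1,2}^\mu\partial_{1,2}^\nu L_2|_0,\ \ \rho_4=L_3(0),\ \ \rho_5=L_4(0),\ \ \rho_6=\partial_{1,3}^\mu\partial_{1,3}^\nu L_3|_0,\ \ \rho_7=\partial_{1,3}^\mu\partial_{2,3}^\nu L_3|_0,\ \ \rho_8=L_5(0).$$ Each $\rho_i$ is a tuple $(\rho_i^1,\dots,\rho_i^{k_i})$: its components are the coordinates of the Taylor coefficient in a chosen basis of the (finite-dimensional) space of the values allowed by the symmetries (all field contents and tensor structures). *Perturbation theory.* The expansion parameters are the components of the renormalized couplings $\rho_4^R,\rho_5^R$ and of the bare couplings $\rho_6^0,\rho_7^0,\rho_8^0$, or equivalently of the dimensionless $\lambda_4^R=\Lambda^{-1}\rho_4^R$, $\lambda_5^R=\rho_5^R$, $\lambda_i^0=\Lambda\rho_i^0$ ($i=6,7,8$). The orders are multiindices $r=(r_1,\dots,r_5)$, with $|r_i|$ the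 sum of the entries of $r_i$, $|r|=|r_1|+\dots+|r_5|$ and $r_{NR}=|r_3|+|r_4|+|r_5|$. The coefficient of order $r$ of the dimensionless vertex function $A_n=\Lambda^{n-4}L_n$ in the dimensionless couplings is $A_n^{(r)}=\Lambda^{\,n-4+|r_1|-r_{NR}}L_n^{(r)}$, where $L_n^{(r)}$ is that of $L_n$ in the dimensionful ones. The order $r=0$ vanishes, and $L_n^{(r)}=0$ for $n>3|r|+2$. *Notation.* $\partial^p$ stands for any product of $p$ derivatives $\partial_{i,j}^\mu$; $\|f(\Lambda)\|$ is the maximum of $|f|$ over the momenta with $\sum_ik_i=0$ and $k_i^2\le4\Lambda^2$; $Pln(z)$ stands for some polynomial in $\ln z$ with nonnegative coefficients, which may depend on $n,p,r$ (and on $K$) only, not on the scales, on $A,B_1,B_2$, on $t$ or on the boundary data. Bounds are meant for all $n\ge1$, $p\ge0$, all $r$, all fields and indices on the legs, and all choices of $\partial^p$. **Theorem (Predictivity of Effective Quantum Gravity).** Let the vertex functions depend smoothly on $(\Lambda,t,k)$, where $t\in[0,1]$ parametrizes the bare data: for $n+p\ge6$, $$\partial^pA_n^{(r)}(M_P,t)=t\,\partial^pA_n^{(r)}(M_P,1).$$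 For all $t\in[0,1]$, and order by order in perturbation theory, let there be the renormalization conditions $$\rho_1(\Lambda_R)=\rho_2(\Lambda_R)=\rho_3(\Lambda_R)=0,\qquad \rho_4(\Lambda_R)=\rho_4^R,\quad\rho_5(\Lambda_R)=\rho_5^R,$$ and the improvement conditions $$\rho_i(\Lambda_R)=\rho_i^{NR},\qquad i=6,7,8,$$ with prescribed ($t$-independent) $\rho_i^{NR}$. Assume that for $\Lambda_R\le\Lambda\le M_P$, $t\in[0,1]$, $$\|\partial^pA_n^{(r)}(\Lambda,t)\|\le\Lambda^{-p}\Big(\frac{\Lambda}{\Lambda_R}\Big)^{|r_1|}\Big(\frac{M_P}{\Lambda}\Big)^{r_{NR}}Pln\Big(\frac{M_P}{\Lambda_R}\Big),$$ and that for $n+p\ge6$, $t\in[0,1]$, $$\Big\|\frac{d}{dt}\partial^pA_n^{(r)}(M_P,t)\Big\|\le M_P^{-p}\Big(\frac{M_P}{\Lambda_R}\Big)^{|r_1|}Pln\Big(\frac{M_P}{\Lambda_R}\Big).$$ Then, for $\Lambda_R\le\Lambda\le M_P$ and $t\in[0,1]$, $$\Big\|\frac{d}{dt}\partial^pA_n^{(r)}(\Lambda,t)\Big\|\le\Lambda^{-p}\Big(\frac{\Lambda}{\Lambda_R}\Big)^{|r_1|}\Big(\frac{M_P}{\Lambda}\Big)^{r_{NR}}\Big(\frac{\Lambda}{M_P}\Big)^{2}Pln\Big(\frac{M_P}{\Lambda_R}\Big),$$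 where the polynomials of the conclusion are determined by $K$ and by the polynomials of the two hypotheses, independently of all other data. -/

import Mathlib

open Polynomial Set MeasureTheory
open scoped ContDiff

noncomputable section

namespace GravFlow

/-- Euclidean four-momenta. -/
abbrev Mom := EuclideanSpace ℝ (Fin 4)

/-- The external legs of a vertex function: graviton `h_{μν}`, ghost `C_μ`, antighost `C̄_μ`. -/
inductive Leg
  | h (μ ν : Fin 4)
  | C (μ : Fin 4)
  | Cbar (μ : Fin 4)
  deriving DecidableEq, Fintype

/-- Ghost and antighost legs are the Grassmann-odd ones. -/
def Leg.IsGhost : Leg → Prop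
  | .h _ _ => False
  | .C _ => True
  | .Cbar _ => True

instance : DecidablePred Leg.IsGhost := fun a => by
  cases a <;> unfold Leg.IsGhost <;> infer_instance

/-- The ghost number of a leg: `+1` for `C`, `-1` for `C̄`, `0` for `h`. -/
def Leg.ghostNumber : Leg → ℤ
  | .h _ _ => 0
  | .C _ => 1
  | .Cbar _ => -1

/-- Exchange the two tensor indices of a graviton leg. -/
def Leg.flip : Leg → Leg
  | .h μ ν => .h ν μ
  | .C μ => .C μ
  | .Cbar μ => .Cbar μ

/-- A smooth cutoff function of `z = k² / Λ²`: equal to `1` for `0 ≤ z ≤ 1`, to `0` for `4 ≤ z`. -/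
structure IsCutoff (K : ℝ → ℝ) : Prop where
  smooth : ContDiff ℝ ∞ K
  eq_one : ∀ z ∈ Icc (0 : ℝ) 1, K z = 1
  eq_zero : ∀ z, 4 ≤ z → K z = 0

/-- The Kronecker symbol. -/
def kron (μ ν : Fin 4) : ℝ := if μ = ν then 1 else 0

/-- The regularized propagators: graviton propagator for a pair `(h, h)`, ghost propagator for a
pair `(C̄, C)`, and zero for every other ordered pair of legs. -/
def propagator (K : ℝ → ℝ) (B₁ B₂ Λ : ℝ) (q : Mom) : Leg → Leg → ℝ
  | .h μ ν, .h ρ σ => 2⁻¹ * K (‖q‖ ^ 2 / Λ ^ 2) *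
      (kron μ ρ * kron ν σ + kron μ σ * kron ν ρ - kron μ ν * kron ρ σ) / (‖q‖ ^ 2 + B₁)
  | .Cbar μ, .C ν => -(K (‖q‖ ^ 2 / Λ ^ 2) * kron μ ν / (‖q‖ ^ 2 + B₂))
  | _, _ => 0

/-- The scale derivative `dΔ^Λ/dΛ` of the propagator. -/
def propagatorDot (K : ℝ → ℝ) (B₁ B₂ Λ : ℝ) (q : Mom) (α β : Leg) : ℝ :=
  deriv (fun s => propagator K B₁ B₂ s q α β) Λ

/-- The prefactor of an internal line in the flow equation: `1/2` for the graviton, `1` for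
the ghosts. -/
def lineWeight : Leg → ℝ
  | .h _ _ => 2⁻¹
  | .C _ => 1
  | .Cbar _ => 1

/-- The `n`-point vertex functions, one for each assignment of fields and tensor indices to the
`n` legs. Only the values at momenta with `k₁ + ... + kₙ = 0` carry meaning; all the conditions
below refer to these values, smoothness being that of some extension. -/
abbrev Vertex (n : ℕ) := (Fin n → Leg) → (Fin n → Mom) → ℂ

/-- Restriction of a function on `{1, ..., n}` to the subset `I`, enumerated increasingly. -/
def sub {n : ℕ} {X : Type*} (I : Finset (Fin n)) (x : Fin n → X) : Fin I.card → X :=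
  fun i => x (I.orderEmbOfFin rfl i)

/-- Append one more entry. -/
def app {n : ℕ} {X : Type*} (x : Fin n → X) (y : X) : Fin (n + 1) → X :=
  Fin.snoc (α := fun _ => X) x y

section Symmetries

/-- Action of `R` on a momentum. -/
def rot (R : Matrix (Fin 4) (Fin 4) ℝ) (k : Mom) : Mom := Matrix.toEuclideanLin R k

/-- The matrix entries of the representation of `O(4)` on the indices of a leg. -/
def legRep (R : Matrix (Fin 4) (Fin 4) ℝ) : Leg → Leg → ℝ
  | .h μ ν, .h ρ σ => R μ ρ * R ν σ
  | .C μ, .C ν => R μ ν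
  | .Cbar μ, .Cbar ν => R μ ν
  | _, _ => 0

/-- The sign of the permutation induced by `σ` on the Grassmann-odd legs. -/
def permSign {n : ℕ} (a : Fin n → Leg) (σ : Equiv.Perm (Fin n)) : ℤ :=
  (-1) ^ (Finset.univ.filter fun x : Fin n × Fin n =>
    x.1 < x.2 ∧ σ x.2 < σ x.1 ∧ (a (σ x.1)).IsGhost ∧ (a (σ x.2)).IsGhost).card

/-- Smooth vertex functions with the symmetries of the theory: symmetric in the graviton legs,
antisymmetric in the ghost legs, symmetric in the two indices of `h_{μν}`, covariant under the
global group `O(4)`, and of ghost number zero. -/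
structure IsVertex {n : ℕ} (f : Vertex n) : Prop where
  smooth : ∀ a, ContDiff ℝ ∞ (f a)
  perm : ∀ (σ : Equiv.Perm (Fin n)) (a : Fin n → Leg) (k : Fin n → Mom), ∑ i, k i = 0 →
    f (a ∘ σ) (k ∘ σ) = (permSign a σ : ℂ) * f a k
  flip : ∀ (i : Fin n) (a : Fin n → Leg) (k : Fin n → Mom), ∑ i, k i = 0 →
    f (Function.update a i (a i).flip) k = f a k
  covariant : ∀ R ∈ Matrix.orthogonalGroup (Fin 4) ℝ, ∀ (a : Fin n → Leg) (k : Fin n → Mom),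
    ∑ i, k i = 0 →
    f a (fun i => rot R (k i)) = ∑ b : Fin n → Leg, ((∏ i, legRep R (a i) (b i) : ℝ) : ℂ) * f b k
  ghost : ∀ (a : Fin n → Leg) (k : Fin n → Mom), ∑ i, k i = 0 →
    ∑ i, (a i).ghostNumber ≠ 0 → f a k = 0

end Symmetries

section Derivatives

/-- The direction of the derivative `∂_{i,j}^μ = ∂/∂k_i^μ - ∂/∂k_j^μ`. -/
def dir {n : ℕ} (d : Fin n × Fin n × Fin 4) : Fin n → Mom :=
  Pi.single d.1 (EuclideanSpace.single d.2.2 1) - Pi.single d.2.1 (EuclideanSpace.single d.2.2 1)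

/-- The iterated derivative `∂^p = ∂_{i₁,j₁}^{μ₁} ⋯ ∂_{i_p,j_p}^{μ_p}`, where `p` is the length
of the list. -/
def momDeriv {n : ℕ} (l : List (Fin n × Fin n × Fin 4)) (g : (Fin n → Mom) → ℂ) :
    (Fin n → Mom) → ℂ :=
  l.foldr (fun d g k => lineDeriv ℝ g k (dir d)) g

end Derivatives

section Couplings

/-- The running couplings of canonical dimension at least `-1`. -/
inductive Coupling
  | rho1 | rho2 | rho3 | rho4 | rho5 | rho6 | rho7 | rho8

/-- The number of legs of the vertex function that defines a coupling. -/
def Coupling.legs : Coupling → ℕ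
  | .rho1 => 1
  | .rho2 => 2
  | .rho3 => 2
  | .rho4 => 3
  | .rho5 => 4
  | .rho6 => 3
  | .rho7 => 3
  | .rho8 => 5

/-- The pairs `(i, j)` of the derivatives `∂_{i,j}` in the definition of a coupling. -/
def Coupling.pattern : (c : Coupling) → List (Fin c.legs × Fin c.legs)
  | .rho1 => []
  | .rho2 => []
  | .rho3 => [((0 : Fin 2), (1 : Fin 2)), ((0 : Fin 2), (1 : Fin 2))]
  | .rho4 => []
  | .rho5 => []
  | .rho6 => [((0 : Fin 3), (2 : Fin 3)), ((0 : Fin 3), (2 : Fin 3))]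
  | .rho7 => [((0 : Fin 3), (2 : Fin 3)), ((1 : Fin 3), (2 : Fin 3))]
  | .rho8 => []

/-- The Taylor coefficient at zero momentum of an `n`-point function that belongs to a coupling,
with its dependence on the fields and tensor indices of the legs and of the derivatives. -/
def couplingTensor (c : Coupling) (f : Vertex c.legs) :
    (Fin c.legs → Leg) → (Fin c.pattern.length → Fin 4) → ℂ :=
  fun a μ => momDeriv (List.ofFn fun i => ((c.pattern.get i).1, (c.pattern.get i).2, μ i)) (f a) 0

/-- The space of all the Taylor coefficients that are allowed by the symmetries. -/
def couplingSpace (c : Coupling) :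
    Submodule ℂ ((Fin c.legs → Leg) → (Fin c.pattern.length → Fin 4) → ℂ) :=
  Submodule.span ℂ {T | ∃ f : Vertex c.legs, IsVertex f ∧ T = couplingTensor c f}

/-- The number of components of a coupling: the number of independent structures (field contents
and tensor structures) of the Taylor coefficient. -/
def numComp (c : Coupling) : ℕ := Module.finrank ℂ (couplingSpace c)

/-- A choice of independent structures for each coupling. -/
abbrev Structures := ∀ c : Coupling, Module.Basis (Fin (numComp c)) ℂ (couplingSpace c)

/-- The coupling `c` read off from the vertex function `f` is the tuple `ρ`. -/
def HasCoupling (b : Structures) (c : Coupling) (f : Vertex c.legs) (ρ : Fin (numComp c) → ℂ) :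
    Prop :=
  couplingTensor c f =
    ∑ j, ρ j • (b c j : (Fin c.legs → Leg) → (Fin c.pattern.length → Fin 4) → ℂ)

/-- The expansion parameters: the components of the renormalized couplings `4, 5` and of the bare
couplings `6, 7, 8`. -/
inductive Param
  | l4 (j : Fin (numComp .rho4))
  | l5 (j : Fin (numComp .rho5))
  | l6 (j : Fin (numComp .rho6))
  | l7 (j : Fin (numComp .rho7))
  | l8 (j : Fin (numComp .rho8))
  deriving DecidableEq

/-- Orders of perturbation theory: the multiindices `r = (r₁, ..., r₅)`. -/
abbrev PertOrder := Param →₀ ℕ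

/-- `|r₁|`, the order in the renormalized coupling `4`. -/
def ord1 (r : PertOrder) : ℕ := ∑ j, r (.l4 j)

/-- `r_NR = |r₃| + |r₄| + |r₅|`, the order in the bare couplings `6, 7, 8`. -/
def ordNR (r : PertOrder) : ℕ := ∑ j, r (.l6 j) + ∑ j, r (.l7 j) + ∑ j, r (.l8 j)

end Couplings

section Flow

/-- The sign of the tree term in which the legs in `I` are attached to the first factor (through
the internal leg `α`) and the other legs to the second factor. -/
def treeSign {n : ℕ} (a : Fin n → Leg) (I : Finset (Fin n)) (α : Leg) : ℤ :=
  (-1) ^ (Finset.univ.filter fun x : Fin n × Fin n =>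
      x.1 < x.2 ∧ x.1 ∉ I ∧ x.2 ∈ I ∧ (a x.1).IsGhost ∧ (a x.2).IsGhost).card *
    (if α.IsGhost then (-1) ^ (Finset.univ.filter fun i => i ∉ I ∧ (a i).IsGhost).card else 1)

/-- Tree term of the flow equation: the `n`-point part of `δL/δφ_α · dΔ/dΛ · δL/δφ_β`. -/
def treeTerm (K : ℝ → ℝ) (B₁ B₂ : ℝ) (L : PertOrder → ∀ n, Vertex n) (Λ : ℝ) (r : PertOrder)
    (n : ℕ) (a : Fin n → Leg) (k : Fin n → Mom) : ℂ :=
  (((2 * Real.pi) ^ 4)⁻¹ : ℝ) *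
    ∑ s ∈ Finset.HasAntidiagonal.antidiagonal r, ∑ I : Finset (Fin n), ∑ α : Leg, ∑ β : Leg,
      ((lineWeight α * propagatorDot K B₁ B₂ Λ (∑ i ∈ I, k i) α β : ℝ) : ℂ) *
        (treeSign a I α : ℂ) *
        L s.1 (I.card + 1) (app (sub I a) α) (app (sub I k) (-∑ i ∈ I, k i)) *
        L s.2 (Iᶜ.card + 1) (app (sub Iᶜ a) β) (app (sub Iᶜ k) (∑ i ∈ I, k i))

/-- Loop term of the flow equation: the `n`-point part of `dΔ/dΛ · δ²L/δφ_α δφ_β`. -/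
def loopTerm (K : ℝ → ℝ) (B₁ B₂ : ℝ) (L : PertOrder → ∀ n, Vertex n) (Λ : ℝ) (r : PertOrder)
    (n : ℕ) (a : Fin n → Leg) (k : Fin n → Mom) : ℂ :=
  (((2 * Real.pi) ^ 4)⁻¹ : ℝ) *
    ∫ q : Mom, ∑ α : Leg, ∑ β : Leg,
      ((lineWeight α * propagatorDot K B₁ B₂ Λ q α β : ℝ) : ℂ) *
        L r (n + 2) (app (app a α) β) (app (app k q) (-q))

/-- Term of the flow equation that comes from the linear term `A h(0)` of the total action. -/
def linearTerm (K : ℝ → ℝ) (A B₁ B₂ : ℝ) (L : PertOrder → ∀ n, Vertex n) (Λ : ℝ) (r : PertOrder)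
    (n : ℕ) (a : Fin n → Leg) (k : Fin n → Mom) : ℂ :=
  ∑ μ : Fin 4, ∑ ρ : Fin 4, ∑ σ : Fin 4,
    ((2⁻¹ * A * propagatorDot K B₁ B₂ Λ 0 (.h μ μ) (.h ρ σ) : ℝ) : ℂ) *
      L r (n + 1) (app a (.h ρ σ)) (app k 0)

/-- A family `L Λ t r n` of perturbative vertex functions (coefficients of the expansion in the
dimensionful couplings), depending on the scale `Λ ∈ [ΛR, MP]` and on a parameter `t ∈ [0, 1]`,
that solves the flow equation of the effective potential of gravity. -/
structure IsFlow (K : ℝ → ℝ) (A B₁ B₂ ΛR MP : ℝ)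
    (L : ℝ → ℝ → PertOrder → ∀ n, Vertex n) : Prop where
  smooth : ∀ (r : PertOrder) (n : ℕ) (a : Fin n → Leg), 1 ≤ n →
    ContDiffOn ℝ ∞ (fun x : ℝ × ℝ × (Fin n → Mom) => L x.1 x.2.1 r n a x.2.2)
      (Icc ΛR MP ×ˢ Icc (0 : ℝ) 1 ×ˢ univ)
  vertex : ∀ Λ ∈ Icc ΛR MP, ∀ t ∈ Icc (0 : ℝ) 1, ∀ (r : PertOrder) (n : ℕ), 1 ≤ n →
    IsVertex (L Λ t r n)
  order_zero : ∀ Λ ∈ Icc ΛR MP, ∀ t ∈ Icc (0 : ℝ) 1, ∀ (n : ℕ), 1 ≤ n →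
    ∀ (a : Fin n → Leg) (k : Fin n → Mom), ∑ i, k i = 0 → L Λ t 0 n a k = 0
  finite_legs : ∀ Λ ∈ Icc ΛR MP, ∀ t ∈ Icc (0 : ℝ) 1, ∀ (r : PertOrder) (n : ℕ),
    3 * r.degree + 2 < n →
    ∀ (a : Fin n → Leg) (k : Fin n → Mom), ∑ i, k i = 0 → L Λ t r n a k = 0
  flow : ∀ Λ ∈ Icc ΛR MP, ∀ t ∈ Icc (0 : ℝ) 1, ∀ (r : PertOrder) (n : ℕ), 1 ≤ n →
    ∀ (a : Fin n → Leg) (k : Fin n → Mom), ∑ i, k i = 0 →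
    HasDerivWithinAt (fun s => L s t r n a k)
      (-(treeTerm K B₁ B₂ (L Λ t) Λ r n a k + loopTerm K B₁ B₂ (L Λ t) Λ r n a k +
        linearTerm K A B₁ B₂ (L Λ t) Λ r n a k)) (Icc ΛR MP) Λ

end Flow

section Conditions

variable (ΛR MP : ℝ) (b : Structures) (L : ℝ → ℝ → PertOrder → ∀ n, Vertex n)

/-- The coefficients `A_n^{(r)} = Λ^{n - 4 + |r₁| - r_NR} L_n^{(r)}` of the expansion of the
dimensionless vertex functions in the dimensionless couplings. -/
def dimless (Λ t : ℝ) (r : PertOrder) (n : ℕ) : Vertex n :=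
  fun a k => ((Λ ^ ((n : ℤ) - 4 + ord1 r - ordNR r) : ℝ) : ℂ) * L Λ t r n a k

/-- `ρ₁ = ρ₂ = ρ₃ = 0` and `ρ₄ = ρ₄^R`, `ρ₅ = ρ₅^R` at the scale `ΛR`, order by order in the
expansion whose parameters are `ρ₄^R, ρ₅^R` and the bare couplings. -/
structure RenormalizationConditions : Prop where
  rho1 : ∀ t ∈ Icc (0 : ℝ) 1, ∀ r, HasCoupling b .rho1 (L ΛR t r 1) 0
  rho2 : ∀ t ∈ Icc (0 : ℝ) 1, ∀ r, HasCoupling b .rho2 (L ΛR t r 2) 0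
  rho3 : ∀ t ∈ Icc (0 : ℝ) 1, ∀ r, HasCoupling b .rho3 (L ΛR t r 2) 0
  rho4 : ∀ t ∈ Icc (0 : ℝ) 1, ∀ r, HasCoupling b .rho4 (L ΛR t r 3)
    fun j => if r = Finsupp.single (.l4 j) 1 then 1 else 0
  rho5 : ∀ t ∈ Icc (0 : ℝ) 1, ∀ r, HasCoupling b .rho5 (L ΛR t r 4)
    fun j => if r = Finsupp.single (.l5 j) 1 then 1 else 0

/-- `ρ₆, ρ₇, ρ₈` take prescribed values at the scale `ΛR`, order by order. -/
structure ImprovementConditions (ρNR : ∀ c : Coupling, PertOrder → Fin (numComp c) → ℂ) :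
    Prop where
  rho6 : ∀ t ∈ Icc (0 : ℝ) 1, ∀ r, HasCoupling b .rho6 (L ΛR t r 3) (ρNR .rho6 r)
  rho7 : ∀ t ∈ Icc (0 : ℝ) 1, ∀ r, HasCoupling b .rho7 (L ΛR t r 3) (ρNR .rho7 r)
  rho8 : ∀ t ∈ Icc (0 : ℝ) 1, ∀ r, HasCoupling b .rho8 (L ΛR t r 5) (ρNR .rho8 r)

/-- For `n + p ≥ 6` the bare data are proportional to `t`:
`∂^p A_n^{(r)}(MP, t) = t ∂^p A_n^{(r)}(MP, 1)`. -/
def BareShape : Prop :=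
  ∀ t ∈ Icc (0 : ℝ) 1, ∀ (r : PertOrder) (n : ℕ), 1 ≤ n →
    ∀ l : List (Fin n × Fin n × Fin 4), 6 ≤ n + l.length →
    ∀ (a : Fin n → Leg) (k : Fin n → Mom), ∑ i, k i = 0 →
      momDeriv l (dimless L MP t r n a) k = (t : ℂ) * momDeriv l (dimless L MP 1 r n a) k

end Conditions

/-- `‖f‖ ≤ c` for the norm `‖f‖ = max |f(k₁, ..., kₙ)|` over all momenta with
`k₁ + ... + kₙ = 0` and `k_i² ≤ 4 Λ²`. -/
def NormLE {n : ℕ} (Λ : ℝ) (f : (Fin n → Mom) → ℂ) (c : ℝ) : Prop :=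
  ∀ k : Fin n → Mom, ∑ i, k i = 0 → (∀ i, ‖k i‖ ^ 2 ≤ 4 * Λ ^ 2) → ‖f k‖ ≤ c

/-- Polynomials with nonnegative coefficients (to be evaluated at a logarithm). -/
def IsPln (P : ℝ[X]) : Prop := ∀ i, 0 ≤ P.coeff i

/-- `d/dt ∂^p A_n^{(r)}(Λ, t)`. -/
def tDeriv (L : ℝ → ℝ → PertOrder → ∀ n, Vertex n) (Λ t : ℝ) (r : PertOrder) (n : ℕ)
    (a : Fin n → Leg) (l : List (Fin n × Fin n × Fin 4)) (k : Fin n → Mom) : ℂ :=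
  derivWithin (fun s => momDeriv l (dimless L Λ s r n a) k) (Icc (0 : ℝ) 1) t

end GravFlow

end

open GravFlow

/-!
The derivative with respect to `t` is replaced by the difference `L(t) - L(t')` of two solutions,
divided by `|t - t'|`; a Lipschitz bound for the vertex functions bounds their derivative, and no
exchange of `d/dt` with the momentum derivatives is needed. In terms of the dimensionful functions
the bound to be shown is, for `p` momentum derivatives,
`|∂^p (L(t) - L(t'))| ≤ |t - t'| MP⁻² ΛR^{-|r₁|} MP^{r_NR} Λ^{6 - n - p} Pln`
on the domain of the norm (`LipBound`). The dependence on the order `r` is multiplicative in `r`.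

The difference satisfies a linear flow equation. In its tree terms both factors have nonzero order,
since vertex functions of order zero vanish, hence both have lower order than `r`; the loop term
contains the `(n + 2)`-point function of the same order; the linear term vanishes, since the
propagator at zero momentum does not depend on the scale. So the right-hand side is under control by
an induction that goes up in `|r|` and down in `n`, starting at `n > 3|r| + 2`
(`DiffSetting.flow_bound`, `exists_lipBound`). The scale derivative of the propagator is supported in
`Λ ≤ ‖q‖ ≤ 2Λ`, so that only momenta in the domain of the norm occur at the vertices. Its derivatives
are bounded by powers of `Λ` (`exists_lineFactor_bound`): the denominator `‖q‖² + B` may be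
arbitrarily close to zero at `‖q‖ = Λ`, but there the derivative of the cutoff function vanishes to
infinite order (`IsShell.flat`, `shellQuot_bound`). The denominator is positive for `Λ > ΛR`, and the
integration over `Λ` only needs the derivative in the open interval.

For `n + p ≥ 6` the flow equation is integrated downwards from `MP`, where the difference is
controlled by the hypothesis on the bare data, which are linear in `t` (`bare_difference`,
`lipBound_of_irrelevant`). For `n + p ≤ 5` it is integrated upwards from `ΛR` at zero momentum
(`lipBound_of_relevant`). There the difference vanishes: the renormalization and improvement
conditions fix the couplings, and the symmetries reduce all Taylor coefficients with `n + p ≤ 5` to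
these (`momDeriv_eq_zero_of_couplings`). Other momenta are reached by a Taylor estimate with one more
derivative, in a descending induction on `p`.
-/

namespace GravFlow

open Filter
open scoped Topology

/-! ### Iterated directional derivatives -/

section IteratedDerivative

variable {E E' F : Type*} [NormedAddCommGroup E] [NormedSpace ℝ E] [NormedAddCommGroup E']
  [NormedSpace ℝ E'] [NormedAddCommGroup F] [NormedSpace ℝ F] {ι ι' : Type*}

/-- The iterated directional derivative along the directions `w i`, `i` in the list `l`; the head
of the list is the outermost derivative. `momDeriv` is the case `w = dir`. -/
noncomputable def dirDeriv (w : ι → E) (l : List ι) (g : E → F) : E → F :=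
  l.foldr (fun i g x => lineDeriv ℝ g x (w i)) g

lemma momDeriv_eq_dirDeriv {n : ℕ} (l : List (Fin n × Fin n × Fin 4)) (g : (Fin n → Mom) → ℂ) :
    momDeriv l g = dirDeriv dir l g := rfl

@[simp] lemma dirDeriv_nil (w : ι → E) (g : E → F) : dirDeriv w [] g = g := rfl

lemma dirDeriv_cons (w : ι → E) (i : ι) (l : List ι) (g : E → F) :
    dirDeriv w (i :: l) g = fun x => lineDeriv ℝ (dirDeriv w l g) x (w i) := rfl

lemma dirDeriv_append (w : ι → E) (l l' : List ι) (g : E → F) :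
    dirDeriv w (l ++ l') g = dirDeriv w l (dirDeriv w l' g) := by
  simp [dirDeriv, List.foldr_append]

lemma dirDeriv_concat (w : ι → E) (l : List ι) (i : ι) (g : E → F) :
    dirDeriv w (l ++ [i]) g = dirDeriv w l (fun x => lineDeriv ℝ g x (w i)) :=
  dirDeriv_append w l [i] g

/-- Chain rule for an affine substitution. No differentiability is needed, since the restriction of
the function to each line is unchanged. -/
lemma dirDeriv_comp {w : ι → E} {w' : ι' → E'} {φ : E → E'} {τ : ι → ι'}
    (h : ∀ x (s : ℝ) i, φ (x + s • w i) = φ x + s • w' (τ i)) (l : List ι) (g : E' → F) :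
    dirDeriv w l (fun x => g (φ x)) = fun x => dirDeriv w' (l.map τ) g (φ x) := by
  induction l with
  | nil => rfl
  | cons i l ih =>
    rw [dirDeriv_cons, ih]
    funext x
    simp only [lineDeriv, List.map_cons, dirDeriv_cons, h]

/-- On a set that contains with each point the lines in the directions `w i`, the iterated
derivatives only depend on the values of the function on the set. -/
lemma dirDeriv_congr {w : ι → E} {S : Set E} (hS : ∀ x ∈ S, ∀ (s : ℝ) i, x + s • w i ∈ S)
    {f g : E → F} (hfg : ∀ x ∈ S, f x = g x) (l : List ι) :
    ∀ x ∈ S, dirDeriv w l f x = dirDeriv w l g x := by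
  induction l with
  | nil => exact hfg
  | cons i l ih =>
    intro x hx
    simp only [dirDeriv_cons, lineDeriv]
    congr 1
    funext s
    exact ih _ (hS x hx s i)

lemma dirDeriv_eventuallyEq {w : ι → E} {f g : E → F} {x : E} (h : f =ᶠ[𝓝 x] g) (l : List ι) :
    dirDeriv w l f =ᶠ[𝓝 x] dirDeriv w l g := by
  induction l with
  | nil => exact h
  | cons i l ih =>
    filter_upwards [ih.eventuallyEq_nhds] with y hy
    exact hy.lineDeriv_eq

lemma dirDeriv_zero (w : ι → E) (l : List ι) : dirDeriv w l (fun _ => (0 : F)) = fun _ => 0 := by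
  induction l with
  | nil => rfl
  | cons i l ih => rw [dirDeriv_cons, ih]; funext x; simp [lineDeriv]

lemma contDiff_lineDeriv {f : E → F} (hf : ContDiff ℝ ∞ f) (v : E) :
    ContDiff ℝ ∞ (fun x => lineDeriv ℝ f x v) := by
  have h : (fun x => lineDeriv ℝ f x v) = fun x => fderiv ℝ f x v := by
    funext x
    exact ((hf.differentiable (by simp)) x).lineDeriv_eq_fderiv
  rw [h]
  exact (hf.fderiv_right (m := ∞) (by simp)).clm_apply contDiff_const

lemma contDiff_dirDeriv {f : E → F} (hf : ContDiff ℝ ∞ f) (w : ι → E) (l : List ι) :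
    ContDiff ℝ ∞ (dirDeriv w l f) := by
  induction l with
  | nil => exact hf
  | cons i l ih => exact contDiff_lineDeriv ih _

lemma lineDeriv_add_of_contDiff {f g : E → F} (hf : ContDiff ℝ ∞ f) (hg : ContDiff ℝ ∞ g) (x v : E) :
    lineDeriv ℝ (fun y => f y + g y) x v = lineDeriv ℝ f x v + lineDeriv ℝ g x v := by
  have h1 := (hf.differentiable (by simp)) x
  have h2 := (hg.differentiable (by simp)) x
  rw [h1.lineDeriv_eq_fderiv, h2.lineDeriv_eq_fderiv, (h1.fun_add h2).lineDeriv_eq_fderiv,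
    fderiv_fun_add h1 h2]
  rfl

lemma dirDeriv_add {f g : E → F} (hf : ContDiff ℝ ∞ f) (hg : ContDiff ℝ ∞ g) (w : ι → E)
    (l : List ι) :
    dirDeriv w l (fun x => f x + g x) = fun x => dirDeriv w l f x + dirDeriv w l g x := by
  induction l with
  | nil => rfl
  | cons i l ih =>
    rw [dirDeriv_cons, ih]
    funext x
    exact lineDeriv_add_of_contDiff (contDiff_dirDeriv hf w l) (contDiff_dirDeriv hg w l) x _

lemma dirDeriv_sum {κ : Type*} (s : Finset κ) {f : κ → E → F} (hf : ∀ j ∈ s, ContDiff ℝ ∞ (f j))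
    (w : ι → E) (l : List ι) :
    dirDeriv w l (fun x => ∑ j ∈ s, f j x) = fun x => ∑ j ∈ s, dirDeriv w l (f j) x := by
  classical
  induction s using Finset.induction_on with
  | empty => simpa using dirDeriv_zero w l
  | insert j s hj ih =>
    simp only [Finset.sum_insert hj]
    rw [dirDeriv_add (hf j (by simp))
      (ContDiff.sum fun i hi => hf i (Finset.mem_insert_of_mem hi)),
      ih fun i hi => hf i (Finset.mem_insert_of_mem hi)]

/-- Scalar factors can be pulled out, also when the function is not differentiable. -/
lemma dirDeriv_const_mul {E : Type*} [NormedAddCommGroup E] [NormedSpace ℝ E]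
    (c : ℂ) (f : E → ℂ) (w : ι → E) (l : List ι) :
    dirDeriv w l (fun x => c * f x) = fun x => c * dirDeriv w l f x := by
  induction l with
  | nil => rfl
  | cons i l ih =>
    rw [dirDeriv_cons, ih]
    funext x
    simp only [lineDeriv, dirDeriv_cons]
    exact deriv_const_mul_field c

lemma dirDeriv_sub {E : Type*} [NormedAddCommGroup E] [NormedSpace ℝ E]
    {f g : E → ℂ} (hf : ContDiff ℝ ∞ f) (hg : ContDiff ℝ ∞ g) (w : ι → E) (l : List ι) :
    dirDeriv w l (fun x => f x - g x) = fun x => dirDeriv w l f x - dirDeriv w l g x := by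
  have h : (fun x => f x - g x) = fun x => f x + (-1) * g x := by funext x; ring
  rw [h, dirDeriv_add hf (contDiff_const.mul hg), dirDeriv_const_mul]
  funext x; ring

/-- The bound that the Leibniz rule gives for the derivatives of order `p` of a product, in terms of
bounds `x i`, `y j` for the derivatives of order `i`, `j` of the factors. -/
def leib {R : Type*} [Semiring R] : ℕ → (ℕ → R) → (ℕ → R) → R
  | 0, x, y => x 0 * y 0
  | p + 1, x, y => leib p (fun i => x (i + 1)) y + leib p x (fun i => y (i + 1))

lemma leib_nonneg (p : ℕ) : ∀ {x y : ℕ → ℝ}, (∀ i, 0 ≤ x i) → (∀ i, 0 ≤ y i) →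
    0 ≤ leib p x y := by
  induction p with
  | zero => intro x y hx hy; exact mul_nonneg (hx 0) (hy 0)
  | succ p ih =>
    intro x y hx hy
    exact add_nonneg (ih (fun i => hx _) hy) (ih hx fun i => hy _)

lemma leib_scale (p : ℕ) : ∀ (c d z : ℝ) (x y : ℕ → ℝ),
    leib p (fun i => c * z ^ i * x i) (fun i => d * z ^ i * y i) = c * d * z ^ p * leib p x y := by
  induction p with
  | zero => intro c d z x y; simp [leib]; ring
  | succ p ih =>
    intro c d z x y
    have h1 := ih (c * z) d z (fun i => x (i + 1)) y
    have h2 := ih c (d * z) z x (fun i => y (i + 1))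
    simp only [leib]
    have e1 : (fun i => c * z ^ (i + 1) * x (i + 1)) = fun i => c * z * z ^ i * x (i + 1) := by
      funext i; ring
    have e2 : (fun i => d * z ^ (i + 1) * y (i + 1)) = fun i => d * z * z ^ i * y (i + 1) := by
      funext i; ring
    rw [e1, e2, h1, h2]
    ring

lemma leib_map {R S : Type*} [Semiring R] [Semiring S] (φ : R →+* S) (p : ℕ) :
    ∀ x y : ℕ → R, φ (leib p x y) = leib p (fun i => φ (x i)) (fun i => φ (y i)) := by
  induction p with
  | zero => intro x y; simp [leib]
  | succ p ih => intro x y; simp [leib, ih]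

lemma norm_dirDeriv_mul_le {E : Type*} [NormedAddCommGroup E] [NormedSpace ℝ E]
    {w : ι → E} {k : E} (l : List ι) :
    ∀ {f g : E → ℂ} {x y : ℕ → ℝ}, ContDiff ℝ ∞ f → ContDiff ℝ ∞ g →
      (∀ l' : List ι, ‖dirDeriv w l' f k‖ ≤ x l'.length) →
      (∀ l' : List ι, ‖dirDeriv w l' g k‖ ≤ y l'.length) →
      ‖dirDeriv w l (fun z => f z * g z) k‖ ≤ leib l.length x y := by
  induction l using List.reverseRecOn with
  | nil =>
    intro f g x y hf hg hx hy
    simp only [dirDeriv_nil, norm_mul, List.length_nil, leib]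
    exact mul_le_mul (hx []) (hy []) (norm_nonneg _) ((norm_nonneg _).trans (hx []))
  | append_singleton l i ih =>
    intro f g x y hf hg hx hy
    have hprod : (fun z => lineDeriv ℝ (fun z => f z * g z) z (w i)) =
        fun z => lineDeriv ℝ f z (w i) * g z + f z * lineDeriv ℝ g z (w i) := by
      funext z
      have h1 := (hf.differentiable (by simp)) z
      have h2 := (hg.differentiable (by simp)) z
      rw [h1.lineDeriv_eq_fderiv, h2.lineDeriv_eq_fderiv, (h1.fun_mul h2).lineDeriv_eq_fderiv,
        fderiv_fun_mul h1 h2]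
      simp; ring
    have hf' := contDiff_lineDeriv hf (w i)
    have hg' := contDiff_lineDeriv hg (w i)
    rw [dirDeriv_concat, hprod, dirDeriv_add (hf'.mul hg) (hf.mul hg')]
    simp only [List.length_append, List.length_singleton, leib]
    refine (norm_add_le _ _).trans (add_le_add (ih hf' hg ?_ hy) (ih hf hg' hx ?_))
    · intro l'
      rw [← dirDeriv_concat]
      simpa using hx (l' ++ [i])
    · intro l'
      rw [← dirDeriv_concat]
      simpa using hy (l' ++ [i])

end IteratedDerivative

/-! ### Derivative bounds for the propagator -/

section Propagator

/-- Smooth functions on momentum space that vanish outside the shell `1 ≤ ‖x‖ ≤ 2`. -/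
structure IsShell {F : Type*} [NormedAddCommGroup F] [NormedSpace ℝ F] (f : Mom → F) : Prop where
  smooth : ContDiff ℝ ∞ f
  inner : ∀ x, ‖x‖ < 1 → f x = 0
  outer : ∀ x, 2 < ‖x‖ → f x = 0

variable {F : Type} [NormedAddCommGroup F] [NormedSpace ℝ F]

lemma IsShell.eventually_inner {f : Mom → F} (hf : IsShell f) {x : Mom} (hx : ‖x‖ < 1) :
    f =ᶠ[𝓝 x] fun _ => 0 := by
  filter_upwards [continuous_norm.continuousAt.eventually_lt (continuousAt_const (y := (1 : ℝ))) hx]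
    with y hy using hf.inner y hy

lemma IsShell.eventually_outer {f : Mom → F} (hf : IsShell f) {x : Mom} (hx : 2 < ‖x‖) :
    f =ᶠ[𝓝 x] fun _ => 0 := by
  filter_upwards [(continuousAt_const (y := (2 : ℝ))).eventually_lt continuous_norm.continuousAt hx]
    with y hy using hf.outer y hy

lemma IsShell.fderiv {f : Mom → F} (hf : IsShell f) : IsShell (fderiv ℝ f) where
  smooth := hf.smooth.fderiv_right (m := ∞) (by simp)
  inner x hx := by rw [(hf.eventually_inner hx).fderiv_eq]; simp
  outer x hx := by rw [(hf.eventually_outer hx).fderiv_eq]; simp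

lemma IsShell.lineDeriv {f : Mom → F} (hf : IsShell f) (v : Mom) :
    IsShell (fun x => lineDeriv ℝ f x v) where
  smooth := contDiff_lineDeriv hf.smooth v
  inner x hx := by rw [(hf.eventually_inner hx).lineDeriv_eq]; simp [_root_.lineDeriv]
  outer x hx := by rw [(hf.eventually_outer hx).lineDeriv_eq]; simp [_root_.lineDeriv]

lemma IsShell.smul {f : Mom → F} (hf : IsShell f) {a : Mom → ℝ} (ha : ContDiff ℝ ∞ a) :
    IsShell (fun x => a x • f x) where
  smooth := ha.smul hf.smooth
  inner x hx := by rw [hf.inner x hx, smul_zero]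
  outer x hx := by rw [hf.outer x hx, smul_zero]

lemma IsShell.eq_zero_of_norm_eq_one {f : Mom → F} (hf : IsShell f) {x : Mom} (hx : ‖x‖ = 1) :
    f x = 0 := by
  have h : Set.EqOn f (fun _ => 0) (closure (Metric.ball (0 : Mom) 1)) :=
    Set.EqOn.closure (fun y hy => hf.inner y (by simpa using hy)) hf.smooth.continuous
      continuous_const
  rw [closure_ball _ one_ne_zero] at h
  exact h (by simp [hx])

lemma IsShell.bounded {f : Mom → F} (hf : IsShell f) : ∃ C, 0 ≤ C ∧ ∀ x, ‖f x‖ ≤ C := by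
  obtain ⟨C, hC⟩ := (isCompact_closedBall (0 : Mom) 2).exists_bound_of_continuousOn
    hf.smooth.continuous.continuousOn
  have hC0 : 0 ≤ C := (norm_nonneg _).trans (hC 0 (by simp))
  refine ⟨C, hC0, fun x => ?_⟩
  by_cases hx : ‖x‖ ≤ 2
  · exact hC x (by simpa using hx)
  · rw [hf.outer x (not_le.mp hx), norm_zero]; exact hC0

/-- A smooth function supported in the shell vanishes to infinite order at its inner boundary. -/
lemma IsShell.flat (m : ℕ) : ∀ {F : Type} [NormedAddCommGroup F] [NormedSpace ℝ F] {f : Mom → F},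
    IsShell f → ∃ C, 0 ≤ C ∧ ∀ x, 1 ≤ ‖x‖ → ‖f x‖ ≤ C * (‖x‖ - 1) ^ m := by
  induction m with
  | zero =>
    intro F _ _ f hf
    obtain ⟨C, h0, hC⟩ := hf.bounded
    exact ⟨C, h0, fun x _ => by simpa using hC x⟩
  | succ m ih =>
    intro F _ _ f hf
    obtain ⟨C, h0, hC⟩ := ih hf.fderiv
    refine ⟨C, h0, fun x hx => ?_⟩
    have hxpos : 0 < ‖x‖ := by linarith
    -- compare with the value at the point of the unit sphere on the same ray
    set y : Mom := ‖x‖⁻¹ • x with hy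
    have hy1 : ‖y‖ = 1 := by rw [hy, norm_smul, norm_inv, norm_norm, inv_mul_cancel₀ hxpos.ne']
    have hseg : ∀ z ∈ segment ℝ y x, ‖_root_.fderiv ℝ f z‖ ≤ C * (‖x‖ - 1) ^ m := by
      rintro z ⟨a, b, ha, hb, hab, rfl⟩
      have hz : a • y + b • x = (a * ‖x‖⁻¹ + b) • x := by rw [hy, smul_smul, add_smul]
      have hn : ‖a • y + b • x‖ = a + b * ‖x‖ := by
        rw [hz, norm_smul, Real.norm_of_nonneg (by positivity), add_mul, mul_assoc,
          inv_mul_cancel₀ hxpos.ne', mul_one]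
      have h1 : 1 ≤ ‖a • y + b • x‖ := by rw [hn]; nlinarith
      have h2 : ‖a • y + b • x‖ ≤ ‖x‖ := by rw [hn]; nlinarith
      refine (hC _ h1).trans (mul_le_mul_of_nonneg_left ?_ h0)
      exact pow_le_pow_left₀ (by linarith) (by linarith) m
    have hmv := (convex_segment y x).norm_image_sub_le_of_norm_fderiv_le
      (fun z _ => (hf.smooth.differentiable (by simp)) z) hseg
      (left_mem_segment ℝ y x) (right_mem_segment ℝ y x)
    rw [hf.eq_zero_of_norm_eq_one hy1, sub_zero] at hmv
    have hxy : ‖x - y‖ = ‖x‖ - 1 := by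
      have : x - y = (1 - ‖x‖⁻¹) • x := by rw [hy, sub_smul, one_smul]
      rw [this, norm_smul, Real.norm_of_nonneg (by
        have := inv_le_one_of_one_le₀ hx
        linarith), sub_mul, one_mul, inv_mul_cancel₀ hxpos.ne']
    rw [hxy] at hmv
    calc ‖f x‖ ≤ _ := hmv
      _ = _ := by ring

/-- A shell function divided by a power of `‖x‖² + β`. -/
noncomputable def shellQuot (β : ℝ) (m : ℕ) (f : Mom → F) (x : Mom) : F :=
  ((‖x‖ ^ 2 + β) ^ m)⁻¹ • f x

lemma shellQuot_contDiff {f : Mom → F} (hf : IsShell f) {β : ℝ} (hβ : -1 < β) (m : ℕ) :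
    ContDiff ℝ ∞ (shellQuot β m f) := by
  rw [contDiff_iff_contDiffAt]
  intro x
  by_cases hx : ‖x‖ < 1
  · have h : shellQuot β m f =ᶠ[𝓝 x] fun _ => 0 := by
      filter_upwards [hf.eventually_inner hx] with y hy
      rw [shellQuot, hy, smul_zero]
    exact (contDiffAt_const).congr_of_eventuallyEq h
  · have hpos : 0 < ‖x‖ ^ 2 + β := by nlinarith
    refine ContDiffAt.smul (ContDiffAt.inv ?_ (by positivity)) hf.smooth.contDiffAt
    exact (((contDiff_norm_sq ℝ).add contDiff_const).pow m).contDiffAt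

lemma lineDeriv_shellQuot {f : Mom → F} (hf : IsShell f) {β : ℝ} (hβ : -1 < β) (m : ℕ) (v x : Mom) :
    lineDeriv ℝ (shellQuot β m f) x v =
      shellQuot β m (fun x => lineDeriv ℝ f x v) x +
        shellQuot β (m + 1) (fun x => (-(2 * m * inner ℝ x v)) • f x) x := by
  by_cases hx : ‖x‖ < 1
  · have h : shellQuot β m f =ᶠ[𝓝 x] fun _ => 0 := by
      filter_upwards [hf.eventually_inner hx] with y hy
      rw [shellQuot, hy, smul_zero]
    rw [h.lineDeriv_eq, shellQuot, shellQuot, (hf.lineDeriv v).inner x hx, hf.inner x hx]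
    simp [lineDeriv]
  · have hpos : 0 < ‖x‖ ^ 2 + β := by nlinarith
    have h1 : HasFDerivAt (fun x : Mom => ‖x‖ ^ 2 + β) ((2 : ℝ) • (innerSL ℝ x)) x := by
      have := (hasStrictFDerivAt_norm_sq x).hasFDerivAt.add_const β
      refine this.congr_fderiv ?_
      ext v; simp [two_smul]
    have h2 := (hasDerivAt_pow m (‖x‖ ^ 2 + β)).comp_hasFDerivAt x h1
    have h3 := ((hasDerivAt_inv (pow_pos hpos m).ne').comp_hasFDerivAt x h2)
    have h4 := h3.smul ((hf.smooth.differentiable (by simp)) x).hasFDerivAt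
    have h5 := h4.hasLineDerivAt v
    have h6 : lineDeriv ℝ f x v = fderiv ℝ f x v :=
      ((hf.smooth.differentiable (by simp)) x).lineDeriv_eq_fderiv
    refine (h5.lineDeriv).trans ?_
    simp only [shellQuot, h6, Function.comp]
    simp [smul_smul]
    congr 1
    cases m with
    | zero => simp
    | succ m =>
      simp
      field_simp
      ring

/-- The derivatives of `f / (‖x‖² + β)^m` are bounded uniformly in the mass parameter `β > -1`,
although the denominator may come arbitrarily close to zero at the inner boundary of the shell. -/
lemma shellQuot_bound {ι : Type*} (w : ι → Mom) (l : List ι) : ∀ {f : Mom → F}, IsShell f →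
    ∀ m : ℕ, ∃ C, 0 ≤ C ∧ ∀ β, -1 < β → ∀ x, ‖dirDeriv w l (shellQuot β m f) x‖ ≤ C := by
  induction l using List.reverseRecOn with
  | nil =>
    intro f hf m
    obtain ⟨C, h0, hC⟩ := hf.flat m
    refine ⟨C, h0, fun β hβ x => ?_⟩
    rw [dirDeriv_nil, shellQuot]
    rcases le_or_gt ‖x‖ 1 with hx | hx
    · have : f x = 0 := by
        rcases hx.lt_or_eq with h | h
        · exact hf.inner x h
        · exact hf.eq_zero_of_norm_eq_one h
      rw [this, smul_zero, norm_zero]; exact h0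
    · have hpos : 0 < ‖x‖ ^ 2 + β := by nlinarith
      rw [norm_smul, norm_inv, norm_pow, Real.norm_of_nonneg hpos.le, inv_mul_le_iff₀ (by positivity)]
      refine (hC x hx.le).trans ?_
      rw [mul_comm]
      refine mul_le_mul_of_nonneg_right ?_ h0
      exact pow_le_pow_left₀ (by linarith) (by nlinarith) m
  | append_singleton l i ih =>
    intro f hf m
    have hg : IsShell (fun x => (-(2 * m * inner ℝ x (w i)) : ℝ) • f x) :=
      hf.smul ((contDiff_const.mul (contDiff_id.inner ℝ contDiff_const)).neg)
    obtain ⟨C₁, h1, hC₁⟩ := ih (hf.lineDeriv (w i)) m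
    obtain ⟨C₂, h2, hC₂⟩ := ih hg (m + 1)
    refine ⟨C₁ + C₂, add_nonneg h1 h2, fun β hβ x => ?_⟩
    have he : (fun x => lineDeriv ℝ (shellQuot β m f) x (w i)) = fun x =>
        shellQuot β m (fun x => lineDeriv ℝ f x (w i)) x +
        shellQuot β (m + 1) (fun x => (-(2 * m * inner ℝ x (w i)) : ℝ) • f x) x := by
      funext x; exact lineDeriv_shellQuot hf hβ m (w i) x
    rw [dirDeriv_concat, he, dirDeriv_add (shellQuot_contDiff (hf.lineDeriv (w i)) hβ m)
      (shellQuot_contDiff hg hβ (m + 1))]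
    exact (norm_add_le _ _).trans (add_le_add (hC₁ β hβ x) (hC₂ β hβ x))

/-- The numerator `K'(z) z`, `z = ‖x‖²`, of the scale derivative of the propagators, as a function
of the rescaled momentum. -/
noncomputable def cutoffShell (K : ℝ → ℝ) (x : Mom) : ℂ := ((deriv K (‖x‖ ^ 2) * ‖x‖ ^ 2 : ℝ) : ℂ)

lemma isShell_cutoffShell {K : ℝ → ℝ} (hK : IsCutoff K) : IsShell (cutoffShell K) where
  smooth := by
    have h : ContDiff ℝ ∞ (deriv K) := hK.smooth.deriv'
    exact Complex.ofRealCLM.contDiff.comp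
      ((h.comp (contDiff_norm_sq ℝ)).mul (contDiff_norm_sq ℝ))
  inner x hx := by
    rcases eq_or_ne x 0 with rfl | h0
    · simp [cutoffShell]
    · have hx0 : 0 < ‖x‖ := norm_pos_iff.mpr h0
      have : K =ᶠ[𝓝 (‖x‖ ^ 2)] fun _ => 1 := by
        filter_upwards [Ioo_mem_nhds (show (0 : ℝ) < ‖x‖ ^ 2 by positivity)
          (show ‖x‖ ^ 2 < 1 by nlinarith)] with z hz using hK.eq_one z ⟨hz.1.le, hz.2.le⟩
      simp [cutoffShell, this.deriv_eq]
  outer x hx := by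
    have : K =ᶠ[𝓝 (‖x‖ ^ 2)] fun _ => 0 := by
      filter_upwards [Ioi_mem_nhds (show (4 : ℝ) < ‖x‖ ^ 2 by nlinarith)] with z hz
        using hK.eq_zero z (le_of_lt hz)
    simp [cutoffShell, this.deriv_eq]

lemma abs_kron_le (μ ν : Fin 4) : |kron μ ν| ≤ 1 := by
  unfold kron; split_ifs <;> simp

lemma hasDerivAt_cutoff {K : ℝ → ℝ} (hK : IsCutoff K) {Λ : ℝ} (hΛ : 0 < Λ) (u : ℝ) :
    HasDerivAt (fun s => K (u / s ^ 2)) (-2 * (Λ ^ 3)⁻¹ * (deriv K (u / Λ ^ 2) * u)) Λ := by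
  have h1 : HasDerivAt (fun s : ℝ => u / s ^ 2) (-2 * (Λ ^ 3)⁻¹ * u) Λ := by
    have h2 := ((hasDerivAt_pow 2 Λ).inv (by positivity)).const_mul u
    simp only [div_eq_mul_inv]
    refine h2.congr_deriv ?_
    simp
    field_simp
  have h3 := ((hK.smooth.differentiable (by simp)) (u / Λ ^ 2)).hasDerivAt.comp Λ h1
  exact h3.congr_deriv (by ring)

/-- The complex factor of an internal line in the flow equation. -/
noncomputable def lineFactor (K : ℝ → ℝ) (B₁ B₂ Λ : ℝ) (α β : Leg) (q : Mom) : ℂ :=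
  ((lineWeight α * propagatorDot K B₁ B₂ Λ q α β : ℝ) : ℂ)

lemma shell_scaling (K : ℝ → ℝ) (B : ℝ) {Λ : ℝ} (hΛ : 0 < Λ) (q : Mom) :
    shellQuot (B / Λ ^ 2) 1 (cutoffShell K) (Λ⁻¹ • q) =
      ((deriv K (‖q‖ ^ 2 / Λ ^ 2) * ‖q‖ ^ 2 / (‖q‖ ^ 2 + B) : ℝ) : ℂ) := by
  have hn : ‖Λ⁻¹ • q‖ ^ 2 = ‖q‖ ^ 2 / Λ ^ 2 := by
    rw [norm_smul, norm_inv, Real.norm_of_nonneg hΛ.le]; field_simp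
  rw [shellQuot, cutoffShell, hn, ← add_div, pow_one, Complex.real_smul, ← Complex.ofReal_mul]
  congr 1
  rcases eq_or_ne (‖q‖ ^ 2 + B) 0 with h | h
  · simp [h]
  · field_simp

/-- Scaling form of the scale derivative of a propagator: up to a bounded numerical factor it is
`Λ⁻³` times a shell quotient in the rescaled momentum. -/
lemma lineFactor_eq {K : ℝ → ℝ} (hK : IsCutoff K) (B₁ B₂ : ℝ) {Λ : ℝ} (hΛ : 0 < Λ) (α β : Leg) :
    ∃ e B : ℝ, |e| ≤ 2 ∧ (B = B₁ ∨ B = B₂) ∧ lineFactor K B₁ B₂ Λ α β = fun q =>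
      ((e * (Λ ^ 3)⁻¹ : ℝ) : ℂ) * shellQuot (B / Λ ^ 2) 1 (cutoffShell K) (Λ⁻¹ • q) := by
  have hzero : ∀ α β, (∀ s q, propagator K B₁ B₂ s q α β = 0) →
      ∃ e B : ℝ, |e| ≤ 2 ∧ (B = B₁ ∨ B = B₂) ∧ lineFactor K B₁ B₂ Λ α β = fun q =>
      ((e * (Λ ^ 3)⁻¹ : ℝ) : ℂ) * shellQuot (B / Λ ^ 2) 1 (cutoffShell K) (Λ⁻¹ • q) := by
    intro α β h
    refine ⟨0, B₁, by simp, Or.inl rfl, ?_⟩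
    funext q
    simp [lineFactor, propagatorDot, h]
  cases α with
  | h μ ν =>
    cases β with
    | h ρ σ =>
      refine ⟨-2⁻¹ * (kron μ ρ * kron ν σ + kron μ σ * kron ν ρ - kron μ ν * kron ρ σ), B₁, ?_,
        Or.inl rfl, ?_⟩
      · have hb : ∀ a b c d, |kron a b * kron c d| ≤ 1 := fun a b c d => by
          rw [abs_mul]
          exact mul_le_one₀ (abs_kron_le _ _) (abs_nonneg _) (abs_kron_le _ _)
        have h1 := abs_le.mp (hb μ ρ ν σ)
        have h2 := abs_le.mp (hb μ σ ν ρ)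
        have h3 := abs_le.mp (hb μ ν ρ σ)
        rw [abs_le]
        constructor <;> linarith [h1.1, h1.2, h2.1, h2.2, h3.1, h3.2]
      · funext q
        have hd := (((hasDerivAt_cutoff hK hΛ (‖q‖ ^ 2)).const_mul 2⁻¹).mul_const
          (kron μ ρ * kron ν σ + kron μ σ * kron ν ρ - kron μ ν * kron ρ σ)).div_const
          (‖q‖ ^ 2 + B₁)
        rw [shell_scaling K B₁ hΛ, ← Complex.ofReal_mul, lineFactor]
        simp only [propagatorDot, propagator, lineWeight]
        rw [hd.deriv]
        congr 1
        ring
    | C ρ => exact hzero _ _ fun _ _ => rfl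
    | Cbar ρ => exact hzero _ _ fun _ _ => rfl
  | C μ => exact hzero _ _ fun _ _ => by cases β <;> rfl
  | Cbar μ =>
    cases β with
    | h ρ σ => exact hzero _ _ fun _ _ => rfl
    | Cbar ρ => exact hzero _ _ fun _ _ => rfl
    | C ρ =>
      refine ⟨2 * kron μ ρ, B₂, ?_, Or.inr rfl, ?_⟩
      · rw [abs_mul]
        have := abs_kron_le μ ρ
        norm_num
        linarith
      · funext q
        have hd := (((hasDerivAt_cutoff hK hΛ (‖q‖ ^ 2)).mul_const
          (kron μ ρ)).div_const (‖q‖ ^ 2 + B₂)).fun_neg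
        rw [shell_scaling K B₂ hΛ, ← Complex.ofReal_mul, lineFactor]
        simp only [propagatorDot, propagator, lineWeight]
        rw [hd.deriv]
        congr 1
        ring

/-- The directions in which the momentum of an internal line varies when the external momenta vary
in a direction `dir (i, j, μ)`; the two flags say whether `i` and `j` are among the legs on one side
of the line. -/
noncomputable def lineDir (d : Bool × Bool × Fin 4) : Mom :=
  ((if d.1 then 1 else 0) - (if d.2.1 then 1 else 0) : ℝ) • EuclideanSpace.single d.2.2 1

/-- Uniform bounds for the momentum derivatives of the propagator of an internal line. The
mass parameters are required to be strictly below the scale, so that denominators are positive. -/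
lemma exists_lineFactor_bound {K : ℝ → ℝ} (hK : IsCutoff K) :
    ∃ c : ℕ → ℝ, (∀ p, 0 ≤ c p) ∧ ∀ B₁ B₂ Λ : ℝ, 0 < Λ → |B₁| < Λ ^ 2 → |B₂| < Λ ^ 2 →
      ∀ α β, ContDiff ℝ ∞ (lineFactor K B₁ B₂ Λ α β) ∧
        (∀ q, 2 * Λ < ‖q‖ → lineFactor K B₁ B₂ Λ α β q = 0) ∧
        ∀ l q, ‖dirDeriv lineDir l (lineFactor K B₁ B₂ Λ α β) q‖ ≤
          (Λ ^ 3)⁻¹ * Λ⁻¹ ^ l.length * c l.length := by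
  have hf := isShell_cutoffShell hK
  choose C hC0 hC using fun l => shellQuot_bound lineDir l hf 1
  have hbdd : ∀ p : ℕ, ∃ M, 0 ≤ M ∧ ∀ l : List (Bool × Bool × Fin 4), l.length = p → C l ≤ M := by
    intro p
    obtain ⟨M, hM⟩ := ((List.finite_length_eq (Bool × Bool × Fin 4) p).image C).bddAbove
    exact ⟨max M 0, le_max_right _ _, fun l hl => (hM ⟨l, hl, rfl⟩).trans (le_max_left _ _)⟩
  choose M hM0 hM using hbdd
  refine ⟨fun p => 2 * M p, fun p => mul_nonneg zero_le_two (hM0 p), ?_⟩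
  intro B₁ B₂ Λ hΛ hB₁ hB₂ α β
  obtain ⟨e, B, he, hB, hl⟩ := lineFactor_eq hK B₁ B₂ hΛ α β
  have hβ : -1 < B / Λ ^ 2 := by
    have : |B| < Λ ^ 2 := by rcases hB with rfl | rfl <;> assumption
    rw [lt_div_iff₀ (by positivity)]
    linarith [(abs_lt.mp this).1]
  have hs := shellQuot_contDiff hf hβ 1
  refine ⟨?_, fun q hq => ?_, fun l q => ?_⟩
  · rw [hl]
    exact contDiff_const.mul (hs.comp (contDiff_const_smul _))
  · have : 2 < ‖Λ⁻¹ • q‖ := by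
      rw [norm_smul, norm_inv, Real.norm_of_nonneg hΛ.le, lt_inv_mul_iff₀ hΛ]
      linarith
    simp [hl, shellQuot, hf.outer _ this]
  · have key : ∀ l : List (Bool × Bool × Fin 4),
        dirDeriv lineDir l (fun q => shellQuot (B / Λ ^ 2) 1 (cutoffShell K) (Λ⁻¹ • q)) =
        fun q => ((Λ⁻¹ ^ l.length : ℝ) : ℂ) *
          dirDeriv lineDir l (shellQuot (B / Λ ^ 2) 1 (cutoffShell K)) (Λ⁻¹ • q) := by
      intro l
      induction l with
      | nil => simp
      | cons i l ih =>
        rw [dirDeriv_cons, ih]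
        funext q
        have h1 := dirDeriv_comp (w := lineDir) (w' := fun i => Λ⁻¹ • lineDir i) (τ := id)
          (φ := fun q : Mom => Λ⁻¹ • q) (fun x s i => by rw [smul_add, smul_comm]; rfl) [i]
          (fun q => ((Λ⁻¹ ^ l.length : ℝ) : ℂ) *
            dirDeriv lineDir l (shellQuot (B / Λ ^ 2) 1 (cutoffShell K)) q)
        have h2 := congrFun h1 q
        simp only [dirDeriv_cons, dirDeriv_nil, List.map_cons, List.map_nil, id] at h2
        rw [h2, lineDeriv_smul]
        simp only [lineDeriv, dirDeriv_cons, List.length_cons, pow_succ]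
        rw [deriv_const_mul_field, Complex.real_smul]
        push_cast
        ring
    rw [hl, dirDeriv_const_mul, key]
    simp only [norm_mul, Complex.norm_real, norm_inv, norm_pow, Real.norm_of_nonneg hΛ.le]
    have h1 := (hC l _ hβ (Λ⁻¹ • q)).trans (hM _ l rfl)
    rw [Real.norm_eq_abs]
    have h3 : 0 ≤ Λ⁻¹ ^ l.length := by positivity
    have h4 : 0 ≤ (Λ ^ 3)⁻¹ := by positivity
    calc |e| * (Λ ^ 3)⁻¹ * (Λ⁻¹ ^ l.length * _) ≤ 2 * (Λ ^ 3)⁻¹ * (Λ⁻¹ ^ l.length * M l.length) := by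
          gcongr
      _ = _ := by ring

end Propagator

/-! ### Exchange of scale and momentum derivatives -/

section Exchange

variable {E : Type*} [NormedAddCommGroup E] [NormedSpace ℝ E] {ι : Type*} {a b : ℝ}
  {F : ℝ × E → ℂ}

lemma uniqueDiffOn_strip (hab : a < b) : UniqueDiffOn ℝ (Icc a b ×ˢ (univ : Set E)) :=
  (uniqueDiffOn_Icc hab).prod uniqueDiffOn_univ

lemma contDiff_slice (hF : ContDiffOn ℝ ∞ F (Icc a b ×ˢ univ)) {s : ℝ} (hs : s ∈ Icc a b) :
    ContDiff ℝ ∞ (fun k => F (s, k)) := by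
  rw [← contDiffOn_univ]
  exact hF.comp ((contDiff_const.prodMk contDiff_id).contDiffOn) fun k _ => ⟨hs, mem_univ _⟩

lemma lineDeriv_slice (hF : ContDiffOn ℝ ∞ F (Icc a b ×ˢ univ)) {s : ℝ}
    (hs : s ∈ Icc a b) (k v : E) :
    lineDeriv ℝ (fun k => F (s, k)) k v = fderivWithin ℝ F (Icc a b ×ˢ univ) (s, k) (0, v) := by
  have h1 : HasFDerivWithinAt F (fderivWithin ℝ F (Icc a b ×ˢ univ) (s, k)) (Icc a b ×ˢ univ)
      (s, k) := ((hF.differentiableOn (by simp)) _ ⟨hs, mem_univ _⟩).hasFDerivWithinAt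
  have h2 : HasFDerivAt (fun k : E => (s, k)) (ContinuousLinearMap.inr ℝ ℝ E) k :=
    hasFDerivAt_prodMk_right s k
  have h3 := h1.comp_hasFDerivAt k h2 (Eventually.of_forall fun y => ⟨hs, mem_univ _⟩)
  simpa [Function.comp_def] using (h3.hasLineDerivAt v).lineDeriv

lemma hasDerivWithinAt_slice (hF : ContDiffOn ℝ ∞ F (Icc a b ×ˢ univ)) {s : ℝ}
    (hs : s ∈ Icc a b) (k : E) :
    HasDerivWithinAt (fun s => F (s, k)) (fderivWithin ℝ F (Icc a b ×ˢ univ) (s, k) (1, 0))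
      (Icc a b) s := by
  have h1 : HasFDerivWithinAt F (fderivWithin ℝ F (Icc a b ×ˢ univ) (s, k)) (Icc a b ×ˢ univ)
      (s, k) := ((hF.differentiableOn (by simp)) _ ⟨hs, mem_univ _⟩).hasFDerivWithinAt
  have h2 : HasFDerivWithinAt (fun s : ℝ => (s, k)) (ContinuousLinearMap.inl ℝ ℝ E) (Icc a b) s :=
    (hasFDerivAt_prodMk_left s k).hasFDerivWithinAt
  have h3 := h1.comp s h2 (show MapsTo _ (Icc a b) (Icc a b ×ˢ univ) from fun y hy => ⟨hy, mem_univ _⟩)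
  simpa [Function.comp_def] using h3.hasDerivWithinAt

lemma contDiffOn_fderivWithin_apply (hab : a < b) (hF : ContDiffOn ℝ ∞ F (Icc a b ×ˢ univ))
    (u : ℝ × E) :
    ContDiffOn ℝ ∞ (fun p => fderivWithin ℝ F (Icc a b ×ˢ univ) p u) (Icc a b ×ˢ univ) :=
  (hF.fderivWithin (m := ∞) (uniqueDiffOn_strip hab) (by simp)).clm_apply contDiffOn_const

lemma contDiffOn_lineDeriv_slice (hab : a < b) (hF : ContDiffOn ℝ ∞ F (Icc a b ×ˢ univ)) (v : E) :
    ContDiffOn ℝ ∞ (fun p : ℝ × E => lineDeriv ℝ (fun k => F (p.1, k)) p.2 v)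
      (Icc a b ×ˢ univ) :=
  (contDiffOn_fderivWithin_apply hab hF (0, v)).congr fun p hp => lineDeriv_slice hF hp.1 p.2 v

lemma contDiffOn_derivWithin_slice (hab : a < b) (hF : ContDiffOn ℝ ∞ F (Icc a b ×ˢ univ)) :
    ContDiffOn ℝ ∞ (fun p : ℝ × E => derivWithin (fun s => F (s, p.2)) (Icc a b) p.1)
      (Icc a b ×ˢ univ) :=
  (contDiffOn_fderivWithin_apply hab hF (1, 0)).congr fun p hp =>
    (hasDerivWithinAt_slice hF hp.1 p.2).derivWithin (uniqueDiffOn_Icc hab _ hp.1)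

lemma derivWithin_lineDeriv_comm (hab : a < b) (hF : ContDiffOn ℝ ∞ F (Icc a b ×ˢ univ)) {s : ℝ}
    (hs : s ∈ Icc a b) (k v : E) :
    derivWithin (fun s => lineDeriv ℝ (fun k => F (s, k)) k v) (Icc a b) s =
      lineDeriv ℝ (fun k => derivWithin (fun s => F (s, k)) (Icc a b) s) k v := by
  set S : Set (ℝ × E) := Icc a b ×ˢ univ with hS
  have hu : UniqueDiffOn ℝ S := uniqueDiffOn_strip hab
  have hp : (s, k) ∈ S := ⟨hs, mem_univ _⟩
  have hud := uniqueDiffOn_Icc hab s hs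
  have e1 : derivWithin (fun s => lineDeriv ℝ (fun k => F (s, k)) k v) (Icc a b) s =
      fderivWithin ℝ (fun p => fderivWithin ℝ F S p (0, v)) S (s, k) (1, 0) := by
    rw [← (hasDerivWithinAt_slice (contDiffOn_fderivWithin_apply hab hF (0, v)) hs k).derivWithin hud]
    exact derivWithin_congr (fun y hy => lineDeriv_slice hF hy k v) (lineDeriv_slice hF hs k v)
  have e2 : lineDeriv ℝ (fun k => derivWithin (fun s => F (s, k)) (Icc a b) s) k v =
      fderivWithin ℝ (fun p => fderivWithin ℝ F S p (1, 0)) S (s, k) (0, v) := by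
    rw [← lineDeriv_slice (contDiffOn_fderivWithin_apply hab hF (1, 0)) hs k v]
    congr 1
    funext k
    exact (hasDerivWithinAt_slice hF hs k).derivWithin hud
  have hd : DifferentiableWithinAt ℝ (fderivWithin ℝ F S) S (s, k) :=
    (hF.fderivWithin (m := ∞) hu (by simp)).differentiableOn (by simp) _ hp
  have hsymm : IsSymmSndFDerivWithinAt ℝ F S (s, k) := by
    refine (hF _ hp).isSymmSndFDerivWithinAt (by
      simpa using (WithTop.coe_le_coe.mpr le_top : ((2 : ℕ∞) : ℕ∞ω) ≤ ∞)) hu ?_ hp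
    rw [hS, interior_prod_eq, interior_Icc, interior_univ, closure_prod_eq, closure_Ioo hab.ne,
      closure_univ]
    exact hp
  have hclm : ∀ u u' : ℝ × E, fderivWithin ℝ (fun p => fderivWithin ℝ F S p u) S (s, k) u' =
      fderivWithin ℝ (fderivWithin ℝ F S) S (s, k) u' u := by
    intro u u'
    rw [fderivWithin_clm_apply (hu _ hp) hd (differentiableWithinAt_const u)]
    simp
  rw [e1, e2, hclm, hclm]
  exact hsymm _ _

/-- The scale derivative commutes with iterated momentum derivatives. -/
lemma hasDerivWithinAt_dirDeriv (hab : a < b) (w : ι → E) (l : List ι) : ∀ {F : ℝ × E → ℂ},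
    ContDiffOn ℝ ∞ F (Icc a b ×ˢ univ) → ∀ {s : ℝ}, s ∈ Icc a b → ∀ k : E,
    HasDerivWithinAt (fun s => dirDeriv w l (fun k => F (s, k)) k)
      (dirDeriv w l (fun k => derivWithin (fun s => F (s, k)) (Icc a b) s) k) (Icc a b) s := by
  induction l using List.reverseRecOn with
  | nil =>
    intro F hF s hs k
    exact (hasDerivWithinAt_slice hF hs k).differentiableWithinAt.hasDerivWithinAt
  | append_singleton l i ih =>
    intro F hF s hs k
    simp only [dirDeriv_concat]
    have h := ih (contDiffOn_lineDeriv_slice hab hF (w i)) hs k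
    refine h.congr_deriv ?_
    congr 1
    funext k
    exact derivWithin_lineDeriv_comm hab hF hs k (w i)

/-- Mean value inequality for a function that is only differentiable inside the interval, with a
bound that varies over the interval. -/
lemma norm_sub_le_of_deriv_le {f f' : ℝ → ℂ} {B B' : ℝ → ℝ} (hab : a ≤ b)
    (hf : ContinuousOn f (Icc a b)) (hf' : ∀ x ∈ Ioo a b, HasDerivAt f (f' x) x)
    (hB : ContinuousOn B (Icc a b)) (hB' : ∀ x ∈ Ioo a b, HasDerivAt B (B' x) x)
    (bound : ∀ x ∈ Ioo a b, ‖f' x‖ ≤ B' x) : ‖f b - f a‖ ≤ B b - B a := by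
  rcases hab.eq_or_lt with rfl | hlt
  · simp
  have key : ∀ c ∈ Ioo a b, ‖f b - f c‖ ≤ B b - B c := by
    intro c hc
    have hsub : Icc c b ⊆ Icc a b := Icc_subset_Icc hc.1.le le_rfl
    have h := image_norm_le_of_norm_deriv_right_le_deriv_boundary' (a := c) (b := b)
      (f := fun x => f x - f c) (f' := f') (B := fun x => B x - B c) (B' := B')
      ((hf.mono hsub).sub continuousOn_const)
      (fun x hx => ((hf' x ⟨hc.1.trans_le hx.1, hx.2⟩).sub_const _).hasDerivWithinAt)
      (by simp) ((hB.mono hsub).sub continuousOn_const)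
      (fun x hx => ((hB' x ⟨hc.1.trans_le hx.1, hx.2⟩).sub_const _).hasDerivWithinAt)
      (fun x hx => bound x ⟨hc.1.trans_le hx.1, hx.2⟩)
    exact h (right_mem_Icc.mpr hc.2.le)
  have hmem : Ioo a b ∈ 𝓝[>] a := Ioo_mem_nhdsGT hlt
  have hle : 𝓝[>] a ≤ 𝓝[Icc a b] a := by
    rw [nhdsWithin_le_iff]
    exact mem_of_superset hmem Ioo_subset_Icc_self
  have t1 : Tendsto (fun c => ‖f b - f c‖) (𝓝[>] a) (𝓝 ‖f b - f a‖) :=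
    (tendsto_const_nhds.sub ((hf a (left_mem_Icc.mpr hab)).mono_left hle)).norm
  have t2 : Tendsto (fun c => B b - B c) (𝓝[>] a) (𝓝 (B b - B a)) :=
    tendsto_const_nhds.sub ((hB a (left_mem_Icc.mpr hab)).mono_left hle)
  exact le_of_tendsto_of_tendsto t1 t2 (by filter_upwards [hmem] with c hc using key c hc)

end Exchange

/-! ### Substitution of momenta at the vertices -/

section Routing

/-- Momentum configurations entering the norm at scale `Λ`: total momentum zero, `k_i² ≤ 4 Λ²`. -/
def InDomain {n : ℕ} (Λ : ℝ) (k : Fin n → Mom) : Prop :=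
  ∑ i, k i = 0 ∧ ∀ i, ‖k i‖ ^ 2 ≤ 4 * Λ ^ 2

variable {n : ℕ}

lemma InDomain.mono {Λ Λ' : ℝ} {k : Fin n → Mom} (h : InDomain Λ k) (h0 : 0 ≤ Λ) (hΛ : Λ ≤ Λ') :
    InDomain Λ' k :=
  ⟨h.1, fun i => (h.2 i).trans (by nlinarith)⟩

lemma sum_dir (d : Fin n × Fin n × Fin 4) : ∑ i, dir d i = 0 := by
  simp [dir, Finset.sum_sub_distrib]

lemma sum_add_smul_dir {x : Fin n → Mom} (hx : ∑ i, x i = 0) (s : ℝ) (d : Fin n × Fin n × Fin 4) :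
    ∑ i, (x + s • dir d) i = 0 := by
  simp [Finset.sum_add_distrib, hx, ← Finset.smul_sum, sum_dir]

lemma momDeriv_congr {f g : (Fin n → Mom) → ℂ} (h : ∀ k, ∑ i, k i = 0 → f k = g k)
    (l : List (Fin n × Fin n × Fin 4)) {k : Fin n → Mom} (hk : ∑ i, k i = 0) :
    momDeriv l f k = momDeriv l g k :=
  dirDeriv_congr (w := dir) (S := {k | ∑ i, k i = 0})
    (fun _ hx s d => sum_add_smul_dir hx s d) h l k hk

@[simp] lemma app_castSucc {X : Type*} (x : Fin n → X) (y : X) (i : Fin n) :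
    app x y i.castSucc = x i := by simp [app]

@[simp] lemma app_last {X : Type*} (x : Fin n → X) (y : X) : app x y (Fin.last n) = y := by
  simp [app]

/-- The slot that an external leg takes at a vertex with the external legs in `I` and one internal
leg. Legs outside `I` are sent to the internal leg, through which their momenta flow. -/
noncomputable def slot (I : Finset (Fin n)) (i : Fin n) : Fin (I.card + 1) :=
  if h : i ∈ I then ((I.orderIsoOfFin rfl).symm ⟨i, h⟩).castSucc else Fin.last _

/-- The action of `slot` on the labels of the derivatives. -/
noncomputable def slotDir (I : Finset (Fin n)) (d : Fin n × Fin n × Fin 4) :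
    Fin (I.card + 1) × Fin (I.card + 1) × Fin 4 := (slot I d.1, slot I d.2.1, d.2.2)

lemma sub_single (I : Finset (Fin n)) (i : Fin n) (v : Mom) (j : Fin I.card) :
    sub I (Pi.single i v : Fin n → Mom) j = (Pi.single (slot I i) v : _ → Mom) j.castSucc := by
  unfold sub slot
  split_ifs with h
  · by_cases hj : I.orderEmbOfFin rfl j = i
    · have : (I.orderIsoOfFin rfl).symm ⟨i, h⟩ = j := by
        rw [OrderIso.symm_apply_eq]
        ext
        simp [← hj]
      rw [hj, this]; simp
    · have : j.castSucc ≠ ((I.orderIsoOfFin rfl).symm ⟨i, h⟩).castSucc := by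
        intro hc
        apply hj
        have h2 := Fin.castSucc_injective _ hc
        rw [h2, ← Finset.coe_orderIsoOfFin_apply, OrderIso.apply_symm_apply]
      rw [Pi.single_eq_of_ne hj, Pi.single_eq_of_ne this]
  · have h1 : I.orderEmbOfFin rfl j ≠ i := fun hc => h (hc ▸ Finset.orderEmbOfFin_mem I rfl j)
    rw [Pi.single_eq_of_ne h1, Pi.single_eq_of_ne (Fin.castSucc_lt_last j).ne]

lemma sum_single_mem (I : Finset (Fin n)) (i : Fin n) (v : Mom) :
    ∑ j ∈ I, (Pi.single i v : Fin n → Mom) j = if i ∈ I then v else 0 := by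
  simp

lemma slot_eq_last (I : Finset (Fin n)) (i : Fin n) : slot I i = Fin.last _ ↔ i ∉ I := by
  unfold slot
  split_ifs with h
  · simp [h]
  · simp [h]

lemma single_slot_last (I : Finset (Fin n)) (i : Fin n) (v : Mom) :
    (Pi.single (slot I i) v : _ → Mom) (Fin.last _) = if i ∈ I then 0 else v := by
  by_cases h : i ∈ I
  · rw [if_pos h, Pi.single_eq_of_ne]
    intro hc
    exact (slot_eq_last I i).mp hc.symm h
  · rw [if_neg h, (slot_eq_last I i).mpr h, Pi.single_eq_same]

lemma dir_apply {m : ℕ} (d : Fin m × Fin m × Fin 4) (j : Fin m) :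
    dir d j = (Pi.single d.1 (EuclideanSpace.single d.2.2 1) : Fin m → Mom) j -
      (Pi.single d.2.1 (EuclideanSpace.single d.2.2 1) : Fin m → Mom) j := rfl

lemma sub_dir (I : Finset (Fin n)) (d : Fin n × Fin n × Fin 4) (j : Fin I.card) :
    dir d (I.orderEmbOfFin rfl j) = dir (slotDir I d) j.castSucc := by
  rw [dir_apply, dir_apply]
  exact congrArg₂ _ (sub_single I d.1 _ j) (sub_single I d.2.1 _ j)

lemma sum_dir_mem (I : Finset (Fin n)) (d : Fin n × Fin n × Fin 4) :
    ∑ j ∈ I, dir d j = lineDir (decide (d.1 ∈ I), decide (d.2.1 ∈ I), d.2.2) := by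
  simp only [dir_apply, Finset.sum_sub_distrib, sum_single_mem, lineDir, decide_eq_true_eq]
  split_ifs <;> simp

lemma dir_slotDir_last (I : Finset (Fin n)) (d : Fin n × Fin n × Fin 4) :
    dir (slotDir I d) (Fin.last _) = -∑ j ∈ I, dir d j := by
  rw [dir_apply]
  simp only [slotDir, single_slot_last, dir_apply, Finset.sum_sub_distrib, sum_single_mem]
  split_ifs <;> simp

lemma sum_line (I : Finset (Fin n)) (x : Fin n → Mom) (s : ℝ) (d : Fin n × Fin n × Fin 4) :
    ∑ i ∈ I, (x + s • dir d) i =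
      ∑ i ∈ I, x i + s • lineDir (decide (d.1 ∈ I), decide (d.2.1 ∈ I), d.2.2) := by
  rw [← sum_dir_mem, Finset.smul_sum, ← Finset.sum_add_distrib]
  rfl

lemma route_left (I : Finset (Fin n)) (x : Fin n → Mom) (s : ℝ) (d : Fin n × Fin n × Fin 4) :
    app (sub I (x + s • dir d)) (-∑ i ∈ I, (x + s • dir d) i) =
      app (sub I x) (-∑ i ∈ I, x i) + s • dir (slotDir I d) := by
  funext j
  induction j using Fin.lastCases with
  | last =>
    rw [Pi.add_apply, Pi.smul_apply, app_last, app_last, dir_slotDir_last, sum_line, sum_dir_mem]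
    simp; abel
  | cast j =>
    rw [Pi.add_apply, Pi.smul_apply, app_castSucc, app_castSucc, ← sub_dir]
    rfl

lemma route_right (I : Finset (Fin n)) (x : Fin n → Mom) (s : ℝ) (d : Fin n × Fin n × Fin 4) :
    app (sub Iᶜ (x + s • dir d)) (∑ i ∈ I, (x + s • dir d) i) =
      app (sub Iᶜ x) (∑ i ∈ I, x i) + s • dir (slotDir Iᶜ d) := by
  have h0 : -∑ j ∈ Iᶜ, dir d j = ∑ j ∈ I, dir d j := by
    rw [neg_eq_iff_add_eq_zero, add_comm, Finset.sum_add_sum_compl, sum_dir]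
  funext j
  induction j using Fin.lastCases with
  | last =>
    rw [Pi.add_apply, Pi.smul_apply, app_last, app_last, dir_slotDir_last, h0, sum_line, sum_dir_mem]
  | cast j =>
    rw [Pi.add_apply, Pi.smul_apply, app_castSucc, app_castSucc, ← sub_dir]
    rfl

/-- The action on the labels of derivatives of adding the two legs of a loop. -/
def loopDir (d : Fin n × Fin n × Fin 4) : Fin (n + 2) × Fin (n + 2) × Fin 4 :=
  (d.1.castSucc.castSucc, d.2.1.castSucc.castSucc, d.2.2)

lemma single_castSucc {m : ℕ} (i : Fin m) (v : Mom) (j : Fin m) :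
    (Pi.single i.castSucc v : Fin (m + 1) → Mom) j.castSucc = (Pi.single i v : Fin m → Mom) j := by
  simp [Pi.single_apply]

lemma route_loop (q : Mom) (x : Fin n → Mom) (s : ℝ) (d : Fin n × Fin n × Fin 4) :
    app (app (x + s • dir d) q) (-q) = app (app x q) (-q) + s • dir (loopDir d) := by
  funext j
  induction j using Fin.lastCases with
  | last => simp [dir_apply, loopDir]
  | cast j =>
    induction j using Fin.lastCases with
    | last => simp [dir_apply, loopDir]
    | cast j => simp [dir_apply, loopDir, single_castSucc]

lemma contDiff_app {E : Type*} [NormedAddCommGroup E] [NormedSpace ℝ E] {f : E → Fin n → Mom}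
    {g : E → Mom} (hf : ContDiff ℝ ∞ f) (hg : ContDiff ℝ ∞ g) :
    ContDiff ℝ ∞ (fun x => app (f x) (g x)) := by
  rw [contDiff_pi]
  intro j
  induction j using Fin.lastCases with
  | last => simpa using hg
  | cast j => simpa using (contDiff_pi.mp hf) j

lemma contDiff_sub (I : Finset (Fin n)) : ContDiff ℝ ∞ (fun k : Fin n → Mom => sub I k) :=
  contDiff_pi.mpr fun _ => contDiff_apply ℝ Mom _

lemma contDiff_lineMom (I : Finset (Fin n)) :
    ContDiff ℝ ∞ (fun k : Fin n → Mom => ∑ i ∈ I, k i) :=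
  ContDiff.sum fun _ _ => contDiff_apply ℝ Mom _

lemma sum_sub_eq (I : Finset (Fin n)) (k : Fin n → Mom) : ∑ j, sub I k j = ∑ i ∈ I, k i := by
  rw [← Finset.sum_coe_sort I, ← (I.orderIsoOfFin rfl).toEquiv.sum_comp]
  rfl

lemma sum_app (x : Fin n → Mom) (y : Mom) : ∑ i, app x y i = ∑ i, x i + y := by
  rw [Fin.sum_univ_castSucc]; simp

lemma sum_left (I : Finset (Fin n)) (k : Fin n → Mom) :
    ∑ i, app (sub I k) (-∑ i ∈ I, k i) i = 0 := by
  rw [sum_app, sum_sub_eq]; simp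

lemma sum_right (I : Finset (Fin n)) {k : Fin n → Mom} (hk : ∑ i, k i = 0) :
    ∑ i, app (sub Iᶜ k) (∑ i ∈ I, k i) i = 0 := by
  rw [sum_app, sum_sub_eq, Finset.sum_compl_add_sum, hk]

lemma sum_loop {k : Fin n → Mom} (hk : ∑ i, k i = 0) (q : Mom) :
    ∑ i, app (app k q) (-q) i = 0 := by
  rw [sum_app, sum_app, hk]; simp

lemma InDomain.loop {Λ : ℝ} {k : Fin n → Mom} (hk : InDomain Λ k) {q : Mom} (hΛ : 0 ≤ Λ)
    (hq : ‖q‖ ≤ 2 * Λ) : InDomain Λ (app (app k q) (-q)) := by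
  have hq2 : ‖q‖ ^ 2 ≤ 4 * Λ ^ 2 := by nlinarith [norm_nonneg q]
  refine ⟨sum_loop hk.1 q, fun j => ?_⟩
  induction j using Fin.lastCases with
  | last => simpa using hq2
  | cast j =>
    induction j using Fin.lastCases with
    | last => simpa using hq2
    | cast j => simpa using hk.2 j

lemma InDomain.left {Λ : ℝ} {k : Fin n → Mom} (hk : InDomain Λ k) (I : Finset (Fin n)) (hΛ : 0 ≤ Λ)
    (hq : ‖∑ i ∈ I, k i‖ ≤ 2 * Λ) : InDomain Λ (app (sub I k) (-∑ i ∈ I, k i)) := by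
  refine ⟨sum_left I k, fun j => ?_⟩
  induction j using Fin.lastCases with
  | last => rw [app_last, norm_neg]; nlinarith [norm_nonneg (∑ i ∈ I, k i)]
  | cast j => rw [app_castSucc]; exact hk.2 _

lemma InDomain.right {Λ : ℝ} {k : Fin n → Mom} (hk : InDomain Λ k) (I : Finset (Fin n)) (hΛ : 0 ≤ Λ)
    (hq : ‖∑ i ∈ I, k i‖ ≤ 2 * Λ) : InDomain Λ (app (sub Iᶜ k) (∑ i ∈ I, k i)) := by
  refine ⟨sum_right I hk.1, fun j => ?_⟩
  induction j using Fin.lastCases with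
  | last => rw [app_last]; nlinarith [norm_nonneg (∑ i ∈ I, k i)]
  | cast j => rw [app_castSucc]; exact hk.2 _

end Routing

/-! ### Bounds for the terms of the flow equation -/

section Terms

variable {n : ℕ}

/-- The bound `c Λ^{-p} x_p` for the derivatives of order `p` of an `n`-point function. -/
def DerivBound (Λ c : ℝ) (x : ℕ → ℝ) (X : (Fin n → Mom) → ℂ) : Prop :=
  ∀ (l : List (Fin n × Fin n × Fin 4)) (k : Fin n → Mom), InDomain Λ k →
    ‖momDeriv l X k‖ ≤ c * Λ⁻¹ ^ l.length * x l.length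

/-- Two vertices joined by a line. Only momenta `‖q‖ ≤ 2 Λ` of the line contribute, and for these
the momenta at both vertices lie in the domain of the norm at scale `Λ`. -/
lemma tree_bound {Λ : ℝ} (hΛ : 0 < Λ) {D : Mom → ℂ} (hD : ContDiff ℝ ∞ D)
    (hD0 : ∀ q, 2 * Λ < ‖q‖ → D q = 0) {cD : ℝ} {c : ℕ → ℝ} (hcD : 0 ≤ cD) (hc : ∀ p, 0 ≤ c p)
    (hDb : ∀ l q, ‖dirDeriv lineDir l D q‖ ≤ cD * Λ⁻¹ ^ l.length * c l.length)
    (I : Finset (Fin n)) {X : (Fin (I.card + 1) → Mom) → ℂ} {Y : (Fin (Iᶜ.card + 1) → Mom) → ℂ}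
    (hX : ContDiff ℝ ∞ X) (hY : ContDiff ℝ ∞ Y) {cX cY : ℝ} {x y : ℕ → ℝ}
    (hcX : 0 ≤ cX) (hcY : 0 ≤ cY) (hx : ∀ p, 0 ≤ x p) (hy : ∀ p, 0 ≤ y p)
    (hXb : DerivBound Λ cX x X) (hYb : DerivBound Λ cY y Y) :
    DerivBound Λ (cD * (cX * cY)) (fun p => leib p c fun j => leib j x y)
      (fun k : Fin n → Mom => D (∑ i ∈ I, k i) *
        (X (app (sub I k) (-∑ i ∈ I, k i)) * Y (app (sub Iᶜ k) (∑ i ∈ I, k i)))) := by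
  intro l k hk
  rw [momDeriv_eq_dirDeriv]
  by_cases hq : ‖∑ i ∈ I, k i‖ ≤ 2 * Λ
  · have hXs : ContDiff ℝ ∞ fun k : Fin n → Mom => X (app (sub I k) (-∑ i ∈ I, k i)) :=
      hX.comp (contDiff_app (contDiff_sub I) (contDiff_lineMom I).neg)
    have hYs : ContDiff ℝ ∞ fun k : Fin n → Mom => Y (app (sub Iᶜ k) (∑ i ∈ I, k i)) :=
      hY.comp (contDiff_app (contDiff_sub Iᶜ) (contDiff_lineMom I))
    have hDs : ContDiff ℝ ∞ fun k : Fin n → Mom => D (∑ i ∈ I, k i) :=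
      hD.comp (contDiff_lineMom I)
    have b1 : ∀ l' : List (Fin n × Fin n × Fin 4),
        ‖dirDeriv dir l' (fun k : Fin n → Mom => X (app (sub I k) (-∑ i ∈ I, k i))) k‖ ≤
          cX * Λ⁻¹ ^ l'.length * x l'.length := by
      intro l'
      rw [dirDeriv_comp (route_left I)]
      simpa [momDeriv_eq_dirDeriv] using hXb (l'.map (slotDir I)) _ (hk.left I hΛ.le hq)
    have b2 : ∀ l' : List (Fin n × Fin n × Fin 4),
        ‖dirDeriv dir l' (fun k : Fin n → Mom => Y (app (sub Iᶜ k) (∑ i ∈ I, k i))) k‖ ≤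
          cY * Λ⁻¹ ^ l'.length * y l'.length := by
      intro l'
      rw [dirDeriv_comp (route_right I)]
      simpa [momDeriv_eq_dirDeriv] using hYb (l'.map (slotDir Iᶜ)) _ (hk.right I hΛ.le hq)
    have b3 : ∀ l' : List (Fin n × Fin n × Fin 4),
        ‖dirDeriv dir l' (fun k : Fin n → Mom => D (∑ i ∈ I, k i)) k‖ ≤
          cD * Λ⁻¹ ^ l'.length * c l'.length := by
      intro l'
      rw [dirDeriv_comp (w' := lineDir) (sum_line I)]
      simpa using hDb (l'.map _) (∑ i ∈ I, k i)
    have b4 : ∀ l' : List (Fin n × Fin n × Fin 4),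
        ‖dirDeriv dir l' (fun k : Fin n → Mom => X (app (sub I k) (-∑ i ∈ I, k i)) *
          Y (app (sub Iᶜ k) (∑ i ∈ I, k i))) k‖ ≤
          cX * cY * Λ⁻¹ ^ l'.length * leib l'.length x y := by
      intro l'
      rw [← leib_scale]
      exact norm_dirDeriv_mul_le l' hXs hYs b1 b2
    rw [← leib_scale]
    exact norm_dirDeriv_mul_le l hDs (hXs.mul hYs) b3 b4
  · have hev : (fun k : Fin n → Mom => D (∑ i ∈ I, k i) *
        (X (app (sub I k) (-∑ i ∈ I, k i)) * Y (app (sub Iᶜ k) (∑ i ∈ I, k i))))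
        =ᶠ[𝓝 k] fun _ => 0 := by
      have hcont : ContinuousAt (fun k : Fin n → Mom => ‖∑ i ∈ I, k i‖) k :=
        ((contDiff_lineMom I).continuous.norm).continuousAt
      filter_upwards [(continuousAt_const (y := 2 * Λ)).eventually_lt hcont (not_le.mp hq)] with k' h
      rw [hD0 _ h, zero_mul]
    rw [(dirDeriv_eventuallyEq hev l).eq_of_nhds, dirDeriv_zero, norm_zero]
    have h3 := leib_nonneg l.length hc fun j => leib_nonneg j hx hy
    positivity

/-- Differentiation under the integral sign for a smooth integrand with bounded support in the
integration variable. -/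
lemma dirDeriv_integral {E : Type*} [NormedAddCommGroup E] [NormedSpace ℝ E] {ι : Type*}
    (w : ι → E) {R : ℝ} (l : List ι) : ∀ {G : E × Mom → ℂ}, ContDiff ℝ ∞ G →
    (∀ k q, R < ‖q‖ → G (k, q) = 0) → ∀ k,
    dirDeriv w l (fun k => ∫ q, G (k, q)) k = ∫ q, dirDeriv w l (fun k => G (k, q)) k := by
  induction l using List.reverseRecOn with
  | nil => intro G _ _ k; rfl
  | append_singleton l i ih =>
    intro G hG hR k
    set G' : E × Mom → ℂ := fun p => lineDeriv ℝ (fun k => G (k, p.2)) p.1 (w i) with hG'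
    have hslice : ∀ q, ContDiff ℝ ∞ fun k => G (k, q) := fun q =>
      hG.comp (contDiff_id.prodMk contDiff_const)
    have hG's : ContDiff ℝ ∞ G' := by
      have : G' = fun p => lineDeriv ℝ G p (w i, 0) := by
        funext p
        simp only [hG', lineDeriv]
        congr 1
        funext s
        congr 1
        ext <;> simp
      rw [this]
      exact contDiff_lineDeriv hG _
    have hR' : ∀ k q, R < ‖q‖ → G' (k, q) = 0 := by
      intro k q hq
      simp [hG', lineDeriv, hR _ q hq]
    have hline : (fun k => lineDeriv ℝ (fun k => ∫ q, G (k, q)) k (w i)) =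
        fun k => ∫ q, G' (k, q) := by
      funext k
      have hcomp : ∀ x : ℝ, Continuous fun q => G (k + x • w i, q) := fun x =>
        hG.continuous.comp (by fun_prop)
      have hsupp : ∀ x : ℝ, HasCompactSupport fun q => G (k + x • w i, q) := fun x =>
        HasCompactSupport.intro (isCompact_closedBall (0 : Mom) R) fun q hq =>
          hR _ q (by simpa using hq)
      have hc' : Continuous fun p : ℝ × Mom => G' (k + p.1 • w i, p.2) :=
        hG's.continuous.comp (by fun_prop)
      obtain ⟨C, hC⟩ := ((isCompact_closedBall (0 : ℝ) 1).prod
        (isCompact_closedBall (0 : Mom) R)).exists_bound_of_continuousOn hc'.continuousOn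
      have key := hasDerivAt_integral_of_dominated_loc_of_deriv_le (μ := (volume : Measure Mom))
        (F := fun (x : ℝ) q => G (k + x • w i, q)) (F' := fun (x : ℝ) q => G' (k + x • w i, q))
        (x₀ := 0) (s := Metric.ball 0 1)
        (bound := (Metric.closedBall (0 : Mom) R).indicator fun _ => C)
        (Metric.ball_mem_nhds 0 one_pos)
        (Eventually.of_forall fun x => (hcomp x).aestronglyMeasurable)
        ((hcomp 0).integrable_of_hasCompactSupport (hsupp 0))
        ((hc'.comp (Continuous.prodMk_right (0 : ℝ))).aestronglyMeasurable)
        (Eventually.of_forall fun q x hx => ?_)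
        ((integrable_indicator_iff Metric.isClosed_closedBall.measurableSet).mpr
          (integrableOn_const (isCompact_closedBall (0 : Mom) R).measure_lt_top.ne))
        (Eventually.of_forall fun q x _ => ?_)
      · have h := key.2
        simp only [zero_smul, add_zero] at h
        exact h.deriv
      · by_cases hq : q ∈ Metric.closedBall (0 : Mom) R
        · rw [indicator_of_mem hq]
          exact hC (x, q) ⟨Metric.ball_subset_closedBall hx, hq⟩
        · rw [indicator_of_notMem hq, hR' _ q (by simpa using hq), norm_zero]
      · have h1 : HasLineDerivAt ℝ (fun k => G (k, q)) (G' (k + x • w i, q)) (k + x • w i) (w i) :=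
          ((((hslice q).differentiable (by simp)) _).lineDifferentiableAt).hasLineDerivAt
        have h2 : HasDerivAt (fun y : ℝ => G (k + x • w i + y • w i, q))
          (G' (k + x • w i, q)) (x - x) := by rw [sub_self]; exact h1
        have h3 := h2.comp_sub_const x x
        refine h3.congr_of_eventuallyEq (Eventually.of_forall fun y => ?_)
        simp only
        congr 2
        rw [add_assoc, ← add_smul]
        congr 2
        ring
    rw [dirDeriv_concat, hline, ih hG's hR' k]
    simp only [dirDeriv_concat]
    rfl

/-- The volume of the ball of radius two, to which the rescaled loop momenta are confined. -/
noncomputable def loopVol : ℝ := (volume : Measure Mom).real (Metric.closedBall 0 2)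

lemma volume_closedBall_scaled {Λ : ℝ} (hΛ : 0 < Λ) :
    (volume : Measure Mom).real (Metric.closedBall 0 (2 * Λ)) = Λ ^ 4 * loopVol := by
  rw [mul_comm, Measure.real, Measure.addHaar_closedBall_mul _ _ hΛ.le zero_le_two, ENNReal.toReal_mul,
    ENNReal.toReal_ofReal (by positivity), loopVol, Measure.real]
  simp

/-- Contraction of two legs of a vertex with a line: integration over the ball of radius `2 Λ`
gives a factor `Λ⁴`. -/
lemma loop_bound {Λ : ℝ} (hΛ : 0 < Λ) {D : Leg → Leg → Mom → ℂ}
    (hD : ∀ α β, ContDiff ℝ ∞ (D α β)) (hD0 : ∀ α β q, 2 * Λ < ‖q‖ → D α β q = 0)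
    {cD : ℝ} (hcD : 0 ≤ cD) (hDb : ∀ α β q, ‖D α β q‖ ≤ cD)
    {W : Leg → Leg → (Fin (n + 2) → Mom) → ℂ} (hW : ∀ α β, ContDiff ℝ ∞ (W α β))
    {cW : ℝ} {x : ℕ → ℝ}
    (hWb : ∀ α β, DerivBound Λ cW x (W α β)) :
    DerivBound Λ (cD * cW * Λ ^ 4) (fun p => Fintype.card Leg * Fintype.card Leg * loopVol * x p)
      (fun k : Fin n → Mom => ∫ q : Mom, ∑ α, ∑ β, D α β q * W α β (app (app k q) (-q))) := by
  intro l k hk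
  have hroute : ContDiff ℝ ∞ fun p : (Fin n → Mom) × Mom => app (app p.1 p.2) (-p.2) :=
    contDiff_app (contDiff_app contDiff_fst contDiff_snd) contDiff_snd.neg
  have hG : ContDiff ℝ ∞ fun p : (Fin n → Mom) × Mom =>
      ∑ α, ∑ β, D α β p.2 * W α β (app (app p.1 p.2) (-p.2)) :=
    ContDiff.sum fun α _ => ContDiff.sum fun β _ =>
      ((hD α β).comp contDiff_snd).mul ((hW α β).comp hroute)
  have hval : ∀ q, dirDeriv dir l (fun k : Fin n → Mom =>
      ∑ α, ∑ β, D α β q * W α β (app (app k q) (-q))) k =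
      ∑ α, ∑ β, D α β q * momDeriv (l.map loopDir) (W α β) (app (app k q) (-q)) := by
    intro q
    have hs : ∀ α β, ContDiff ℝ ∞ fun k : Fin n → Mom =>
        D α β q * W α β (app (app k q) (-q)) := fun α β =>
      contDiff_const.mul ((hW α β).comp (hroute.comp (contDiff_id.prodMk contDiff_const)))
    rw [dirDeriv_sum _ fun α _ => ContDiff.sum fun β _ => hs α β]
    refine Finset.sum_congr rfl fun α _ => ?_
    rw [dirDeriv_sum _ fun β _ => hs α β]
    refine Finset.sum_congr rfl fun β _ => ?_
    rw [dirDeriv_const_mul, dirDeriv_comp (route_loop q)]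
    rfl
  rw [momDeriv_eq_dirDeriv, dirDeriv_integral dir (R := 2 * Λ) l hG (fun k q hq =>
    Finset.sum_eq_zero fun α _ => Finset.sum_eq_zero fun β _ => by
      simp only; rw [hD0 α β q hq, zero_mul]) k]
  simp only [hval]
  rw [← setIntegral_eq_integral_of_forall_compl_eq_zero (s := Metric.closedBall (0 : Mom) (2 * Λ))]
  · have hb : ∀ q ∈ Metric.closedBall (0 : Mom) (2 * Λ),
        ‖∑ α, ∑ β, D α β q * momDeriv (l.map loopDir) (W α β) (app (app k q) (-q))‖ ≤
          Fintype.card Leg * (Fintype.card Leg * (cD * (cW * Λ⁻¹ ^ l.length * x l.length))) := by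
      intro q hq
      have hdom := hk.loop hΛ.le (q := q) (by simpa using hq)
      refine (norm_sum_le_of_le _ fun α _ => norm_sum_le_of_le _ fun β _ =>
        (norm_mul_le _ _).trans (mul_le_mul (hDb α β q)
          (hWb α β (l.map loopDir) _ hdom) (norm_nonneg _) hcD)).trans (le_of_eq ?_)
      simp
    refine (norm_setIntegral_le_of_norm_le_const
      (isCompact_closedBall (0 : Mom) (2 * Λ)).measure_lt_top hb).trans (le_of_eq ?_)
    rw [volume_closedBall_scaled hΛ]
    ring
  · intro q hq
    refine Finset.sum_eq_zero fun α _ => Finset.sum_eq_zero fun β _ => ?_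
    rw [hD0 α β q (by simpa using hq), zero_mul]

end Terms

/-! ### Taylor coefficients at zero momentum -/

section ZeroMomentum

variable {n : ℕ}

lemma IsVertex.sub {f g : Vertex n} (hf : IsVertex f) (hg : IsVertex g) :
    IsVertex (fun a k => f a k - g a k) where
  smooth a := (hf.smooth a).sub (hg.smooth a)
  perm σ a k hk := by rw [hf.perm σ a k hk, hg.perm σ a k hk, mul_sub]
  flip i a k hk := by rw [hf.flip i a k hk, hg.flip i a k hk]
  covariant R hR a k hk := by
    rw [hf.covariant R hR a k hk, hg.covariant R hR a k hk, ← Finset.sum_sub_distrib]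
    simp only [mul_sub]
  ghost a k hk h := by rw [hf.ghost a k hk h, hg.ghost a k hk h, sub_zero]

lemma legRep_neg_one (a b : Leg) :
    legRep (-1) a b = if a = b then (-1 : ℝ) ^ a.ghostNumber else 0 := by
  cases a <;> cases b <;> simp [legRep, Leg.ghostNumber, Matrix.one_apply]
  · split_ifs <;> simp_all
  · split_ifs <;> simp_all
  · split_ifs <;> simp_all

lemma prod_ghost_sign (a : Fin n → Leg) (h : ∑ i, (a i).ghostNumber = 0) :
    ∏ i, (-1 : ℝ) ^ (a i).ghostNumber = 1 := by
  have key : ∀ s : Finset (Fin n), ∏ i ∈ s, (-1 : ℝ) ^ (a i).ghostNumber =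
      (-1 : ℝ) ^ (∑ i ∈ s, (a i).ghostNumber) := by
    intro s
    induction s using Finset.induction_on with
    | empty => simp
    | insert i s hi ih => rw [Finset.prod_insert hi, Finset.sum_insert hi, ih, zpow_add₀ (by norm_num)]
  rw [key, h, zpow_zero]

/-- Covariance under the reflection `-1 ∈ O(4)` makes vertex functions even: ghosts only come in
pairs, so that the number of tensor indices is even. -/
lemma IsVertex.even {f : Vertex n} (hf : IsVertex f) (a : Fin n → Leg) {k : Fin n → Mom}
    (hk : ∑ i, k i = 0) : f a (-k) = f a k := by
  have hk' : ∑ i, (-k) i = 0 := by simp [hk]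
  by_cases hg : ∑ i, (a i).ghostNumber = 0
  · have hR : (-1 : Matrix (Fin 4) (Fin 4) ℝ) ∈ Matrix.orthogonalGroup (Fin 4) ℝ := by
      rw [Matrix.mem_orthogonalGroup_iff]; simp
    have h := hf.covariant (-1) hR a k hk
    have hrot : (fun i => rot (-1) (k i)) = -k := by
      funext i; simp [rot]
    rw [hrot] at h
    rw [h, Finset.sum_eq_single a]
    · simp only [legRep_neg_one, if_true]
      rw [prod_ghost_sign a hg]
      simp
    · intro b _ hb
      obtain ⟨i, hi⟩ := Function.ne_iff.mp hb
      rw [Finset.prod_eq_zero (Finset.mem_univ i) (by rw [legRep_neg_one, if_neg (Ne.symm hi)])]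
      simp
    · simp
  · rw [hf.ghost a _ hk' hg, hf.ghost a _ hk hg]

lemma IsVertex.momDeriv_odd {f : Vertex n} (hf : IsVertex f) (a : Fin n → Leg)
    {l : List (Fin n × Fin n × Fin 4)} (hl : Odd l.length) : momDeriv l (f a) 0 = 0 := by
  have hneg : ∀ (l : List (Fin n × Fin n × Fin 4)) (g : (Fin n → Mom) → ℂ),
      dirDeriv (fun d => -dir d) l g = fun x => (-1) ^ l.length * dirDeriv dir l g x := by
    intro l g
    induction l with
    | nil => simp
    | cons d l ih =>
      rw [dirDeriv_cons, ih]
      funext x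
      rw [lineDeriv_neg]
      simp only [lineDeriv, dirDeriv_cons, deriv_const_mul_field, List.length_cons, pow_succ]
      ring
  have h1 := dirDeriv_comp (w := dir) (w' := fun d : Fin n × Fin n × Fin 4 => -dir d) (τ := id)
    (φ := fun k : Fin n → Mom => -k) (fun x s d => by simp [add_comm]) l (f a)
  have h2 := momDeriv_congr (f := fun k => f a (-k)) (g := f a) (fun k hk => hf.even a hk) l
    (k := 0) (by simp)
  rw [momDeriv_eq_dirDeriv, h1] at h2
  simp only [List.map_id, hneg, neg_zero, hl.neg_one_pow] at h2
  rw [momDeriv_eq_dirDeriv] at h2 ⊢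
  have h3 : (2 : ℂ) * dirDeriv dir l (f a) 0 = 0 := by linear_combination -h2
  simpa using h3

lemma momDeriv_two {f : (Fin n → Mom) → ℂ} (hf : ContDiff ℝ ∞ f) (d d' : Fin n × Fin n × Fin 4) :
    momDeriv [d, d'] f 0 = fderiv ℝ (fderiv ℝ f) 0 (dir d) (dir d') := by
  have h1 : ∀ x v, lineDeriv ℝ f x v = fderiv ℝ f x v := fun x v =>
    ((hf.differentiable (by simp)) x).lineDeriv_eq_fderiv
  have h2 : DifferentiableAt ℝ (fderiv ℝ f) 0 :=
    ((hf.fderiv_right (m := ∞) (by simp)).differentiable (by simp)) 0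
  simp only [momDeriv_eq_dirDeriv, dirDeriv_cons, dirDeriv_nil, h1]
  rw [(h2.clm_apply (differentiableAt_const _)).lineDeriv_eq_fderiv,
    fderiv_clm_apply h2 (differentiableAt_const _)]
  simp

lemma momDeriv_two_comm {f : (Fin n → Mom) → ℂ} (hf : ContDiff ℝ ∞ f)
    (d d' : Fin n × Fin n × Fin 4) : momDeriv [d, d'] f 0 = momDeriv [d', d] f 0 := by
  rw [momDeriv_two hf, momDeriv_two hf]
  have : IsSymmSndFDerivAt ℝ f 0 := hf.contDiffAt.isSymmSndFDerivAt (by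
    simpa using (WithTop.coe_le_coe.mpr le_top : ((2 : ℕ∞) : ℕ∞ω) ≤ ∞))
  exact this _ _

lemma dir_eq_sub (i₀ i j : Fin n) (μ : Fin 4) : dir (i, j, μ) = dir (i, i₀, μ) - dir (j, i₀, μ) := by
  simp [dir]

lemma dir_self (i : Fin n) (μ : Fin 4) : dir (i, i, μ) = 0 := by simp [dir]

/-- All second derivatives at zero momentum follow from those with respect to a fixed reference
leg. -/
lemma momDeriv_two_eq_zero {f : (Fin n → Mom) → ℂ} (hf : ContDiff ℝ ∞ f) (i₀ : Fin n)
    (h : ∀ i j, i ≠ i₀ → j ≠ i₀ → ∀ μ ν, momDeriv [(i, i₀, μ), (j, i₀, ν)] f 0 = 0)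
    (d d' : Fin n × Fin n × Fin 4) : momDeriv [d, d'] f 0 = 0 := by
  have h' : ∀ i j μ ν, fderiv ℝ (fderiv ℝ f) 0 (dir (i, i₀, μ)) (dir (j, i₀, ν)) = 0 := by
    intro i j μ ν
    by_cases hi : i = i₀
    · rw [hi, dir_self]; simp
    by_cases hj : j = i₀
    · rw [hj, dir_self]; simp
    rw [← momDeriv_two hf]
    exact h i j hi hj μ ν
  obtain ⟨i, j, μ⟩ := d
  obtain ⟨i', j', ν⟩ := d'
  rw [momDeriv_two hf, dir_eq_sub i₀ i j, dir_eq_sub i₀ i' j']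
  simp [h']

lemma permSign_ne_zero (a : Fin n → Leg) (σ : Equiv.Perm (Fin n)) : (permSign a σ : ℂ) ≠ 0 := by
  simp [permSign]

lemma IsVertex.momDeriv_perm {f : Vertex n} (hf : IsVertex f) (a : Fin n → Leg)
    (σ : Equiv.Perm (Fin n)) (l : List (Fin n × Fin n × Fin 4))
    (h : momDeriv (l.map fun d => (σ.symm d.1, σ.symm d.2.1, d.2.2)) (f (a ∘ σ)) 0 = 0) :
    momDeriv l (f a) 0 = 0 := by
  have hs : ∀ (i : Fin n) (v : Mom) (j : Fin n),
      (Pi.single i v : Fin n → Mom) (σ j) = (Pi.single (σ.symm i) v : Fin n → Mom) j := by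
    intro i v j
    by_cases hj : σ j = i
    · subst hj; simp
    · rw [Pi.single_eq_of_ne hj, Pi.single_eq_of_ne]
      rintro rfl
      simp at hj
  have h1 := dirDeriv_comp (w := dir) (w' := dir)
    (τ := fun d : Fin n × Fin n × Fin 4 => (σ.symm d.1, σ.symm d.2.1, d.2.2))
    (φ := fun k : Fin n → Mom => k ∘ σ)
    (fun x s d => by funext j; simp [dir_apply, hs]) l (f (a ∘ σ))
  have h2 := momDeriv_congr (f := fun k => f (a ∘ σ) (k ∘ σ))
    (g := fun k => (permSign a σ : ℂ) * f a k) (fun k hk => hf.perm σ a k hk) l (k := 0) (by simp)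
  rw [momDeriv_eq_dirDeriv, momDeriv_eq_dirDeriv, h1, dirDeriv_const_mul] at h2
  have h0 : (0 : Fin n → Mom) ∘ σ = 0 := rfl
  simp only [h0] at h2
  rw [momDeriv_eq_dirDeriv] at h ⊢
  rw [h] at h2
  exact (mul_eq_zero.mp h2.symm).resolve_left (permSign_ne_zero a σ)

/-- If all couplings vanish, then so do all Taylor coefficients at zero momentum of canonical
dimension at least `-1`: odd orders vanish by reflection symmetry, and the second derivatives of
the two- and three-point functions reduce to the couplings by linearity, symmetry of second
derivatives and exchange of legs. -/
lemma momDeriv_eq_zero_of_couplings {V : ∀ n, Vertex n} (hV : ∀ n, 1 ≤ n → IsVertex (V n))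
    (hc : ∀ c : Coupling, couplingTensor c (V c.legs) = 0) (hn : 1 ≤ n) (a : Fin n → Leg)
    (l : List (Fin n × Fin n × Fin 4)) (hl : n + l.length ≤ 5) : momDeriv l (V n a) 0 = 0 := by
  rcases Nat.even_or_odd l.length with he | ho
  swap
  · exact (hV n hn).momDeriv_odd a ho
  match n, l, hn, hl, he with
  | 1, [], _, _, _ => exact congrFun (congrFun (hc .rho1) a) ![]
  | 1, d :: l, _, _, _ =>
    have : dir d = 0 := by
      obtain ⟨i, j, μ⟩ := d
      rw [Subsingleton.elim j i, dir_self]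
    rw [momDeriv_eq_dirDeriv, dirDeriv_cons, this]
    exact lineDeriv_zero
  | 2, [], _, _, _ => exact congrFun (congrFun (hc .rho2) a) ![]
  | 2, [d, d'], _, _, _ =>
    refine momDeriv_two_eq_zero ((hV 2 one_le_two).smooth a) 1 ?_ d d'
    intro i j hi hj μ ν
    obtain rfl : i = 0 := by omega
    obtain rfl : j = 0 := by omega
    exact congrFun (congrFun (hc .rho3) a) ![μ, ν]
  | 3, [], _, _, _ => exact congrFun (congrFun (hc .rho4) a) ![]
  | 3, [d, d'], h3, _, _ =>
    refine momDeriv_two_eq_zero ((hV 3 h3).smooth a) 2 ?_ d d'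
    have h6 : ∀ (a : Fin 3 → Leg) (μ ν : Fin 4),
        momDeriv [((0 : Fin 3), (2 : Fin 3), μ), (0, 2, ν)] (V 3 a) 0 = 0 := fun a μ ν =>
      congrFun (congrFun (hc .rho6) a) ![μ, ν]
    have h7 : ∀ (a : Fin 3 → Leg) (μ ν : Fin 4),
        momDeriv [((0 : Fin 3), (2 : Fin 3), μ), (1, 2, ν)] (V 3 a) 0 = 0 := fun a μ ν =>
      congrFun (congrFun (hc .rho7) a) ![μ, ν]
    intro i j hi hj μ ν
    obtain rfl | rfl : i = 0 ∨ i = 1 := by omega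
    · obtain rfl | rfl : j = 0 ∨ j = 1 := by omega
      · exact h6 a μ ν
      · exact h7 a μ ν
    · obtain rfl | rfl : j = 0 ∨ j = 1 := by omega
      · rw [momDeriv_two_comm ((hV 3 h3).smooth a)]
        exact h7 a ν μ
      · exact (hV 3 h3).momDeriv_perm a (Equiv.swap 0 1) _ (h6 _ μ ν)
  | 4, [], _, _, _ => exact congrFun (congrFun (hc .rho5) a) ![]
  | 5, [], _, _, _ => exact congrFun (congrFun (hc .rho8) a) ![]
  | 2, [_], _, _, h | 3, [_], _, _, h | 4, [_], _, _, h => simp at h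
  | 2, _ :: _ :: _ :: l, _, hl, h =>
    simp only [List.length_cons] at hl h
    rw [show l.length = 0 by omega] at h
    exact absurd h (by decide)
  | 3, _ :: _ :: _ :: l, _, hl, _ => simp only [List.length_cons] at hl; omega
  | 4, _ :: _ :: l, _, hl, _ => simp only [List.length_cons] at hl; omega
  | 5, _ :: l, _, hl, _ => simp only [List.length_cons] at hl; omega
  | n + 6, l, _, hl, _ => omega

lemma eq_sum_smul_dir (i₀ : Fin n) {k : Fin n → Mom} (hk : ∑ i, k i = 0) :
    k = ∑ i, ∑ μ, (k i μ) • dir (i, i₀, μ) := by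
  have hbasis : ∀ v : Mom, ∑ μ, v μ • (EuclideanSpace.single μ 1 : Mom) = v := by
    intro v; ext ν; simp [Pi.single_apply]
  have h1 : ∀ i, ∑ μ, (k i μ) • dir (i, i₀, μ) = Pi.single i (k i) - Pi.single i₀ (k i) := by
    intro i
    have hs : ∀ j : Fin n, ∑ μ, (k i μ) • (Pi.single j (EuclideanSpace.single μ 1) : Fin n → Mom) =
        Pi.single j (k i) := by
      intro j
      conv_rhs => rw [← hbasis (k i)]
      funext m
      by_cases hm : m = j
      · subst hm; simp
      · simp [hm]
    simp only [dir, smul_sub, Finset.sum_sub_distrib, hs]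
  simp only [h1, Finset.sum_sub_distrib, Finset.univ_sum_single]
  have h2 : ∑ i, (Pi.single i₀ (k i) : Fin n → Mom) = 0 := by
    funext m
    by_cases hm : m = i₀
    · subst hm; simp [hk]
    · simp [hm]
  rw [h2, sub_zero]

/-- First order Taylor estimate around zero momentum in terms of the derivatives `∂_{i,j}`. -/
lemma norm_sub_zero_le {f : (Fin n → Mom) → ℂ} (hf : ContDiff ℝ ∞ f) (i₀ : Fin n) {Λ M : ℝ}
    (hΛ : 0 ≤ Λ) (hM : ∀ d k, InDomain Λ k → ‖lineDeriv ℝ f k (dir d)‖ ≤ M)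
    {k : Fin n → Mom} (hk : InDomain Λ k) : ‖f k - f 0‖ ≤ 8 * n * Λ * M := by
  have hline : ∀ x v, lineDeriv ℝ f x v = fderiv ℝ f x v := fun x v =>
    ((hf.differentiable (by simp)) x).lineDeriv_eq_fderiv
  have hder : ∀ s ∈ Icc (0 : ℝ) 1, HasDerivWithinAt (fun s : ℝ => f (s • k))
      (fderiv ℝ f (s • k) k) (Icc 0 1) s := by
    intro s _
    have h1 : HasDerivAt (fun s : ℝ => s • k) k s := by
      simpa using (hasDerivAt_id s).smul_const k
    exact ((((hf.differentiable (by simp)) (s • k)).hasFDerivAt).comp_hasDerivAt s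
      h1).hasDerivWithinAt
  have hbound : ∀ s ∈ Ico (0 : ℝ) 1, ‖fderiv ℝ f (s • k) k‖ ≤ 8 * n * Λ * M := by
    intro s hs
    have hdom : InDomain Λ (s • k) := by
      refine ⟨by simp [← Finset.smul_sum, hk.1], fun i => ?_⟩
      rw [Pi.smul_apply, norm_smul, mul_pow]
      have h1 : ‖s‖ ^ 2 ≤ 1 := by
        rw [Real.norm_of_nonneg hs.1]; nlinarith [hs.1, hs.2]
      have h2 := hk.2 i
      nlinarith [sq_nonneg ‖k i‖]
    have hcoord : ∀ i μ, |k i μ| ≤ 2 * Λ := fun i μ => by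
      have h1 := PiLp.norm_apply_le (k i) μ
      have h2 := hk.2 i
      rw [Real.norm_eq_abs] at h1
      exact h1.trans (abs_le_of_sq_le_sq' (by nlinarith) (by linarith)).2
    have hkk := eq_sum_smul_dir i₀ hk.1
    calc ‖fderiv ℝ f (s • k) k‖
        = ‖∑ i, ∑ μ, (k i μ) • lineDeriv ℝ f (s • k) (dir (i, i₀, μ))‖ := by
          conv_lhs => rw [show fderiv ℝ f (s • k) k =
            fderiv ℝ f (s • k) (∑ i, ∑ μ, (k i μ) • dir (i, i₀, μ)) by rw [← hkk]]
          simp only [map_sum, map_smul, hline]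
      _ ≤ ∑ _i : Fin n, ∑ _μ : Fin 4, 2 * Λ * M := by
          refine norm_sum_le_of_le _ fun i _ => norm_sum_le_of_le _ fun μ _ => ?_
          rw [norm_smul, Real.norm_eq_abs]
          exact mul_le_mul (hcoord i μ) (hM _ _ hdom) (norm_nonneg _) (by linarith)
      _ = 8 * n * Λ * M := by simp; ring
  have := norm_image_sub_le_of_norm_deriv_le_segment_01' hder hbound
  simpa using this

end ZeroMomentum

/-! ### The scale derivative of the difference of two solutions -/

section DerivBoundAlgebra

variable {n : ℕ} {Λ c : ℝ} {x y : ℕ → ℝ} {X Y : (Fin n → Mom) → ℂ}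

lemma DerivBound.congr (hX : DerivBound Λ c x X) (h : ∀ k, ∑ i, k i = 0 → X k = Y k) :
    DerivBound Λ c x Y := by
  intro l k hk
  rw [← momDeriv_congr h l hk.1]
  exact hX l k hk

lemma DerivBound.add (hXs : ContDiff ℝ ∞ X) (hYs : ContDiff ℝ ∞ Y) (hX : DerivBound Λ c x X)
    (hY : DerivBound Λ c y Y) : DerivBound Λ c (fun p => x p + y p) (fun k => X k + Y k) := by
  intro l k hk
  rw [momDeriv_eq_dirDeriv, dirDeriv_add hXs hYs, mul_add]
  exact (norm_add_le _ _).trans (add_le_add (hX l k hk) (hY l k hk))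

lemma DerivBound.sum {κ : Type*} {s : Finset κ} {x : κ → ℕ → ℝ} {X : κ → (Fin n → Mom) → ℂ}
    (hXs : ∀ j ∈ s, ContDiff ℝ ∞ (X j)) (hX : ∀ j ∈ s, DerivBound Λ c (x j) (X j)) :
    DerivBound Λ c (fun p => ∑ j ∈ s, x j p) (fun k => ∑ j ∈ s, X j k) := by
  intro l k hk
  rw [momDeriv_eq_dirDeriv, dirDeriv_sum s hXs, Finset.mul_sum]
  exact norm_sum_le_of_le s fun j hj => hX j hj l k hk

lemma DerivBound.const_mul (hX : DerivBound Λ c x X) {z : ℂ} {C : ℝ} (hz : ‖z‖ ≤ C) :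
    DerivBound Λ c (fun p => C * x p) (fun k => z * X k) := by
  intro l k hk
  rw [momDeriv_eq_dirDeriv, dirDeriv_const_mul, norm_mul]
  calc ‖z‖ * ‖dirDeriv dir l X k‖ ≤ C * (c * Λ⁻¹ ^ l.length * x l.length) :=
        mul_le_mul hz (hX l k hk) (norm_nonneg _) ((norm_nonneg _).trans hz)
    _ = _ := by ring

end DerivBoundAlgebra

section Polynomials

lemma IsPln.eval_nonneg {P : ℝ[X]} (hP : IsPln P) {z : ℝ} (hz : 0 ≤ z) : 0 ≤ P.eval z := by
  rw [eval_eq_sum_range]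
  exact Finset.sum_nonneg fun i _ => mul_nonneg (hP i) (pow_nonneg hz i)

lemma isPln_C {c : ℝ} (hc : 0 ≤ c) : IsPln (C c) := by
  intro i
  rw [coeff_C]
  split_ifs
  · exact hc
  · exact le_rfl

lemma isPln_zero : IsPln 0 := fun i => by simp

lemma isPln_X : IsPln X := by
  intro i
  rw [coeff_X]
  split_ifs <;> norm_num

lemma IsPln.add {P Q : ℝ[X]} (hP : IsPln P) (hQ : IsPln Q) : IsPln (P + Q) := fun i => by
  rw [coeff_add]; exact add_nonneg (hP i) (hQ i)

lemma IsPln.mul {P Q : ℝ[X]} (hP : IsPln P) (hQ : IsPln Q) : IsPln (P * Q) := fun i => by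
  rw [coeff_mul]; exact Finset.sum_nonneg fun j _ => mul_nonneg (hP _) (hQ _)

lemma IsPln.sum {κ : Type*} {s : Finset κ} {P : κ → ℝ[X]} (hP : ∀ j ∈ s, IsPln (P j)) :
    IsPln (∑ j ∈ s, P j) := fun i => by
  rw [finsetSum_coeff]; exact Finset.sum_nonneg fun j hj => hP j hj i

lemma IsPln.leib (p : ℕ) : ∀ {x y : ℕ → ℝ[X]}, (∀ i, IsPln (x i)) → (∀ i, IsPln (y i)) →
    IsPln (leib p x y) := by
  induction p with
  | zero => intro x y hx hy; exact (hx 0).mul (hy 0)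
  | succ p ih => intro x y hx hy; exact (ih (fun i => hx _) hy).add (ih hx fun i => hy _)

lemma eval_leib (z : ℝ) (p : ℕ) (x y : ℕ → ℝ[X]) :
    (leib p x y).eval z = leib p (fun i => (x i).eval z) (fun i => (y i).eval z) :=
  leib_map (evalRingHom z) p x y

end Polynomials

section Difference

/-- The dependence of the bounds on the order of perturbation theory. It is multiplicative, and
this is why the tree terms reproduce it. -/
noncomputable def orderScale (ΛR MP : ℝ) (r : PertOrder) : ℝ := ΛR⁻¹ ^ ord1 r * MP ^ ordNR r

lemma orderScale_add (ΛR MP : ℝ) (r s : PertOrder) :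
    orderScale ΛR MP (r + s) = orderScale ΛR MP r * orderScale ΛR MP s := by
  have h1 : ord1 (r + s) = ord1 r + ord1 s := by simp [ord1, Finset.sum_add_distrib]
  have h2 : ordNR (r + s) = ordNR r + ordNR s := by
    simp [ordNR, Finset.sum_add_distrib]; ring
  simp only [orderScale, h1, h2, pow_add]
  ring

lemma orderScale_nonneg {ΛR MP : ℝ} (h : 0 ≤ ΛR) (h' : 0 ≤ MP) (r : PertOrder) :
    0 ≤ orderScale ΛR MP r := by
  unfold orderScale; positivity

/-- The hypotheses on a solution of the flow equation in the form in which they enter the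
estimates: bounds in terms of the dimensionful vertex functions, and finite differences in place of
derivatives with respect to `t`. -/
structure DiffSetting (K : ℝ → ℝ) (P₁ P₂ : PertOrder → ℕ → ℕ → ℝ[X]) (ΛR MP A B₁ B₂ : ℝ)
    (L : ℝ → ℝ → PertOrder → ∀ n, Vertex n) : Prop where
  pos : 0 < ΛR
  lt : ΛR < MP
  mass₁ : |B₁| ≤ ΛR ^ 2
  mass₂ : |B₂| ≤ ΛR ^ 2
  flow : IsFlow K A B₁ B₂ ΛR MP L
  bound : ∀ Λ ∈ Icc ΛR MP, ∀ t ∈ Icc (0 : ℝ) 1, ∀ r n, 1 ≤ n → ∀ a : Fin n → Leg,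
    DerivBound Λ (orderScale ΛR MP r * Λ ^ (4 - n : ℤ))
      (fun p => (P₁ r n p).eval (Real.log (MP / ΛR))) (L Λ t r n a)
  bare : ∀ t ∈ Icc (0 : ℝ) 1, ∀ t' ∈ Icc (0 : ℝ) 1, ∀ r n, 1 ≤ n → ∀ (a : Fin n → Leg) l k,
    6 ≤ n + l.length → InDomain MP k →
    ‖momDeriv l (L MP t r n a) k - momDeriv l (L MP t' r n a) k‖ ≤
      |t - t'| * (orderScale ΛR MP r * MP ^ (4 - n : ℤ) * MP⁻¹ ^ l.length *
        (P₂ r n l.length).eval (Real.log (MP / ΛR)))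
  renorm : ∀ t ∈ Icc (0 : ℝ) 1, ∀ t' ∈ Icc (0 : ℝ) 1, ∀ r n, 1 ≤ n → ∀ (a : Fin n → Leg) l,
    n + l.length ≤ 5 → momDeriv l (L ΛR t r n a) 0 = momDeriv l (L ΛR t' r n a) 0

variable {K : ℝ → ℝ} {P₁ P₂ : PertOrder → ℕ → ℕ → ℝ[X]} {ΛR MP A B₁ B₂ : ℝ}
  {L : ℝ → ℝ → PertOrder → ∀ n, Vertex n}

lemma DiffSetting.log_nonneg (S : DiffSetting K P₁ P₂ ΛR MP A B₁ B₂ L) :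
    0 ≤ Real.log (MP / ΛR) :=
  Real.log_nonneg ((one_le_div S.pos).mpr S.lt.le)

/-- The difference of two solutions that belong to different bare data. -/
def vertexDiff (L : ℝ → ℝ → PertOrder → ∀ n, Vertex n) (t t' Λ : ℝ) (r : PertOrder) (n : ℕ) :
    Vertex n := fun a k => L Λ t r n a k - L Λ t' r n a k

/-- The prefactor, common to all the orders in the momentum derivatives, of the bound for the
difference of two solutions. -/
noncomputable def diffScale (ΛR MP t t' : ℝ) (r : PertOrder) : ℝ :=
  |t - t'| * (MP ^ 2)⁻¹ * orderScale ΛR MP r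

lemma diffScale_nonneg {ΛR MP : ℝ} (h : 0 ≤ ΛR) (h' : 0 ≤ MP) (t t' : ℝ) (r : PertOrder) :
    0 ≤ diffScale ΛR MP t t' r :=
  mul_nonneg (by positivity) (orderScale_nonneg h h' r)

/-- The Lipschitz form of the assertion for the `n`-point functions of order `r` and `p` momentum
derivatives, with the polynomial `Q`. -/
def LipBound (K : ℝ → ℝ) (P₁ P₂ : PertOrder → ℕ → ℕ → ℝ[X]) (r : PertOrder) (n p : ℕ)
    (Q : ℝ[X]) : Prop :=
  ∀ (ΛR MP A B₁ B₂ : ℝ) (L : ℝ → ℝ → PertOrder → ∀ n, Vertex n),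
    DiffSetting K P₁ P₂ ΛR MP A B₁ B₂ L → ∀ Λ ∈ Icc ΛR MP, ∀ t ∈ Icc (0 : ℝ) 1,
    ∀ t' ∈ Icc (0 : ℝ) 1, ∀ (a : Fin n → Leg) (l : List (Fin n × Fin n × Fin 4)) k,
    l.length = p → InDomain Λ k →
    ‖momDeriv l (vertexDiff L t t' Λ r n a) k‖ ≤
      diffScale ΛR MP t t' r * Λ ^ (6 - n : ℤ) * Λ⁻¹ ^ p * Q.eval (Real.log (MP / ΛR))

lemma LipBound.derivBound {r : PertOrder} {n : ℕ} {Q : ℕ → ℝ[X]}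
    (h : ∀ p, LipBound K P₁ P₂ r n p (Q p)) (S : DiffSetting K P₁ P₂ ΛR MP A B₁ B₂ L) {Λ : ℝ}
    (hΛ : Λ ∈ Icc ΛR MP) {t t' : ℝ} (ht : t ∈ Icc (0 : ℝ) 1) (ht' : t' ∈ Icc (0 : ℝ) 1)
    (a : Fin n → Leg) :
    DerivBound Λ (diffScale ΛR MP t t' r * Λ ^ (6 - n : ℤ))
      (fun p => (Q p).eval (Real.log (MP / ΛR))) (vertexDiff L t t' Λ r n a) :=
  fun l k hk => h l.length ΛR MP A B₁ B₂ L S Λ hΛ t ht t' ht' a l k rfl hk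

lemma DiffSetting.contDiff (S : DiffSetting K P₁ P₂ ΛR MP A B₁ B₂ L) {Λ : ℝ}
    (hΛ : Λ ∈ Icc ΛR MP) {t : ℝ} (ht : t ∈ Icc (0 : ℝ) 1) (r : PertOrder) {n : ℕ} (hn : 1 ≤ n)
    (a : Fin n → Leg) : ContDiff ℝ ∞ (L Λ t r n a) :=
  (S.flow.vertex Λ hΛ t ht r n hn).smooth a

lemma DiffSetting.contDiff_vertexDiff (S : DiffSetting K P₁ P₂ ΛR MP A B₁ B₂ L) {Λ : ℝ}
    (hΛ : Λ ∈ Icc ΛR MP) {t t' : ℝ} (ht : t ∈ Icc (0 : ℝ) 1) (ht' : t' ∈ Icc (0 : ℝ) 1)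
    (r : PertOrder) {n : ℕ} (hn : 1 ≤ n) (a : Fin n → Leg) :
    ContDiff ℝ ∞ (vertexDiff L t t' Λ r n a) :=
  (S.contDiff hΛ ht r hn a).sub (S.contDiff hΛ ht' r hn a)

/-- Pairs of orders that can contribute to a tree term. -/
noncomputable def treeOrders (r : PertOrder) : Finset (PertOrder × PertOrder) :=
  (Finset.HasAntidiagonal.antidiagonal r).filter fun s => s.1 ≠ 0 ∧ s.2 ≠ 0

/-- The contribution of one tree diagram to the scale derivative of the difference of two solutions;
the difference of the two products of vertices has been split by the product rule. -/
noncomputable def treeDiffTerm (K : ℝ → ℝ) (B₁ B₂ : ℝ) (L : ℝ → ℝ → PertOrder → ∀ n, Vertex n)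
    (t t' Λ : ℝ) {n : ℕ} (a : Fin n → Leg) (s : PertOrder × PertOrder) (I : Finset (Fin n))
    (α β : Leg) (k : Fin n → Mom) : ℂ :=
  (treeSign a I α : ℂ) *
    (lineFactor K B₁ B₂ Λ α β (∑ i ∈ I, k i) *
        (vertexDiff L t t' Λ s.1 (I.card + 1) (app (sub I a) α) (app (sub I k) (-∑ i ∈ I, k i)) *
          L Λ t s.2 (Iᶜ.card + 1) (app (sub Iᶜ a) β) (app (sub Iᶜ k) (∑ i ∈ I, k i))) +
      lineFactor K B₁ B₂ Λ α β (∑ i ∈ I, k i) *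
        (L Λ t' s.1 (I.card + 1) (app (sub I a) α) (app (sub I k) (-∑ i ∈ I, k i)) *
          vertexDiff L t t' Λ s.2 (Iᶜ.card + 1) (app (sub Iᶜ a) β)
            (app (sub Iᶜ k) (∑ i ∈ I, k i))))

/-- The contribution of all tree diagrams to the scale derivative of the difference. -/
noncomputable def treeDiff (K : ℝ → ℝ) (B₁ B₂ : ℝ) (L : ℝ → ℝ → PertOrder → ∀ n, Vertex n)
    (t t' Λ : ℝ) (r : PertOrder) {n : ℕ} (a : Fin n → Leg) (k : Fin n → Mom) : ℂ :=
  (((2 * Real.pi) ^ 4)⁻¹ : ℝ) * ∑ s ∈ treeOrders r, ∑ I : Finset (Fin n), ∑ α : Leg, ∑ β : Leg,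
    treeDiffTerm K B₁ B₂ L t t' Λ a s I α β k

/-- The contribution of the loop diagrams to the scale derivative of the difference. -/
noncomputable def loopDiff (K : ℝ → ℝ) (B₁ B₂ : ℝ) (L : ℝ → ℝ → PertOrder → ∀ n, Vertex n)
    (t t' Λ : ℝ) (r : PertOrder) {n : ℕ} (a : Fin n → Leg) (k : Fin n → Mom) : ℂ :=
  (((2 * Real.pi) ^ 4)⁻¹ : ℝ) * ∫ q : Mom, ∑ α : Leg, ∑ β : Leg, lineFactor K B₁ B₂ Λ α β q *
    vertexDiff L t t' Λ r (n + 2) (app (app a α) β) (app (app k q) (-q))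

/-- Vertex functions of order zero vanish, so the orders of both factors of a tree term may be
restricted to nonzero ones, which makes them of lower order than the sum. -/
lemma DiffSetting.treeTerm_sub (S : DiffSetting K P₁ P₂ ΛR MP A B₁ B₂ L) {Λ : ℝ}
    (hΛ : Λ ∈ Icc ΛR MP) {t t' : ℝ} (ht : t ∈ Icc (0 : ℝ) 1) (ht' : t' ∈ Icc (0 : ℝ) 1)
    (r : PertOrder) {n : ℕ} (a : Fin n → Leg) {k : Fin n → Mom} (hk : ∑ i, k i = 0) :
    treeTerm K B₁ B₂ (L Λ t) Λ r n a k - treeTerm K B₁ B₂ (L Λ t') Λ r n a k =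
      treeDiff K B₁ B₂ L t t' Λ r a k := by
  have hsub : ∀ t ∈ Icc (0 : ℝ) 1, treeTerm K B₁ B₂ (L Λ t) Λ r n a k =
      (((2 * Real.pi) ^ 4)⁻¹ : ℝ) * ∑ s ∈ treeOrders r, ∑ I : Finset (Fin n), ∑ α : Leg, ∑ β : Leg,
      ((lineWeight α * propagatorDot K B₁ B₂ Λ (∑ i ∈ I, k i) α β : ℝ) : ℂ) *
        (treeSign a I α : ℂ) *
        L Λ t s.1 (I.card + 1) (app (sub I a) α) (app (sub I k) (-∑ i ∈ I, k i)) *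
        L Λ t s.2 (Iᶜ.card + 1) (app (sub Iᶜ a) β) (app (sub Iᶜ k) (∑ i ∈ I, k i)) := by
    intro t ht
    rw [treeTerm, treeOrders]
    congr 1
    symm
    refine Finset.sum_subset (Finset.filter_subset _ _) fun s hs hns => ?_
    refine Finset.sum_eq_zero fun I _ => Finset.sum_eq_zero fun α _ =>
      Finset.sum_eq_zero fun β _ => ?_
    rw [Finset.mem_filter, not_and, not_and_or, not_not, not_not] at hns
    rcases hns hs with h | h
    · rw [h, S.flow.order_zero Λ hΛ t ht _ (Nat.le_add_left 1 _) _ _ (sum_left I k)]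
      ring
    · rw [h, S.flow.order_zero Λ hΛ t ht _ (Nat.le_add_left 1 _) _ _ (sum_right I hk)]
      ring
  rw [hsub t ht, hsub t' ht', treeDiff, ← mul_sub]
  congr 1
  simp only [← Finset.sum_sub_distrib]
  refine Finset.sum_congr rfl fun s _ => Finset.sum_congr rfl fun I _ =>
    Finset.sum_congr rfl fun α _ => Finset.sum_congr rfl fun β _ => ?_
  simp only [treeDiffTerm, lineFactor, vertexDiff]
  ring

lemma DiffSetting.loopTerm_sub (S : DiffSetting K P₁ P₂ ΛR MP A B₁ B₂ L) {Λ : ℝ}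
    (hΛ : Λ ∈ Icc ΛR MP) {t t' : ℝ} (ht : t ∈ Icc (0 : ℝ) 1) (ht' : t' ∈ Icc (0 : ℝ) 1)
    (hD : ∀ α β, ContDiff ℝ ∞ (lineFactor K B₁ B₂ Λ α β))
    (hD0 : ∀ α β q, 2 * Λ < ‖q‖ → lineFactor K B₁ B₂ Λ α β q = 0)
    (r : PertOrder) {n : ℕ} (a : Fin n → Leg) (k : Fin n → Mom) :
    loopTerm K B₁ B₂ (L Λ t) Λ r n a k - loopTerm K B₁ B₂ (L Λ t') Λ r n a k =
      loopDiff K B₁ B₂ L t t' Λ r a k := by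
  have hroute : Continuous fun q : Mom => app (app k q) (-q) :=
    (contDiff_app (contDiff_app contDiff_const contDiff_id) contDiff_id.neg).continuous
  have hint : ∀ t ∈ Icc (0 : ℝ) 1, Integrable fun q : Mom => ∑ α : Leg, ∑ β : Leg,
      ((lineWeight α * propagatorDot K B₁ B₂ Λ q α β : ℝ) : ℂ) *
        L Λ t r (n + 2) (app (app a α) β) (app (app k q) (-q)) := by
    intro t ht
    refine Continuous.integrable_of_hasCompactSupport ?_ ?_
    · exact continuous_finsetSum _ fun α _ => continuous_finsetSum _ fun β _ =>
        (hD α β).continuous.mul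
          ((S.contDiff hΛ ht r (Nat.le_add_left 1 (n + 1)) _).continuous.comp hroute)
    · refine HasCompactSupport.intro (isCompact_closedBall (0 : Mom) (2 * Λ)) fun q hq => ?_
      refine Finset.sum_eq_zero fun α _ => Finset.sum_eq_zero fun β _ => ?_
      have := hD0 α β q (by simpa using hq)
      rw [lineFactor] at this
      rw [this, zero_mul]
  rw [loopTerm, loopTerm, loopDiff, ← mul_sub, ← integral_sub (hint t ht) (hint t' ht')]
  congr 2
  funext q
  simp only [← Finset.sum_sub_distrib]
  refine Finset.sum_congr rfl fun α _ => Finset.sum_congr rfl fun β _ => ?_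
  simp only [lineFactor, vertexDiff]
  ring

/-- The propagator at zero momentum does not depend on the scale, since the cutoff function is
constant near zero. -/
lemma linearTerm_eq_zero (K : ℝ → ℝ) (A B₁ B₂ : ℝ) (L : PertOrder → ∀ n, Vertex n) (Λ : ℝ)
    (r : PertOrder) (n : ℕ) (a : Fin n → Leg) (k : Fin n → Mom) :
    linearTerm K A B₁ B₂ L Λ r n a k = 0 := by
  simp [linearTerm, propagatorDot, propagator]

lemma norm_treeSign {n : ℕ} (a : Fin n → Leg) (I : Finset (Fin n)) (α : Leg) :
    ‖(treeSign a I α : ℂ)‖ ≤ 1 := by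
  unfold treeSign
  split_ifs <;> simp

/-- The polynomial in the bound for one tree diagram. -/
noncomputable def treePln (c : ℕ → ℝ) (P₁ T : PertOrder → ℕ → ℕ → ℝ[X]) (s : PertOrder × PertOrder)
    (m m' p : ℕ) : ℝ[X] :=
  leib p (fun i => C (c i)) (fun j => leib j (T s.1 m) (P₁ s.2 m')) +
    leib p (fun i => C (c i)) (fun j => leib j (P₁ s.1 m) (T s.2 m'))

/-- The polynomial in the bound for the scale derivative of the difference of two solutions. -/
noncomputable def flowPln (c : ℕ → ℝ) (P₁ T : PertOrder → ℕ → ℕ → ℝ[X]) (U : ℕ → ℝ[X])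
    (r : PertOrder) (n p : ℕ) : ℝ[X] :=
  C ((2 * Real.pi) ^ 4)⁻¹ * (∑ s ∈ treeOrders r, ∑ I : Finset (Fin n), ∑ _α : Leg, ∑ _β : Leg,
      treePln c P₁ T s (I.card + 1) (Iᶜ.card + 1) p) +
    C (((2 * Real.pi) ^ 4)⁻¹ * (Fintype.card Leg * Fintype.card Leg * loopVol * c 0)) * U p

lemma isPln_flowPln {c : ℕ → ℝ} (hc : ∀ p, 0 ≤ c p) {P₁ T : PertOrder → ℕ → ℕ → ℝ[X]}
    {U : ℕ → ℝ[X]} {r : PertOrder} (hP₁ : ∀ s m p, IsPln (P₁ s m p))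
    (hT : ∀ s m p, IsPln (T s m p)) (hU : ∀ p, IsPln (U p)) (n p : ℕ) :
    IsPln (flowPln c P₁ T U r n p) := by
  have hv : 0 ≤ loopVol := measureReal_nonneg
  refine ((isPln_C (by positivity)).mul (IsPln.sum fun s _ => IsPln.sum fun I _ =>
    IsPln.sum fun α _ => IsPln.sum fun β _ => IsPln.add ?_ ?_)).add ((isPln_C ?_).mul (hU p))
  · exact IsPln.leib p (fun i => isPln_C (hc i)) fun j => IsPln.leib j (hT _ _) (hP₁ _ _)
  · exact IsPln.leib p (fun i => isPln_C (hc i)) fun j => IsPln.leib j (hP₁ _ _) (hT _ _)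
  · have := hc 0
    positivity

lemma scale_tree {Λ : ℝ} (hΛ : 0 < Λ) {m m' n : ℕ} (h : m + m' = n) :
    (Λ ^ 3)⁻¹ * (Λ ^ (6 - (m + 1 : ℕ) : ℤ) * Λ ^ (4 - (m' + 1 : ℕ) : ℤ)) = Λ ^ (5 - n : ℤ) := by
  rw [← zpow_add₀ hΛ.ne', ← zpow_natCast, ← zpow_neg, ← zpow_add₀ hΛ.ne']
  congr 1
  push_cast
  omega

lemma scale_loop {Λ : ℝ} (hΛ : 0 < Λ) (n : ℕ) :
    (Λ ^ 3)⁻¹ * Λ ^ (6 - (n + 2 : ℕ) : ℤ) * Λ ^ 4 = Λ ^ (5 - n : ℤ) := by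
  rw [← zpow_natCast, ← zpow_natCast, ← zpow_neg, ← zpow_add₀ hΛ.ne', ← zpow_add₀ hΛ.ne']
  congr 1
  push_cast
  omega

variable {c : ℕ → ℝ} {Λ t t' : ℝ} {n : ℕ} {r : PertOrder}

lemma DiffSetting.treeDiffTerm_bound (S : DiffSetting K P₁ P₂ ΛR MP A B₁ B₂ L)
    (hP₁ : ∀ s m p, IsPln (P₁ s m p)) {T : PertOrder → ℕ → ℕ → ℝ[X]}
    (hT : ∀ s m p, IsPln (T s m p)) {s : PertOrder × PertOrder} (hs : s.1 + s.2 = r)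
    (hT₁ : ∀ m p, 1 ≤ m → LipBound K P₁ P₂ s.1 m p (T s.1 m p))
    (hT₂ : ∀ m p, 1 ≤ m → LipBound K P₁ P₂ s.2 m p (T s.2 m p))
    (hΛ : Λ ∈ Icc ΛR MP) (ht : t ∈ Icc (0 : ℝ) 1) (ht' : t' ∈ Icc (0 : ℝ) 1)
    (hc : ∀ p, 0 ≤ c p) (α β : Leg) (hD : ContDiff ℝ ∞ (lineFactor K B₁ B₂ Λ α β))
    (hD0 : ∀ q, 2 * Λ < ‖q‖ → lineFactor K B₁ B₂ Λ α β q = 0)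
    (hDb : ∀ l q, ‖dirDeriv lineDir l (lineFactor K B₁ B₂ Λ α β) q‖ ≤
      (Λ ^ 3)⁻¹ * Λ⁻¹ ^ l.length * c l.length) (a : Fin n → Leg) (I : Finset (Fin n)) :
    ContDiff ℝ ∞ (treeDiffTerm K B₁ B₂ L t t' Λ a s I α β) ∧
    DerivBound Λ (diffScale ΛR MP t t' r * Λ ^ (5 - n : ℤ))
      (fun p => (treePln c P₁ T s (I.card + 1) (Iᶜ.card + 1) p).eval (Real.log (MP / ΛR)))
      (treeDiffTerm K B₁ B₂ L t t' Λ a s I α β) := by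
  have hpos : 0 < Λ := S.pos.trans_le hΛ.1
  have hMP : 0 < MP := S.pos.trans S.lt
  have hlog := S.log_nonneg
  have hm : 1 ≤ I.card + 1 := Nat.le_add_left 1 _
  have hm' : 1 ≤ Iᶜ.card + 1 := Nat.le_add_left 1 _
  have hcard : I.card + Iᶜ.card = n := by rw [Finset.card_add_card_compl, Fintype.card_fin]
  have hX := S.contDiff_vertexDiff hΛ ht ht' s.1 hm (app (sub I a) α)
  have hX' := S.contDiff hΛ ht' s.1 hm (app (sub I a) α)
  have hY := S.contDiff hΛ ht s.2 hm' (app (sub Iᶜ a) β)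
  have hY' := S.contDiff_vertexDiff hΛ ht ht' s.2 hm' (app (sub Iᶜ a) β)
  have hl : ContDiff ℝ ∞ fun k : Fin n → Mom => app (sub I k) (-∑ i ∈ I, k i) :=
    contDiff_app (contDiff_sub I) (contDiff_lineMom I).neg
  have hr : ContDiff ℝ ∞ fun k : Fin n → Mom => app (sub Iᶜ k) (∑ i ∈ I, k i) :=
    contDiff_app (contDiff_sub Iᶜ) (contDiff_lineMom I)
  have hDI : ContDiff ℝ ∞ fun k : Fin n → Mom => lineFactor K B₁ B₂ Λ α β (∑ i ∈ I, k i) :=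
    hD.comp (contDiff_lineMom I)
  have s₁ := hDI.mul ((hX.comp hl).mul (hY.comp hr))
  have s₂ := hDI.mul ((hX'.comp hl).mul (hY'.comp hr))
  have hcD : 0 ≤ (Λ ^ 3)⁻¹ := by positivity
  have hd₁ := mul_nonneg (diffScale_nonneg S.pos.le hMP.le t t' s.1)
    (zpow_nonneg hpos.le (6 - (I.card + 1 : ℕ) : ℤ))
  have hd₂ := mul_nonneg (diffScale_nonneg S.pos.le hMP.le t t' s.2)
    (zpow_nonneg hpos.le (6 - (Iᶜ.card + 1 : ℕ) : ℤ))
  have ho₁ := mul_nonneg (orderScale_nonneg S.pos.le hMP.le s.1)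
    (zpow_nonneg hpos.le (4 - (I.card + 1 : ℕ) : ℤ))
  have ho₂ := mul_nonneg (orderScale_nonneg S.pos.le hMP.le s.2)
    (zpow_nonneg hpos.le (4 - (Iᶜ.card + 1 : ℕ) : ℤ))
  have b₁ := tree_bound hpos hD hD0 hcD hc hDb I hX hY hd₁ ho₂
    (fun p => (hT s.1 _ p).eval_nonneg hlog) (fun p => (hP₁ s.2 _ p).eval_nonneg hlog)
    (LipBound.derivBound (fun p => hT₁ _ p hm) S hΛ ht ht' _) (S.bound Λ hΛ t ht s.2 _ hm' _)
  have b₂ := tree_bound hpos hD hD0 hcD hc hDb I hX' hY' ho₁ hd₂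
    (fun p => (hP₁ s.1 _ p).eval_nonneg hlog) (fun p => (hT s.2 _ p).eval_nonneg hlog)
    (S.bound Λ hΛ t' ht' s.1 _ hm _) (LipBound.derivBound (fun p => hT₂ _ p hm') S hΛ ht ht' _)
  have e₁ : (Λ ^ 3)⁻¹ * (diffScale ΛR MP t t' s.1 * Λ ^ (6 - (I.card + 1 : ℕ) : ℤ) *
      (orderScale ΛR MP s.2 * Λ ^ (4 - (Iᶜ.card + 1 : ℕ) : ℤ))) =
      diffScale ΛR MP t t' r * Λ ^ (5 - n : ℤ) := by
    rw [← scale_tree hpos hcard, diffScale, diffScale, ← hs, orderScale_add]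
    ring
  have e₂ : (Λ ^ 3)⁻¹ * (orderScale ΛR MP s.1 * Λ ^ (4 - (I.card + 1 : ℕ) : ℤ) *
      (diffScale ΛR MP t t' s.2 * Λ ^ (6 - (Iᶜ.card + 1 : ℕ) : ℤ))) =
      diffScale ΛR MP t t' r * Λ ^ (5 - n : ℤ) := by
    rw [← scale_tree hpos ((add_comm _ _).trans hcard), diffScale, diffScale, ← hs, orderScale_add]
    ring
  rw [e₁] at b₁
  rw [e₂] at b₂
  refine ⟨contDiff_const.mul (s₁.add s₂), ?_⟩
  have b₃ := (DerivBound.add s₁ s₂ b₁ b₂).const_mul (norm_treeSign a I α)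
  simp only [one_mul] at b₃
  simp only [treePln, eval_add, eval_leib, eval_C]
  exact b₃

/-- The main estimate: for the difference of two solutions, all the terms in the flow equation gain
the factor `Λ² / MP²`, and one power of `Λ` is lost relative to the bound for the difference. -/
lemma DiffSetting.flow_bound (S : DiffSetting K P₁ P₂ ΛR MP A B₁ B₂ L)
    (hP₁ : ∀ s m p, IsPln (P₁ s m p)) {T : PertOrder → ℕ → ℕ → ℝ[X]}
    (hT : ∀ s m p, IsPln (T s m p))
    (hTb : ∀ s, s.degree < r.degree → ∀ m p, 1 ≤ m → LipBound K P₁ P₂ s m p (T s m p))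
    {U : ℕ → ℝ[X]} (hUb : ∀ p, LipBound K P₁ P₂ r (n + 2) p (U p))
    (hn : 1 ≤ n) (hΛ : Λ ∈ Icc ΛR MP) (ht : t ∈ Icc (0 : ℝ) 1) (ht' : t' ∈ Icc (0 : ℝ) 1)
    (hc : ∀ p, 0 ≤ c p) (hD : ∀ α β, ContDiff ℝ ∞ (lineFactor K B₁ B₂ Λ α β) ∧
      (∀ q, 2 * Λ < ‖q‖ → lineFactor K B₁ B₂ Λ α β q = 0) ∧
      ∀ l q, ‖dirDeriv lineDir l (lineFactor K B₁ B₂ Λ α β) q‖ ≤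
        (Λ ^ 3)⁻¹ * Λ⁻¹ ^ l.length * c l.length) (a : Fin n → Leg)
    {Φ : (Fin n → Mom) → ℂ} (hΦ : ContDiff ℝ ∞ Φ)
    (hflow : ∀ k, ∑ i, k i = 0 → HasDerivWithinAt (fun s => vertexDiff L t t' s r n a k) (Φ k)
      (Icc ΛR MP) Λ) :
    DerivBound Λ (diffScale ΛR MP t t' r * Λ ^ (5 - n : ℤ))
      (fun p => (flowPln c P₁ T U r n p).eval (Real.log (MP / ΛR))) Φ := by
  have hpos : 0 < Λ := S.pos.trans_le hΛ.1
  -- the right-hand side of the flow equation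
  have hrhs : ∀ k, ∑ i, k i = 0 →
      Φ k = -(treeDiff K B₁ B₂ L t t' Λ r a k + loopDiff K B₁ B₂ L t t' Λ r a k) := by
    intro k hk
    have h1 := (S.flow.flow Λ hΛ t ht r n hn a k hk).fun_sub
      (S.flow.flow Λ hΛ t' ht' r n hn a k hk)
    have h2 := (uniqueDiffOn_Icc S.lt Λ hΛ).eq_deriv _ (hflow k hk) h1
    rw [h2, linearTerm_eq_zero, linearTerm_eq_zero, ← S.treeTerm_sub hΛ ht ht' r a hk,
      ← S.loopTerm_sub hΛ ht ht' (fun α β => (hD α β).1) (fun α β => (hD α β).2.1) r a k]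
    ring
  have hlt : ∀ s ∈ treeOrders r, s.1 + s.2 = r ∧ s.1.degree < r.degree ∧
      s.2.degree < r.degree := by
    intro s hs
    rw [treeOrders, Finset.mem_filter, Finset.HasAntidiagonal.mem_antidiagonal] at hs
    obtain ⟨hadd, h1, h2⟩ := hs
    have hdeg : s.1.degree + s.2.degree = r.degree := by rw [← hadd, map_add]
    have p1 : s.1.degree ≠ 0 := fun h => h1 ((Finsupp.degree_eq_zero_iff _).mp h)
    have p2 : s.2.degree ≠ 0 := fun h => h2 ((Finsupp.degree_eq_zero_iff _).mp h)
    exact ⟨hadd, by omega, by omega⟩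
  have hterm : ∀ s ∈ treeOrders r, ∀ I α β, _ := fun s hs I α β =>
    S.treeDiffTerm_bound hP₁ hT (hlt s hs).1 (hTb s.1 (hlt s hs).2.1) (hTb s.2 (hlt s hs).2.2)
      hΛ ht ht' hc α β (hD α β).1 (hD α β).2.1 (hD α β).2.2 a I
  have hnorm : ‖((((2 * Real.pi) ^ 4)⁻¹ : ℝ) : ℂ)‖ ≤ ((2 * Real.pi) ^ 4)⁻¹ := by
    rw [Complex.norm_real, Real.norm_of_nonneg (by positivity)]
  have htree : ContDiff ℝ ∞ (treeDiff K B₁ B₂ L t t' Λ r a) :=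
    contDiff_const.mul (ContDiff.sum fun s hs => ContDiff.sum fun I _ => ContDiff.sum fun α _ =>
      ContDiff.sum fun β _ => (hterm s hs I α β).1)
  have htreeb : DerivBound Λ (diffScale ΛR MP t t' r * Λ ^ (5 - n : ℤ)) _
      (treeDiff K B₁ B₂ L t t' Λ r a) :=
    DerivBound.const_mul (DerivBound.sum
      (fun s hs => ContDiff.sum fun I _ => ContDiff.sum fun α _ =>
        ContDiff.sum fun β _ => (hterm s hs I α β).1)
      fun s hs => DerivBound.sum
        (fun I _ => ContDiff.sum fun α _ => ContDiff.sum fun β _ => (hterm s hs I α β).1)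
        fun I _ => DerivBound.sum (fun α _ => ContDiff.sum fun β _ => (hterm s hs I α β).1)
          fun α _ => DerivBound.sum (fun β _ => (hterm s hs I α β).1)
            fun β _ => (hterm s hs I α β).2) hnorm
  have hn2 : 1 ≤ n + 2 := by omega
  have hloopb := (loop_bound hpos (n := n) (fun α β => (hD α β).1) (fun α β => (hD α β).2.1)
    (cD := (Λ ^ 3)⁻¹ * c 0) (mul_nonneg (by positivity) (hc 0))
    (fun α β q => by simpa using (hD α β).2.2 [] q)
    (fun α β => S.contDiff_vertexDiff hΛ ht ht' r hn2 (app (app a α) β))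
    (fun α β => LipBound.derivBound hUb S hΛ ht ht' (app (app a α) β))).const_mul hnorm
  -- the loop term is smooth because the other terms of the flow equation are
  set Ψ : (Fin n → Mom) → ℂ := fun k => Φ k + treeDiff K B₁ B₂ L t t' Λ r a k with hΨ
  have hΨs : ContDiff ℝ ∞ Ψ := hΦ.add htree
  have hΨb : DerivBound Λ (diffScale ΛR MP t t' r * Λ ^ (5 - n : ℤ))
      (fun p => ((2 * Real.pi) ^ 4)⁻¹ * (Fintype.card Leg * Fintype.card Leg * loopVol * c 0) *
        (U p).eval (Real.log (MP / ΛR))) (fun k => (-1) * Ψ k) := by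
    refine DerivBound.congr (X := loopDiff K B₁ B₂ L t t' Λ r a) ?_ fun k hk => by
      rw [hΨ]; simp only; rw [hrhs k hk]; ring
    intro l k hk
    refine (hloopb l k hk).trans (le_of_eq ?_)
    rw [← scale_loop hpos n]
    ring
  have hneg : (fun k => (-1 : ℂ) * (-1 * Ψ k)) = Ψ := by funext k; ring
  have hΨ' := hΨb.const_mul (z := -1) (C := 1) (by simp)
  rw [hneg] at hΨ'
  have htree' := htreeb.const_mul (z := -1) (C := 1) (by simp)
  have hfin := DerivBound.add (contDiff_const.mul htree) hΨs htree' hΨ'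
  intro l k hk
  have h := hfin l k hk
  have hfun : (fun k => -1 * treeDiff K B₁ B₂ L t t' Λ r a k + Ψ k) = Φ := by
    funext k; rw [hΨ]; ring
  rw [hfun] at h
  refine h.trans (le_of_eq ?_)
  simp only [flowPln, eval_add, eval_mul, eval_C, eval_finsetSum, one_mul]

end Difference

/-! ### Integration of the flow equation -/

section Integration

variable {K : ℝ → ℝ} {P₁ P₂ : PertOrder → ℕ → ℕ → ℝ[X]} {ΛR MP A B₁ B₂ : ℝ}
  {L : ℝ → ℝ → PertOrder → ∀ n, Vertex n} {Λ t t' : ℝ} {n : ℕ} {r : PertOrder}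

/-- The scale derivative of the difference of two solutions is smooth in the momenta, and its momentum
derivatives are the scale derivatives of the momentum derivatives. -/
lemma DiffSetting.exists_scaleDeriv (S : DiffSetting K P₁ P₂ ΛR MP A B₁ B₂ L) (hn : 1 ≤ n)
    (ht : t ∈ Icc (0 : ℝ) 1) (ht' : t' ∈ Icc (0 : ℝ) 1) (r : PertOrder) (a : Fin n → Leg) :
    ∃ Φ : ℝ → (Fin n → Mom) → ℂ, (∀ Λ ∈ Icc ΛR MP, ContDiff ℝ ∞ (Φ Λ)) ∧
      ∀ l, ∀ Λ ∈ Icc ΛR MP, ∀ k, HasDerivWithinAt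
        (fun s => momDeriv l (vertexDiff L t t' s r n a) k) (momDeriv l (Φ Λ) k) (Icc ΛR MP) Λ := by
  have hs : ∀ t ∈ Icc (0 : ℝ) 1, ContDiffOn ℝ ∞ (fun p : ℝ × (Fin n → Mom) => L p.1 t r n a p.2)
      (Icc ΛR MP ×ˢ univ) := by
    intro t ht
    have hmap : ContDiff ℝ ∞ fun p : ℝ × (Fin n → Mom) => (p.1, t, p.2) :=
      contDiff_fst.prodMk (contDiff_const.prodMk contDiff_snd)
    exact (S.flow.smooth r n a hn).comp hmap.contDiffOn
      fun p hp => ⟨hp.1, ht, mem_univ _⟩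
  have hF : ContDiffOn ℝ ∞ (fun p : ℝ × (Fin n → Mom) => vertexDiff L t t' p.1 r n a p.2)
      (Icc ΛR MP ×ˢ univ) := (hs t ht).sub (hs t' ht')
  refine ⟨fun Λ k => derivWithin (fun s => vertexDiff L t t' s r n a k) (Icc ΛR MP) Λ,
    fun Λ hΛ => contDiff_slice (contDiffOn_derivWithin_slice S.lt hF) hΛ, fun l Λ hΛ k => ?_⟩
  exact hasDerivWithinAt_dirDeriv S.lt dir l hF hΛ k

lemma DiffSetting.momDeriv_vertexDiff (S : DiffSetting K P₁ P₂ ΛR MP A B₁ B₂ L)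
    (hΛ : Λ ∈ Icc ΛR MP) (ht : t ∈ Icc (0 : ℝ) 1) (ht' : t' ∈ Icc (0 : ℝ) 1) (hn : 1 ≤ n)
    (a : Fin n → Leg) (l : List (Fin n × Fin n × Fin 4)) (k : Fin n → Mom) :
    momDeriv l (vertexDiff L t t' Λ r n a) k =
      momDeriv l (L Λ t r n a) k - momDeriv l (L Λ t' r n a) k :=
  congrFun (dirDeriv_sub (S.contDiff hΛ ht r hn a) (S.contDiff hΛ ht' r hn a) dir l) k

lemma zpow_mul_inv_pow (hΛ : 0 < Λ) (m : ℤ) (p : ℕ) :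
    Λ ^ m * Λ⁻¹ ^ p = Λ ^ (m - p) := by
  rw [zpow_sub₀ hΛ.ne', inv_pow, zpow_natCast, div_eq_mul_inv]

lemma InDomain.zero {Λ : ℝ} : InDomain Λ (0 : Fin n → Mom) :=
  ⟨by simp, fun i => by simp; positivity⟩

/-- Irrelevant case: the flow equation is integrated downwards from `MP`, where the bare data
provide the bound. -/
lemma lipBound_of_irrelevant {R : ℝ[X]} {p : ℕ} (hR : IsPln R) (hn : 1 ≤ n) (hp : 6 ≤ n + p)
    (hP₂ : IsPln (P₂ r n p))
    (h : ∀ (ΛR MP A B₁ B₂ : ℝ) (L : ℝ → ℝ → PertOrder → ∀ n, Vertex n),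
      DiffSetting K P₁ P₂ ΛR MP A B₁ B₂ L → ∀ t ∈ Icc (0 : ℝ) 1, ∀ t' ∈ Icc (0 : ℝ) 1,
      ∀ (a : Fin n → Leg) l, l.length = p → ∃ f' : ℝ → (Fin n → Mom) → ℂ,
        (∀ Λ ∈ Icc ΛR MP, ∀ k, HasDerivWithinAt
          (fun s => momDeriv l (vertexDiff L t t' s r n a) k) (f' Λ k) (Icc ΛR MP) Λ) ∧
        ∀ Λ ∈ Ioo ΛR MP, ∀ k, InDomain Λ k → ‖f' Λ k‖ ≤ diffScale ΛR MP t t' r *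
          Λ ^ (5 - n : ℤ) * Λ⁻¹ ^ p * R.eval (Real.log (MP / ΛR))) :
    LipBound K P₁ P₂ r n p (P₂ r n p + X * R) := by
  intro ΛR MP A B₁ B₂ L S Λ hΛ t ht t' ht' a l k hl hk
  obtain ⟨f', hf', hb⟩ := h ΛR MP A B₁ B₂ L S t ht t' ht' a l hl
  have hpos : 0 < Λ := S.pos.trans_le hΛ.1
  have hMP : 0 < MP := S.pos.trans S.lt
  have hlog := S.log_nonneg
  have hMPmem : MP ∈ Icc ΛR MP := right_mem_Icc.mpr S.lt.le
  set f : ℝ → ℂ := fun s => momDeriv l (vertexDiff L t t' s r n a) k with hf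
  set ℓ := Real.log (MP / ΛR) with hℓ
  set e : ℤ := 6 - n - p with he
  have he0 : e ≤ 0 := by omega
  have hmono : ∀ s, Λ ≤ s → s ^ e ≤ Λ ^ e := fun s hs => by
    obtain ⟨j, hj⟩ := Int.exists_eq_neg_ofNat he0
    rw [hj, zpow_neg, zpow_neg, zpow_natCast, zpow_natCast]
    gcongr
  have hd := diffScale_nonneg S.pos.le hMP.le t t' r
  have hRn := hR.eval_nonneg hlog
  -- the value at the ultraviolet cutoff
  have h1 : ‖f MP‖ ≤ diffScale ΛR MP t t' r * Λ ^ e * (P₂ r n p).eval ℓ := by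
    have hb := S.bare t ht t' ht' r n hn a l k (by omega) (hk.mono hpos.le hΛ.2)
    rw [← S.momDeriv_vertexDiff hMPmem ht ht' hn a l k] at hb
    refine hb.trans ?_
    rw [hl, mul_assoc (orderScale _ _ _), zpow_mul_inv_pow hMP]
    have e1 : MP ^ (4 - n - p : ℤ) = (MP ^ 2)⁻¹ * MP ^ e := by
      rw [← zpow_natCast, ← zpow_neg, ← zpow_add₀ hMP.ne']
      congr 1
      push_cast
      omega
    rw [e1]
    calc |t - t'| * (orderScale ΛR MP r * ((MP ^ 2)⁻¹ * MP ^ e) * (P₂ r n p).eval ℓ)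
        = diffScale ΛR MP t t' r * MP ^ e * (P₂ r n p).eval ℓ := by rw [diffScale]; ring
      _ ≤ _ := by
        have := hP₂.eval_nonneg hlog
        gcongr
        exact hmono MP hΛ.2
  have h2 : ‖f MP - f Λ‖ ≤ diffScale ΛR MP t t' r * Λ ^ e * R.eval ℓ * Real.log MP -
      diffScale ΛR MP t t' r * Λ ^ e * R.eval ℓ * Real.log Λ := by
    refine norm_sub_le_of_deriv_le (f := f) (f' := fun s => f' s k)
      (B := fun s => diffScale ΛR MP t t' r * Λ ^ e * R.eval ℓ * Real.log s)
      (B' := fun s => diffScale ΛR MP t t' r * Λ ^ e * R.eval ℓ * s⁻¹) hΛ.2 ?_ ?_ ?_ ?_ ?_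
    · exact fun s hs => ((hf' s ⟨hΛ.1.trans hs.1, hs.2⟩ k).continuousWithinAt).mono
        (Icc_subset_Icc hΛ.1 le_rfl)
    · exact fun s hs => (hf' s ⟨hΛ.1.trans hs.1.le, hs.2.le⟩ k).hasDerivAt
        (Icc_mem_nhds (hΛ.1.trans_lt hs.1) hs.2)
    · exact continuousOn_const.mul (Real.continuousOn_log.mono fun s hs =>
        (hpos.trans_le hs.1).ne')
    · exact fun s hs => (Real.hasDerivAt_log (hpos.trans hs.1).ne').const_mul _
    · intro s hs
      have hs0 : 0 < s := hpos.trans hs.1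
      refine (hb s ⟨hΛ.1.trans_lt hs.1, hs.2⟩ k (hk.mono hpos.le hs.1.le)).trans ?_
      rw [mul_assoc (diffScale _ _ _ _ _), zpow_mul_inv_pow hs0]
      have e2 : s ^ (5 - n - p : ℤ) = s ^ e * s⁻¹ := by
        rw [← zpow_sub_one₀ hs0.ne']
        congr 1
        omega
      rw [e2]
      calc diffScale ΛR MP t t' r * (s ^ e * s⁻¹) * R.eval ℓ
          = diffScale ΛR MP t t' r * s ^ e * R.eval ℓ * s⁻¹ := by ring
        _ ≤ _ := by
          gcongr
          exact hmono s hs.1.le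
  have h3 : Real.log MP - Real.log Λ ≤ ℓ := by
    rw [hℓ, Real.log_div hMP.ne' S.pos.ne']
    linarith [Real.log_le_log S.pos hΛ.1]
  calc ‖f Λ‖ = ‖f MP - (f MP - f Λ)‖ := by rw [sub_sub_cancel]
    _ ≤ ‖f MP‖ + ‖f MP - f Λ‖ := norm_sub_le _ _
    _ ≤ diffScale ΛR MP t t' r * Λ ^ e * (P₂ r n p).eval ℓ +
        diffScale ΛR MP t t' r * Λ ^ e * R.eval ℓ * ℓ := by
      refine add_le_add h1 (h2.trans ?_)
      rw [← mul_sub]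
      have : 0 ≤ Λ ^ e := zpow_nonneg hpos.le e
      gcongr
    _ = _ := by
      rw [mul_assoc (diffScale _ _ _ _ _) (Λ ^ (6 - n : ℤ)), zpow_mul_inv_pow hpos]
      simp only [eval_add, eval_mul, eval_X]
      ring

/-- Relevant case: at zero momentum the flow equation is integrated upwards from `ΛR`, where the
difference of the solutions vanishes; other momenta are reached by a Taylor estimate, which needs
one more momentum derivative. -/
lemma lipBound_of_relevant {R Q : ℝ[X]} {p : ℕ} (hR : IsPln R) (hn : 1 ≤ n) (hp : n + p ≤ 5)
    (hQ : LipBound K P₁ P₂ r n (p + 1) Q)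
    (h : ∀ (ΛR MP A B₁ B₂ : ℝ) (L : ℝ → ℝ → PertOrder → ∀ n, Vertex n),
      DiffSetting K P₁ P₂ ΛR MP A B₁ B₂ L → ∀ t ∈ Icc (0 : ℝ) 1, ∀ t' ∈ Icc (0 : ℝ) 1,
      ∀ (a : Fin n → Leg) l, l.length = p → ∃ f' : ℝ → (Fin n → Mom) → ℂ,
        (∀ Λ ∈ Icc ΛR MP, ∀ k, HasDerivWithinAt
          (fun s => momDeriv l (vertexDiff L t t' s r n a) k) (f' Λ k) (Icc ΛR MP) Λ) ∧
        ∀ Λ ∈ Ioo ΛR MP, ∀ k, InDomain Λ k → ‖f' Λ k‖ ≤ diffScale ΛR MP t t' r *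
          Λ ^ (5 - n : ℤ) * Λ⁻¹ ^ p * R.eval (Real.log (MP / ΛR))) :
    LipBound K P₁ P₂ r n p (R + C (8 * n : ℝ) * Q) := by
  intro ΛR MP A B₁ B₂ L S Λ hΛ t ht t' ht' a l k hl hk
  obtain ⟨f', hf', hb⟩ := h ΛR MP A B₁ B₂ L S t ht t' ht' a l hl
  have hpos : 0 < Λ := S.pos.trans_le hΛ.1
  have hMP : 0 < MP := S.pos.trans S.lt
  have hlog := S.log_nonneg
  have hRmem : ΛR ∈ Icc ΛR MP := left_mem_Icc.mpr S.lt.le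
  set f : ℝ → ℂ := fun s => momDeriv l (vertexDiff L t t' s r n a) 0 with hf
  set ℓ := Real.log (MP / ΛR) with hℓ
  have hd := diffScale_nonneg S.pos.le hMP.le t t' r
  have hRn := hR.eval_nonneg hlog
  obtain ⟨j, hj⟩ : ∃ j : ℕ, (5 - n - p : ℤ) = j := ⟨5 - n - p, by omega⟩
  have h0 : f ΛR = 0 := by
    rw [hf]
    simp only
    rw [S.momDeriv_vertexDiff hRmem ht ht' hn a l 0, S.renorm t ht t' ht' r n hn a l (by omega),
      sub_self]
  have h1 : ‖f Λ - f ΛR‖ ≤ diffScale ΛR MP t t' r * Λ ^ j * R.eval ℓ * Λ -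
      diffScale ΛR MP t t' r * Λ ^ j * R.eval ℓ * ΛR := by
    refine norm_sub_le_of_deriv_le (f := f) (f' := fun s => f' s 0)
      (B := fun s => diffScale ΛR MP t t' r * Λ ^ j * R.eval ℓ * s)
      (B' := fun s => diffScale ΛR MP t t' r * Λ ^ j * R.eval ℓ * 1) hΛ.1 ?_ ?_ ?_ ?_ ?_
    · exact fun s hs => ((hf' s ⟨hs.1, hs.2.trans hΛ.2⟩ 0).continuousWithinAt).mono
        (Icc_subset_Icc le_rfl hΛ.2)
    · exact fun s hs => (hf' s ⟨hs.1.le, hs.2.le.trans hΛ.2⟩ 0).hasDerivAt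
        (Icc_mem_nhds hs.1 (hs.2.trans_le hΛ.2))
    · exact (continuous_const.mul continuous_id).continuousOn
    · exact fun s hs => (hasDerivAt_id s).const_mul _
    · intro s hs
      have hs0 : 0 < s := S.pos.trans hs.1
      refine (hb s ⟨hs.1, hs.2.trans_le hΛ.2⟩ 0 InDomain.zero).trans ?_
      rw [mul_assoc (diffScale _ _ _ _ _), zpow_mul_inv_pow hs0, hj, zpow_natCast, mul_one]
      have := hs.2.le
      gcongr
  have hcd := S.contDiff_vertexDiff hΛ ht ht' r hn a
  have h2 := norm_sub_zero_le (contDiff_dirDeriv hcd dir l) ⟨0, hn⟩ hpos.le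
    (M := diffScale ΛR MP t t' r * Λ ^ (6 - n : ℤ) * Λ⁻¹ ^ (p + 1) * Q.eval ℓ)
    (fun d k' hk' => hQ ΛR MP A B₁ B₂ L S Λ hΛ t ht t' ht' a (d :: l) k' (by simp [hl]) hk') hk
  have h3 : ‖f Λ‖ ≤ diffScale ΛR MP t t' r * Λ ^ j * R.eval ℓ * Λ := by
    rw [h0, sub_zero] at h1
    refine h1.trans (sub_le_self _ ?_)
    have := S.pos
    positivity
  have e1 : Λ ^ (6 - n : ℤ) * Λ⁻¹ ^ p = Λ ^ j * Λ := by
    rw [zpow_mul_inv_pow hpos, ← pow_succ, ← zpow_natCast]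
    congr 1
    push_cast
    omega
  have e2 : Λ * Λ⁻¹ ^ (p + 1) = Λ⁻¹ ^ p := by
    rw [pow_succ, mul_comm (Λ⁻¹ ^ p), ← mul_assoc, mul_inv_cancel₀ hpos.ne', one_mul]
  calc ‖momDeriv l (vertexDiff L t t' Λ r n a) k‖
      = ‖f Λ + (momDeriv l (vertexDiff L t t' Λ r n a) k - f Λ)‖ := by rw [add_sub_cancel]
    _ ≤ ‖f Λ‖ + ‖momDeriv l (vertexDiff L t t' Λ r n a) k - f Λ‖ := norm_add_le _ _
    _ ≤ _ := add_le_add h3 h2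
    _ = diffScale ΛR MP t t' r * (Λ ^ j * Λ) * R.eval ℓ + 8 * n * (diffScale ΛR MP t t' r *
        Λ ^ (6 - n : ℤ) * (Λ * Λ⁻¹ ^ (p + 1)) * Q.eval ℓ) := by ring
    _ = _ := by
      rw [← e1, e2]
      simp only [eval_add, eval_mul, eval_C]
      ring

/-- Induction step: bounds at lower orders and for two more legs imply the bounds for the `n`-point
functions of order `r`. -/
lemma exists_lipBound_step (hK : IsCutoff K) (hP₁ : ∀ s m p, IsPln (P₁ s m p))
    (hP₂ : ∀ s m p, IsPln (P₂ s m p)) (hn : 1 ≤ n)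
    (hlow : ∀ s, s.degree < r.degree → ∀ m p, 1 ≤ m → ∃ Q, IsPln Q ∧ LipBound K P₁ P₂ s m p Q)
    (hlegs : ∀ p, ∃ Q, IsPln Q ∧ LipBound K P₁ P₂ r (n + 2) p Q) (p : ℕ) :
    ∃ Q, IsPln Q ∧ LipBound K P₁ P₂ r n p Q := by
  have hT : ∀ s m p, ∃ Q, IsPln Q ∧
      (s.degree < r.degree → 1 ≤ m → LipBound K P₁ P₂ s m p Q) := by
    intro s m p
    by_cases h : s.degree < r.degree ∧ 1 ≤ m
    · obtain ⟨Q, h1, h2⟩ := hlow s h.1 m p h.2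
      exact ⟨Q, h1, fun _ _ => h2⟩
    · exact ⟨0, isPln_zero, fun h1 h2 => absurd ⟨h1, h2⟩ h⟩
  choose T hT hTb using hT
  choose U hU hUb using hlegs
  obtain ⟨c, hc, hline⟩ := exists_lineFactor_bound hK
  have hR := isPln_flowPln hc hP₁ hT hU (r := r) n
  have hder : ∀ p, ∀ (ΛR MP A B₁ B₂ : ℝ) (L : ℝ → ℝ → PertOrder → ∀ n, Vertex n),
      DiffSetting K P₁ P₂ ΛR MP A B₁ B₂ L → ∀ t ∈ Icc (0 : ℝ) 1, ∀ t' ∈ Icc (0 : ℝ) 1,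
      ∀ (a : Fin n → Leg) l, l.length = p → ∃ f' : ℝ → (Fin n → Mom) → ℂ,
        (∀ Λ ∈ Icc ΛR MP, ∀ k, HasDerivWithinAt
          (fun s => momDeriv l (vertexDiff L t t' s r n a) k) (f' Λ k) (Icc ΛR MP) Λ) ∧
        ∀ Λ ∈ Ioo ΛR MP, ∀ k, InDomain Λ k → ‖f' Λ k‖ ≤ diffScale ΛR MP t t' r *
          Λ ^ (5 - n : ℤ) * Λ⁻¹ ^ p *
            (flowPln c P₁ T U r n p).eval (Real.log (MP / ΛR)) := by
    intro p ΛR MP A B₁ B₂ L S t ht t' ht' a l hl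
    obtain ⟨Φ, hΦ, hder⟩ := S.exists_scaleDeriv hn ht ht' r a
    refine ⟨fun Λ => momDeriv l (Φ Λ), hder l, fun Λ hΛ k hk => ?_⟩
    have hΛ' : Λ ∈ Icc ΛR MP := Ioo_subset_Icc_self hΛ
    have hpos : 0 < Λ := S.pos.trans hΛ.1
    -- the mass parameters stay below the scale because `ΛR < Λ`
    have hsq : ΛR ^ 2 < Λ ^ 2 := pow_lt_pow_left₀ hΛ.1 S.pos.le two_ne_zero
    have hb := S.flow_bound hP₁ hT (fun s hs m p hm => hTb s m p hs hm) hUb hn hΛ' ht ht' hc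
      (hline B₁ B₂ Λ hpos (S.mass₁.trans_lt hsq) (S.mass₂.trans_lt hsq)) a (hΦ Λ hΛ')
      (fun k _ => hder [] Λ hΛ' k) l k hk
    rwa [hl] at hb
  -- descending induction on the number of momentum derivatives
  have key : ∀ j p, 6 ≤ n + p + j → ∃ Q, IsPln Q ∧ LipBound K P₁ P₂ r n p Q := by
    intro j
    induction j with
    | zero =>
      intro p hp
      exact ⟨_, (hP₂ r n p).add (isPln_X.mul (hR p)),
        lipBound_of_irrelevant (hR p) hn (by omega) (hP₂ r n p) (hder p)⟩
    | succ j ih =>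
      intro p hp
      by_cases h6 : 6 ≤ n + p + j
      · exact ih p h6
      · by_cases h6' : 6 ≤ n + p
        · omega
        obtain ⟨Q, hQ, hQb⟩ := ih (p + 1) (by omega)
        exact ⟨_, (hR p).add ((isPln_C (by positivity)).mul hQ),
          lipBound_of_relevant (hR p) hn (by omega) hQb (hder p)⟩
  exact key 6 p (by omega)

lemma lipBound_of_many_legs (h : 3 * r.degree + 2 < n) (p : ℕ) :
    LipBound K P₁ P₂ r n p 0 := by
  intro ΛR MP A B₁ B₂ L S Λ hΛ t ht t' ht' a l k _ hk
  have hz : ∀ k : Fin n → Mom, ∑ i, k i = 0 → vertexDiff L t t' Λ r n a k = 0 := fun k hk => by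
    rw [vertexDiff, S.flow.finite_legs Λ hΛ t ht r n h a k hk,
      S.flow.finite_legs Λ hΛ t' ht' r n h a k hk, sub_zero]
  rw [momDeriv_congr (g := fun _ => 0) hz l hk.1, momDeriv_eq_dirDeriv, dirDeriv_zero]
  simp

/-- The double induction: over the order of perturbation theory, on which the tree terms depend,
and, downwards, over the number of legs, on which the loop term depends. -/
theorem exists_lipBound (hK : IsCutoff K) (hP₁ : ∀ s m p, IsPln (P₁ s m p))
    (hP₂ : ∀ s m p, IsPln (P₂ s m p)) (d : ℕ) : ∀ r : PertOrder, r.degree = d →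
    ∀ n p, 1 ≤ n → ∃ Q, IsPln Q ∧ LipBound K P₁ P₂ r n p Q := by
  induction d using Nat.strong_induction_on with
  | _ d ihd =>
    intro r hr
    have hlow : ∀ s : PertOrder, s.degree < r.degree → ∀ m p, 1 ≤ m →
        ∃ Q, IsPln Q ∧ LipBound K P₁ P₂ s m p Q := fun s hs m p hm =>
      ihd s.degree (hr ▸ hs) s rfl m p hm
    have key : ∀ j n, 3 * r.degree + 2 < n + j → 1 ≤ n →
        ∀ p, ∃ Q, IsPln Q ∧ LipBound K P₁ P₂ r n p Q := by
      intro j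
      induction j with
      | zero => exact fun n hj hn p => ⟨0, isPln_zero, lipBound_of_many_legs hj p⟩
      | succ j ih =>
        intro n hj hn
        exact exists_lipBound_step hK hP₁ hP₂ hn hlow (ih (n + 2) (by omega) (by omega))
    exact fun n p hn => key (3 * r.degree + 2) n (by omega) hn p

end Integration

/-! ### Dimensionless vertex functions -/

section Dimensionless

variable {K : ℝ → ℝ} {P₁ P₂ : PertOrder → ℕ → ℕ → ℝ[X]} {ΛR MP A B₁ B₂ : ℝ}
  {L : ℝ → ℝ → PertOrder → ∀ n, Vertex n} {Λ t t' : ℝ} {n : ℕ} {r : PertOrder}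

/-- The power of the scale that makes the vertex function dimensionless. -/
noncomputable def dimFactor (Λ : ℝ) (r : PertOrder) (n : ℕ) : ℝ :=
  Λ ^ ((n : ℤ) - 4 + ord1 r - ordNR r)

lemma dimFactor_pos (hΛ : 0 < Λ) (r : PertOrder) (n : ℕ) : 0 < dimFactor Λ r n := zpow_pos hΛ _

lemma momDeriv_dimless (L : ℝ → ℝ → PertOrder → ∀ n, Vertex n) (Λ t : ℝ) (r : PertOrder) {n : ℕ}
    (a : Fin n → Leg) (l : List (Fin n × Fin n × Fin 4)) (k : Fin n → Mom) :
    momDeriv l (dimless L Λ t r n a) k = (dimFactor Λ r n : ℂ) * momDeriv l (L Λ t r n a) k := by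
  simp only [momDeriv_eq_dirDeriv]
  exact congrFun (dirDeriv_const_mul _ (L Λ t r n a) dir l) k

lemma dimFactor_scale (hΛ : 0 < Λ) (hR : 0 < ΛR) (r : PertOrder) (n p : ℕ) :
    (Λ ^ p)⁻¹ * (Λ / ΛR) ^ ord1 r * (MP / Λ) ^ ordNR r =
      dimFactor Λ r n * (orderScale ΛR MP r * Λ ^ (4 - n : ℤ) * Λ⁻¹ ^ p) := by
  have h1 : dimFactor Λ r n * Λ ^ (4 - n : ℤ) = Λ ^ ord1 r * (Λ ^ ordNR r)⁻¹ := by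
    rw [dimFactor, ← zpow_add₀ hΛ.ne', ← zpow_natCast, ← zpow_natCast Λ (ordNR r), ← zpow_neg,
      ← zpow_add₀ hΛ.ne']
    congr 1
    ring
  calc (Λ ^ p)⁻¹ * (Λ / ΛR) ^ ord1 r * (MP / Λ) ^ ordNR r
      = (Λ ^ ord1 r * (Λ ^ ordNR r)⁻¹) * orderScale ΛR MP r * Λ⁻¹ ^ p := by
        rw [orderScale, div_pow, div_pow, inv_pow, inv_pow]
        field_simp
    _ = _ := by rw [← h1]; ring

/-- For irrelevant derivatives the bare data are linear in `t`, so that their differences are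
controlled by the derivative with respect to `t`. -/
lemma bare_difference (hMP : 0 < MP) (hshape : BareShape MP L) {r : PertOrder} (hn : 1 ≤ n)
    {a : Fin n → Leg} {l : List (Fin n × Fin n × Fin 4)} (hl : 6 ≤ n + l.length) {k : Fin n → Mom}
    (hk : ∑ i, k i = 0) (ht : t ∈ Icc (0 : ℝ) 1) (ht' : t' ∈ Icc (0 : ℝ) 1) :
    dimFactor MP r n * ‖momDeriv l (L MP t r n a) k - momDeriv l (L MP t' r n a) k‖ =
      |t - t'| * ‖tDeriv L MP t r n a l k‖ := by
  have hlin := fun s hs => hshape s hs r n hn l hl a k hk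
  have hder : tDeriv L MP t r n a l k = momDeriv l (dimless L MP 1 r n a) k := by
    have h1 : HasDerivWithinAt (fun s : ℝ => (s : ℂ) * momDeriv l (dimless L MP 1 r n a) k)
        (momDeriv l (dimless L MP 1 r n a) k) (Icc 0 1) t := by
      simpa using ((Complex.ofRealCLM.hasDerivAt (x := t)).mul_const
        (momDeriv l (dimless L MP 1 r n a) k)).hasDerivWithinAt
    exact (h1.congr hlin (hlin t ht)).derivWithin (uniqueDiffOn_Icc zero_lt_one t ht)
  have hd := dimFactor_pos hMP r n
  calc dimFactor MP r n * ‖momDeriv l (L MP t r n a) k - momDeriv l (L MP t' r n a) k‖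
      = ‖(dimFactor MP r n : ℂ) *
          (momDeriv l (L MP t r n a) k - momDeriv l (L MP t' r n a) k)‖ := by
        rw [norm_mul, Complex.norm_real, Real.norm_of_nonneg hd.le]
    _ = ‖momDeriv l (dimless L MP t r n a) k - momDeriv l (dimless L MP t' r n a) k‖ := by
        rw [momDeriv_dimless, momDeriv_dimless, mul_sub]
    _ = ‖((t - t' : ℝ) : ℂ) * momDeriv l (dimless L MP 1 r n a) k‖ := by
        rw [hlin t ht, hlin t' ht']
        push_cast
        ring_nf
    _ = _ := by rw [norm_mul, Complex.norm_real, Real.norm_eq_abs, hder]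

lemma couplingTensor_sub {c : Coupling} {f g : Vertex c.legs} (hf : IsVertex f) (hg : IsVertex g)
    {b : Structures} {ρ : Fin (numComp c) → ℂ} (h : HasCoupling b c f ρ) (h' : HasCoupling b c g ρ) :
    couplingTensor c (fun a k => f a k - g a k) = 0 := by
  have he : couplingTensor c f = couplingTensor c g := by rw [h, h']
  funext a μ
  have h1 := congrFun (congrFun he a) μ
  simp only [couplingTensor, momDeriv_eq_dirDeriv] at h1 ⊢
  rw [dirDeriv_sub (hf.smooth a) (hg.smooth a)]
  exact sub_eq_zero.mpr h1

/-- The renormalization and improvement conditions fix all the Taylor coefficients at zero momentum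
with `n + p ≤ 5` independently of `t`. -/
lemma renorm_difference (hlt : ΛR < MP) (hflow : IsFlow K A B₁ B₂ ΛR MP L) {b : Structures}
    {ρNR : ∀ c : Coupling, PertOrder → Fin (numComp c) → ℂ}
    (hren : RenormalizationConditions ΛR b L) (himp : ImprovementConditions ΛR b L ρNR)
    (ht : t ∈ Icc (0 : ℝ) 1) (ht' : t' ∈ Icc (0 : ℝ) 1) (r : PertOrder) (hn : 1 ≤ n)
    (a : Fin n → Leg) (l : List (Fin n × Fin n × Fin 4)) (hl : n + l.length ≤ 5) :
    momDeriv l (L ΛR t r n a) 0 = momDeriv l (L ΛR t' r n a) 0 := by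
  have hmem : ΛR ∈ Icc ΛR MP := left_mem_Icc.mpr hlt.le
  have hv := fun n hn => hflow.vertex ΛR hmem t ht r n hn
  have hv' := fun n hn => hflow.vertex ΛR hmem t' ht' r n hn
  have h := momDeriv_eq_zero_of_couplings (V := fun n a k => L ΛR t r n a k - L ΛR t' r n a k)
    (fun n hn => (hv n hn).sub (hv' n hn)) (fun c => ?_) hn a l hl
  · rw [momDeriv_eq_dirDeriv, dirDeriv_sub ((hv n hn).smooth a) ((hv' n hn).smooth a)] at h
    exact sub_eq_zero.mp h
  · have hc : 1 ≤ c.legs := by cases c <;> simp [Coupling.legs]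
    have hs := fun ρ => couplingTensor_sub (b := b) (ρ := ρ) (hv c.legs hc) (hv' c.legs hc)
    cases c with
    | rho1 => exact hs _ (hren.rho1 t ht r) (hren.rho1 t' ht' r)
    | rho2 => exact hs _ (hren.rho2 t ht r) (hren.rho2 t' ht' r)
    | rho3 => exact hs _ (hren.rho3 t ht r) (hren.rho3 t' ht' r)
    | rho4 => exact hs _ (hren.rho4 t ht r) (hren.rho4 t' ht' r)
    | rho5 => exact hs _ (hren.rho5 t ht r) (hren.rho5 t' ht' r)
    | rho6 => exact hs _ (himp.rho6 t ht r) (himp.rho6 t' ht' r)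
    | rho7 => exact hs _ (himp.rho7 t ht r) (himp.rho7 t' ht' r)
    | rho8 => exact hs _ (himp.rho8 t ht r) (himp.rho8 t' ht' r)

lemma norm_derivWithin_le_of_lipschitz {f : ℝ → ℂ} {s : Set ℝ} {C : ℝ} (hC : 0 ≤ C)
    (h : ∀ u ∈ s, ‖f u - f t‖ ≤ C * |u - t|) :
    ‖derivWithin f s t‖ ≤ C := by
  by_cases hu : (𝓝[s \ {t}] t).NeBot
  · by_cases hd : DifferentiableWithinAt ℝ f s t
    · have hs := (hasDerivWithinAt_iff_tendsto_slope.mp hd.hasDerivWithinAt).norm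
      refine le_of_tendsto hs ?_
      filter_upwards [self_mem_nhdsWithin] with u hus
      have hne : 0 < |u - t| := abs_pos.mpr (sub_ne_zero.mpr hus.2)
      rw [slope_def_module, norm_smul, norm_inv, Real.norm_eq_abs, inv_mul_le_iff₀ hne, mul_comm]
      exact h u hus.1
    · rw [derivWithin_zero_of_not_differentiableWithinAt hd, norm_zero]
      exact hC
  · rw [derivWithin_zero_of_not_uniqueDiffWithinAt, norm_zero]
    · exact hC
    · rw [uniqueDiffWithinAt_iff_accPt, accPt_principal_iff_nhdsWithin]
      exact hu

end Dimensionless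

/-- The hypotheses of the theorem in the form used by the induction. -/
lemma diffSetting_of_hypotheses {K : ℝ → ℝ} {P₁ P₂ : PertOrder → ℕ → ℕ → ℝ[X]}
    {ΛR MP A B₁ B₂ : ℝ} {b : Structures} {ρNR : ∀ c : Coupling, PertOrder → Fin (numComp c) → ℂ}
    {L : ℝ → ℝ → PertOrder → ∀ n, Vertex n} (hR : 0 < ΛR) (hlt : ΛR < MP) (hB₁ : |B₁| ≤ ΛR ^ 2)
    (hB₂ : |B₂| ≤ ΛR ^ 2) (hflow : IsFlow K A B₁ B₂ ΛR MP L)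
    (hren : RenormalizationConditions ΛR b L) (himp : ImprovementConditions ΛR b L ρNR)
    (hshape : BareShape MP L)
    (hbound : ∀ Λ ∈ Icc ΛR MP, ∀ t ∈ Icc (0 : ℝ) 1, ∀ (r : PertOrder) (n : ℕ), 1 ≤ n →
      ∀ (a : Fin n → Leg) (l : List (Fin n × Fin n × Fin 4)),
      NormLE Λ (momDeriv l (dimless L Λ t r n a))
        ((Λ ^ l.length)⁻¹ * (Λ / ΛR) ^ ord1 r * (MP / Λ) ^ ordNR r *
          (P₁ r n l.length).eval (Real.log (MP / ΛR))))
    (hbare : ∀ t ∈ Icc (0 : ℝ) 1, ∀ (r : PertOrder) (n : ℕ), 1 ≤ n →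
      ∀ (a : Fin n → Leg) (l : List (Fin n × Fin n × Fin 4)), 6 ≤ n + l.length →
      NormLE MP (tDeriv L MP t r n a l)
        ((MP ^ l.length)⁻¹ * (MP / ΛR) ^ ord1 r *
          (P₂ r n l.length).eval (Real.log (MP / ΛR)))) :
    DiffSetting K P₁ P₂ ΛR MP A B₁ B₂ L where
  pos := hR
  lt := hlt
  mass₁ := hB₁
  mass₂ := hB₂
  flow := hflow
  bound := by
    intro Λ hΛ t ht r n hn a l k hk
    have hpos : 0 < Λ := hR.trans_le hΛ.1
    have hd := dimFactor_pos hpos r n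
    have h := hbound Λ hΛ t ht r n hn a l k hk.1 hk.2
    rw [momDeriv_dimless, norm_mul, Complex.norm_real, Real.norm_of_nonneg hd.le,
      dimFactor_scale hpos hR, mul_assoc (dimFactor Λ r n)] at h
    exact le_of_mul_le_mul_left h hd
  bare := by
    intro t ht t' ht' r n hn a l k hl hk
    have hMP : 0 < MP := hR.trans hlt
    have hd := dimFactor_pos hMP r n
    have h := hbare t ht r n hn a l hl k hk.1 hk.2
    have hs := dimFactor_scale (MP := MP) hMP hR r n l.length
    rw [div_self hMP.ne', one_pow, mul_one] at hs
    rw [hs] at h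
    refine le_of_mul_le_mul_left ?_ hd
    rw [bare_difference hMP hshape hn hl hk.1 ht ht']
    refine (mul_le_mul_of_nonneg_left h (abs_nonneg _)).trans (le_of_eq ?_)
    ring
  renorm := fun t ht t' ht' r n hn a l hl =>
    renorm_difference hlt hflow hren himp ht ht' r hn a l hl

end GravFlow

theorem mainTheorem2
    (K : ℝ → ℝ) (hK : IsCutoff K)
    (P₁ P₂ : PertOrder → ℕ → ℕ → ℝ[X])
    (hP₁ : ∀ r n p, IsPln (P₁ r n p)) (hP₂ : ∀ r n p, IsPln (P₂ r n p)) :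
    ∃ Q : PertOrder → ℕ → ℕ → ℝ[X], (∀ r n p, IsPln (Q r n p)) ∧
      ∀ (ΛR MP A B₁ B₂ : ℝ) (b : Structures)
        (ρNR : ∀ c : Coupling, PertOrder → Fin (numComp c) → ℂ)
        (L : ℝ → ℝ → PertOrder → ∀ n, Vertex n),
        0 < ΛR → ΛR < MP →
        |A| ≤ ΛR ^ 3 → |B₁| ≤ ΛR ^ 2 → |B₂| ≤ ΛR ^ 2 →
        IsFlow K A B₁ B₂ ΛR MP L →
        RenormalizationConditions ΛR b L →
        ImprovementConditions ΛR b L ρNR →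
        BareShape MP L →
        (∀ Λ ∈ Icc ΛR MP, ∀ t ∈ Icc (0 : ℝ) 1, ∀ (r : PertOrder) (n : ℕ), 1 ≤ n →
          ∀ (a : Fin n → Leg) (l : List (Fin n × Fin n × Fin 4)),
          NormLE Λ (momDeriv l (dimless L Λ t r n a))
            ((Λ ^ l.length)⁻¹ * (Λ / ΛR) ^ ord1 r * (MP / Λ) ^ ordNR r *
              (P₁ r n l.length).eval (Real.log (MP / ΛR)))) →
        (∀ t ∈ Icc (0 : ℝ) 1, ∀ (r : PertOrder) (n : ℕ), 1 ≤ n →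
          ∀ (a : Fin n → Leg) (l : List (Fin n × Fin n × Fin 4)), 6 ≤ n + l.length →
          NormLE MP (tDeriv L MP t r n a l)
            ((MP ^ l.length)⁻¹ * (MP / ΛR) ^ ord1 r *
              (P₂ r n l.length).eval (Real.log (MP / ΛR)))) →
        ∀ Λ ∈ Icc ΛR MP, ∀ t ∈ Icc (0 : ℝ) 1, ∀ (r : PertOrder) (n : ℕ), 1 ≤ n →
          ∀ (a : Fin n → Leg) (l : List (Fin n × Fin n × Fin 4)),
          NormLE Λ (tDeriv L Λ t r n a l)
            ((Λ ^ l.length)⁻¹ * (Λ / ΛR) ^ ord1 r * (MP / Λ) ^ ordNR r * (Λ / MP) ^ 2 *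
              (Q r n l.length).eval (Real.log (MP / ΛR))) := by
  have hex : ∀ r n p, ∃ Q, IsPln Q ∧ (1 ≤ n → LipBound K P₁ P₂ r n p Q) := by
    intro r n p
    rcases Nat.eq_zero_or_pos n with h | h
    · exact ⟨0, isPln_zero, fun h1 => absurd h1 (by omega)⟩
    · obtain ⟨Q, hQ, hQb⟩ := exists_lipBound hK hP₁ hP₂ r.degree r rfl n p h
      exact ⟨Q, hQ, fun _ => hQb⟩
  choose Q hQ hQb using hex
  refine ⟨Q, hQ, ?_⟩
  intro ΛR MP A B₁ B₂ b ρNR L hR hlt _ hB₁ hB₂ hflow hren himp hshape hbound hbare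
    Λ hΛ t ht r n hn a l k hk0 hk
  have S := diffSetting_of_hypotheses hR hlt hB₁ hB₂ hflow hren himp hshape hbound hbare
  have hpos : 0 < Λ := hR.trans_le hΛ.1
  have hMP : 0 < MP := hR.trans hlt
  have hd := dimFactor_pos hpos r n
  have hQ0 := (hQ r n l.length).eval_nonneg S.log_nonneg
  refine norm_derivWithin_le_of_lipschitz (by positivity) fun u hu => ?_
  have h := hQb r n l.length hn ΛR MP A B₁ B₂ L S Λ hΛ u hu t ht a l k rfl ⟨hk0, hk⟩
  rw [S.momDeriv_vertexDiff hΛ hu ht hn a l k] at h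
  rw [momDeriv_dimless, momDeriv_dimless, ← mul_sub, norm_mul, Complex.norm_real,
    Real.norm_of_nonneg hd.le, dimFactor_scale hpos hR]
  refine (mul_le_mul_of_nonneg_left h hd.le).trans (le_of_eq ?_)
  have e : Λ ^ (6 - n : ℤ) = Λ ^ (4 - n : ℤ) * Λ ^ 2 := by
    rw [← zpow_natCast, ← zpow_add₀ hpos.ne']
    congr 1
    push_cast
    ring
  rw [e, diffScale, div_pow]
  ring
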